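/- Let $\mathfrak g\neq 0$ be a finite-dimensional real semisimple Lie algebra without compact factor (no nonzero ideal of $\mathfrak g$ has a negative definite Killing form). A Cartan subspace of $\mathfrak g$ is a Lie subalgebra that is maximal among the abelian subalgebras diagonalizable over $\mathbb R$ (every element acts on $\mathfrak g$ by the adjoint representation as an endomorphism diagonalizable over $\mathbb R$). Let $r$ be the real rank of $\mathfrak g$, i.e. the dimension of its Cartan subspaces, let $\mathrm{Gr}_r(\mathfrak g)$ be the Grassmannian of $r$-dimensional linear subspaces of $\mathfrak g$, let $\mathrm{Cartan}(\mathfrak g)\subset \mathrm{Gr}_r(\mathfrak g)$ be the set of Cartan subspaces, and let its Chabauty compactification $\overline{\mathrm{Cartan}(\mathfrak g)}$ be its closure in $\mathrm{Gr}_r(\mathfrak g)$ for the usual (analytic) topology. (1) $\overline{\mathrm{Cartan}(\mathfrak g)}$ is a semialgebraic subset of $\mathrm{Gr}_r(\mathfrak g)$, but it is not closed for the real Zariski topology of $\mathrm{Gr}_r(\mathfrak g)$, i.e. in the Plücker embedding it is not the zero locus in $\mathrm{Gr}_r(\mathfrak g)$ of a set of real homogeneous polynomials. (2) For $\mathfrak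 g=\mathfrak{sl}_2(\mathbb R)$, the Cartan subspaces have dimension $r=1$, so that $\mathrm{Gr}_r(\mathfrak g)=\mathbb P(\mathfrak g)$; the analytic closure $\overline{\mathrm{Cartan}(\mathfrak g)}$ is the set of the lines of $\mathfrak g$ all of whose elements, as $2\times 2$ matrices, have only real eigenvalues, whereas the closure of $\mathrm{Cartan}(\mathfrak g)$ for the real Zariski topology is the whole of $\mathbb P(\mathfrak g)$. -/

import Mathlib

open Module

namespace CartanGr

/-! ### The Grassmannian of `r`-planes -/

section Grassmannian

variable (W : Type*) [AddCommGroup W] [Module ℝ W]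

/-- The Grassmannian of the `r`-dimensional linear subspaces of the real vector space `W`.
(Mathlib's `Module.Grassmannian` prescribes the rank of the quotient, not of the subspace.) -/
def Gr (r : ℕ) : Type _ := {V : Submodule ℝ W // finrank ℝ V = r}

/-- The `r`-frames of `W`, i.e. the linearly independent families of `r` vectors. -/
def Frame (r : ℕ) : Type _ := {v : Fin r → W // LinearIndependent ℝ v}

variable {W} {r : ℕ}

/-- The `r`-plane spanned by an `r`-frame. -/
def Frame.span (v : Frame W r) : Gr W r :=
  ⟨Submodule.span ℝ (Set.range v.1), by
    simpa using finrank_span_eq_card v.2⟩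

/-- Every `r`-plane is spanned by an `r`-frame. -/
theorem Frame.span_surjective [FiniteDimensional ℝ W] :
    Function.Surjective (Frame.span : Frame W r → Gr W r) := by
  rintro ⟨V, rfl⟩
  let b := finBasis ℝ V
  refine ⟨⟨fun i => (b i : W), ?_⟩, ?_⟩
  · exact b.linearIndependent.map' V.subtype (Submodule.ker_subtype V)
  · apply Subtype.ext
    change Submodule.span ℝ (Set.range (V.subtype ∘ b)) = V
    rw [Set.range_comp, Submodule.span_image, b.span_eq, Submodule.map_top,
      Submodule.range_subtype]

/-! ### The analytic topology -/

/-- The topology of the set of frames, as a subset of the finite-dimensional space `W ^ r`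
(whose usual topology is its module topology). -/
instance : TopologicalSpace (Frame W r) :=
  TopologicalSpace.induced Subtype.val (moduleTopology ℝ (Fin r → W))

/-- The usual (analytic) topology of the Grassmannian: the quotient topology for the map
that sends a frame to its span. -/
instance : TopologicalSpace (Gr W r) :=
  TopologicalSpace.coinduced Frame.span inferInstance

/-! ### Polynomial functions and semialgebraic sets

Polynomial functions on `W` are written without a choice of coordinates: a polynomial whose
indeterminates are the linear forms on `W` is evaluated by giving each linear form its value. -/

/-- The value at `w` of the polynomial function on `W` given by `F`. -/
noncomputable def polyEval (F : MvPolynomial (Dual ℝ W) ℝ) (w : W) : ℝ :=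
  MvPolynomial.eval (fun φ : Dual ℝ W => φ w) F

/-- The semialgebraic subsets of a finite-dimensional real vector space: the smallest Boolean
algebra of subsets that contains the sets `{F > 0}`, for `F` a polynomial function. -/
inductive IsSemialgebraic : Set W → Prop
  | pos (F : MvPolynomial (Dual ℝ W) ℝ) : IsSemialgebraic {w | 0 < polyEval F w}
  | compl {S : Set W} : IsSemialgebraic S → IsSemialgebraic Sᶜ
  | inter {S T : Set W} : IsSemialgebraic S → IsSemialgebraic T → IsSemialgebraic (S ∩ T)

/-- A subset `S` of the Grassmannian is semialgebraic if the set of the frames that span a member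
of `S` is a semialgebraic subset of `W ^ r`. (For `r = 1` this says that the cone without its
vertex over `S ⊆ ℙ(W)` is semialgebraic. In general, spanning is a regular map with regular local
sections over the standard affine charts, so that this is semialgebraicity in these charts.) -/
def IsSemialgebraicGr (S : Set (Gr W r)) : Prop :=
  IsSemialgebraic {v : Fin r → W | ∃ h : LinearIndependent ℝ v, Frame.span ⟨v, h⟩ ∈ S}

/-! ### The real Zariski topology -/

/-- The Plücker vector `v₁ ∧ ⋯ ∧ vᵣ` of a frame; up to a nonzero factor it depends only on the
span of the frame. -/
noncomputable def Frame.plucker (v : Frame W r) : ⋀[ℝ]^r W := exteriorPower.ιMulti ℝ r v.1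

/-- A subset of the Grassmannian is Zariski-closed if, in the Plücker embedding into `ℙ(Λ^r W)`,
it is the zero locus in the Grassmannian of a set of homogeneous polynomials. -/
def IsZariskiClosed (S : Set (Gr W r)) : Prop :=
  ∃ P : Set (MvPolynomial (Dual ℝ (⋀[ℝ]^r W)) ℝ),
    (∀ F ∈ P, ∃ d : ℕ, F.IsHomogeneous d) ∧
    ∀ v : Frame W r, v.span ∈ S ↔ ∀ F ∈ P, polyEval F v.plucker = 0

/-- The Zariski closure: the intersection of all Zariski-closed sets that contain `S`. -/
def zariskiClosure (S : Set (Gr W r)) : Set (Gr W r) :=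
  ⋂₀ {T | IsZariskiClosed T ∧ S ⊆ T}

end Grassmannian

/-! ### Cartan subspaces of a real Lie algebra -/

section Cartan

variable {𝔤 : Type*} [LieRing 𝔤] [LieAlgebra ℝ 𝔤]

/-- An abelian Lie subalgebra that is diagonalizable over `ℝ`: each of its elements acts on `𝔤`,
by the adjoint representation, as an endomorphism diagonalizable over `ℝ`. -/
structure IsSplitAbelian (𝔞 : LieSubalgebra ℝ 𝔤) : Prop where
  abelian : IsLieAbelian 𝔞
  diagonalizable : ∀ x ∈ 𝔞, ⨆ μ : ℝ, (LieAlgebra.ad ℝ 𝔤 x).eigenspace μ = ⊤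

/-- A Cartan subspace of `𝔤`: a Lie subalgebra that is maximal among the abelian ones which are
diagonalizable over `ℝ`. -/
def IsCartanSubspace (𝔞 : LieSubalgebra ℝ 𝔤) : Prop :=
  Maximal IsSplitAbelian 𝔞

variable (𝔤) in
/-- The set of the Cartan subspaces of `𝔤`, as a subset of the Grassmannian of `r`-planes
(meant for `r` the real rank of `𝔤`, the common dimension of the Cartan subspaces). -/
def cartan (r : ℕ) : Set (Gr 𝔤 r) :=
  {V | ∃ 𝔞 : LieSubalgebra ℝ 𝔤, IsCartanSubspace 𝔞 ∧ 𝔞.toSubmodule = V.1}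

variable (𝔤) in
/-- The Chabauty compactification: the closure, in the analytic topology of the Grassmannian,
of the set of Cartan subspaces. -/
def chabauty (r : ℕ) : Set (Gr 𝔤 r) := closure (cartan 𝔤 r)

variable (𝔤) in
/-- `𝔤` has no compact factor: its only ideal with a negative definite Killing form is `0`. -/
def NoCompactFactor : Prop :=
  ∀ I : LieIdeal ℝ 𝔤, (∀ x : I, x ≠ 0 → killingForm ℝ I x x < 0) → I = ⊥

end Cartan

attribute [local instance 100] LieRing.ofAssociativeRing

/-- The real Lie algebra `𝔰𝔩₂(ℝ)` of real `2 × 2` matrices of trace zero,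
with the commutator bracket. -/
abbrev sl2 : LieSubalgebra ℝ (Matrix (Fin 2) (Fin 2) ℝ) := LieAlgebra.SpecialLinear.sl (Fin 2) ℝ

end CartanGr

namespace CartanGr

/-! ### Sign diagrams of finite families of real polynomials in one variable -/

section SignMatching

open Polynomial SignType

/-! Semialgebraicity is quantifier elimination. An endomorphism is diagonalizable over ℝ iff it has
a basis of eigenvectors, and maximality of a split abelian subalgebra need only be tested by
adjoining one element. In terms of a frame, being a Cartan subspace is therefore a first-order
formula over ℝ (`span_mem_cartan_iff`). So is the closure (`mem_closure_moduleTopology_iff`),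
because spanning is an open map and closures can be taken on frames (`Frame.span_mem_closure_iff`).
Quantifiers are removed by Tarski-Seidenberg (`IsSemialgebraic.exists_vec`). It rests on the
Cohen-Hörmander algorithm: in a finite family closed under derivatives, truncations, leading
coefficients and pseudo-remainders, the signs of the constant members determine the whole sign
diagram up to an increasing bijection of ℝ (`EliminationClosed.exists_orderIso`).

Failure of Zariski closedness comes from a pencil. The Killing form is nonnegative on split
elements, hence on every plane of the closure (`killingForm_nonneg_of_mem_chabauty`). A restricted
root `χ` of a Cartan subspace `𝔞` gives `e`, `f` in the root spaces of `χ` and `-χ` with `[e, f]` in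
`𝔞` and `χ [e, f] = 2` (`IsCartanSubspace.exists_triple`). The planes `ker χ ⊕ ℝ (e + t f)` have
Plücker vectors affine in `t`. For `t > 0` they are conjugates of `𝔞`
(`IsCartanSubspace.exists_rotate`), so a Zariski-closed set containing the closure contains them for
all `t`. At `t = -1` the plane contains `e - f`, whose Killing norm is negative.

The structure theory behind the triple uses the real part of the Jordan decomposition instead of a
Cartan involution. The real part of `ad x` is a polynomial in `ad x` and a derivation
(`realPart_ad_lie`), hence it is `ad y` with `y` split. The trace of `D * realPart D` is a sum of
squares, so it vanishes only if the real part does. If all real parts vanished, the Killing form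
would be negative definite, which is excluded by the absence of compact factors.

For `𝔰𝔩₂(ℝ)` everything is read off from the quadratic form `-det`: nonzero split elements are those
where it is positive, real eigenvalues mean that it is nonnegative, and adding a large multiple of a
diagonal matrix makes it positive, so every line lies on a pencil with infinitely many Cartan
subspaces. -/

theorem sign_eval_eq_of_forall_ne_zero {p : ℝ[X]} {s t : ℝ}
    (h : ∀ x ∈ Set.uIcc s t, p.eval x ≠ 0) : sign (p.eval s) = sign (p.eval t) := by
  have hc : ContinuousOn (fun x => p.eval x) (Set.uIcc s t) := p.continuous.continuousOn
  have hiv := intermediate_value_uIcc hc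
  have hs := h s Set.left_mem_uIcc
  have ht := h t Set.right_mem_uIcc
  by_contra hne
  have h0 : (0 : ℝ) ∈ Set.uIcc (p.eval s) (p.eval t) := by
    rw [Set.mem_uIcc]
    rcases lt_or_gt_of_ne hs with h1 | h1 <;> rcases lt_or_gt_of_ne ht with h2 | h2
    · simp [sign_neg h1, sign_neg h2] at hne
    · exact Or.inl ⟨h1.le, h2.le⟩
    · exact Or.inr ⟨h2.le, h1.le⟩
    · simp [sign_pos h1, sign_pos h2] at hne
  obtain ⟨x, hx, hx0⟩ := hiv h0
  exact h x hx hx0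

/-- The derivative keeps the sign it has at `u`. The left end is left out of the hypothesis because
in the applications it may be a zero of the derivative. -/
theorem strictMonoOn_of_derivative_ne_zero {p : ℝ[X]} {s t u : ℝ}
    (hu : u ∈ Set.Ioc s t) (hut : ∀ x ∈ Set.Ioc s t, p.derivative.eval x ≠ 0)
    (hpos : 0 < p.derivative.eval u) :
    StrictMonoOn (fun x => p.eval x) (Set.Icc s t) := by
  apply strictMonoOn_of_deriv_pos (convex_Icc s t) p.continuous.continuousOn
  intro x hx
  rw [interior_Icc] at hx
  rw [Polynomial.deriv]
  have := sign_eval_eq_of_forall_ne_zero (p := p.derivative) (s := u) (t := x) (by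
    intro y hy
    apply hut
    rcases Set.mem_uIcc.1 hy with hy | hy
    · exact ⟨by linarith [hu.1, hy.1], by linarith [hy.2, hx.2]⟩
    · exact ⟨by linarith [hx.1, hy.1], by linarith [hy.2, hu.2]⟩)
  rw [sign_pos hpos] at this
  exact sign_eq_one_iff.1 this.symm

/-- Going left from a point where an increasing polynomial is positive, one meets a root or
a point of the exceptional set `Z` where the polynomial is still nonnegative. -/
theorem exists_root_or_nonneg_left {p : ℝ[X]} {Z : Set ℝ} (hZ : Z.Finite)
    (hp : 0 < p.natDegree) (hroots : ∀ x, p.derivative.eval x = 0 → x ∈ Z) {t : ℝ} (ht : t ∉ Z)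
    (hd : 0 < p.derivative.eval t) (hpt : 0 < p.eval t) :
    (∃ u < t, p.eval u = 0 ∧ ∀ x ∈ Set.Icc u t, x ∉ Z) ∨
    (∃ z ∈ Z, z < t ∧ (∀ x ∈ Set.Ioc z t, x ∉ Z) ∧ 0 ≤ p.eval z) := by
  by_cases hne : (Z ∩ Set.Iio t).Nonempty
  · obtain ⟨z, ⟨hzZ, hzt⟩, hmax⟩ := Set.exists_max_image _ id (hZ.inter_of_left _) hne
    have hzt : z < t := hzt
    have hav : ∀ x ∈ Set.Ioc z t, x ∉ Z := by
      intro x hx hxZ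
      rcases hx.2.lt_or_eq with h | h
      · exact absurd (hmax x ⟨hxZ, h⟩) (not_le.2 hx.1)
      · exact ht (h ▸ hxZ)
    rcases le_or_gt 0 (p.eval z) with h0 | h0
    · exact Or.inr ⟨z, hzZ, hzt, hav, h0⟩
    · left
      obtain ⟨u, hu, hu0⟩ := intermediate_value_Ioo hzt.le
        (f := fun x => p.eval x) p.continuous.continuousOn ⟨h0, hpt⟩
      exact ⟨u, hu.2, hu0, fun x hx => hav x ⟨by linarith [hu.1, hx.1], hx.2⟩⟩
  · left
    have hav : ∀ x ≤ t, x ∉ Z := by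
      intro x hx hxZ
      rcases hx.lt_or_eq with h | h
      · exact hne ⟨x, hxZ, h⟩
      · exact ht (h ▸ hxZ)
    have hcomp : 0 < (p.comp (-X)).degree := by
      rw [← natDegree_pos_iff_degree_pos, natDegree_comp]; simpa using hp
    have hlim := (p.comp (-X)).abs_tendsto_atTop hcomp
    obtain ⟨y, hy, hyt⟩ := ((hlim.eventually_gt_atTop (p.eval t)).and
      (Filter.eventually_gt_atTop (-t))).exists
    have hyt' : -y < t := by linarith
    have hmono : StrictMonoOn (fun x => p.eval x) (Set.Icc (-y) t) :=
      strictMonoOn_of_derivative_ne_zero (u := t) ⟨hyt', le_rfl⟩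
        (fun x hx h => hav x hx.2 (hroots x h)) hd
    have hlt := hmono ⟨le_rfl, hyt'.le⟩ ⟨hyt'.le, le_rfl⟩ hyt'
    -- `y` was chosen with `|p(-y)| > p(t)`, while monotonicity gives `p(-y) < p(t)`; only a
    -- negative value allows both.
    have hneg : p.eval (-y) < 0 := by
      simp only [eval_comp, eval_neg, eval_X] at hy
      by_contra hcon
      rw [abs_of_nonneg (not_lt.1 hcon)] at hy
      exact absurd hlt (not_lt.2 hy.le)
    obtain ⟨u, hu, hu0⟩ := intermediate_value_Ioo hyt'.le
        (f := fun x => p.eval x) p.continuous.continuousOn ⟨hneg, hpt⟩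
    exact ⟨u, hu.2, hu0, fun x hx => hav x hx.2⟩

/-- The mirror image of the previous lemma, applied to `-p(-X)`, which again has positive derivative
at the reflected point. -/
theorem exists_root_or_nonpos_right {p : ℝ[X]} {Z : Set ℝ} (hZ : Z.Finite)
    (hp : 0 < p.natDegree) (hroots : ∀ x, p.derivative.eval x = 0 → x ∈ Z) {t : ℝ} (ht : t ∉ Z)
    (hd : 0 < p.derivative.eval t) (hpt : p.eval t < 0) :
    (∃ u > t, p.eval u = 0 ∧ ∀ x ∈ Set.Icc t u, x ∉ Z) ∨
    (∃ z ∈ Z, t < z ∧ (∀ x ∈ Set.Ico t z, x ∉ Z) ∧ p.eval z ≤ 0) := by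
  have key := exists_root_or_nonneg_left (p := -(p.comp (-X))) (Z := (fun x => -x) ⁻¹' Z)
    (t := -t) (hZ.preimage neg_injective.injOn)
    (by rw [natDegree_neg, natDegree_comp]; simpa using hp)
    (by intro x hx; exact hroots _ (by simpa [derivative_comp] using hx))
    (by simpa using ht) (by simpa [derivative_comp] using hd) (by simpa using hpt)
  rcases key with ⟨u, hu, hu0, hav⟩ | ⟨z, hz, hzt, hav, h0⟩
  · refine Or.inl ⟨-u, by simpa using neg_lt_neg hu, by simpa using hu0, fun x hx => ?_⟩
    have := hav (-x) ⟨by linarith [hx.2], by linarith [hx.1]⟩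
    simpa using this
  · refine Or.inr ⟨-z, hz, by linarith, fun x hx => ?_, by simpa using h0⟩
    have := hav (-x) ⟨by linarith [hx.2], by linarith [hx.1]⟩
    simpa using this

theorem exists_orderIso_apply_eq_aux {a b c d : ℝ} (hac : a < c) (hcd : c ≤ d) (hdb : d < b) :
    ∃ θ : ℝ ≃o ℝ, θ c = d ∧ (∀ x, x ≤ a → θ x = x) ∧ ∀ x, b ≤ x → θ x = x := by
  have hcb : c < b := hcd.trans_lt hdb
  set l : ℝ → ℝ := fun x => a + (d - a) / (c - a) * (x - a) with hl
  set m : ℝ → ℝ := fun x => b - (b - d) / (b - c) * (b - x) with hm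
  have h1 : 1 ≤ (d - a) / (c - a) := by rw [le_div_iff₀ (by linarith)]; linarith
  have h2 : (b - d) / (b - c) ≤ 1 := by rw [div_le_iff₀ (by linarith)]; linarith
  have h2' : 0 < (b - d) / (b - c) := div_pos (by linarith) (by linarith)
  have hlmono : StrictMono l := fun x y hxy => by
    simp only [hl]; nlinarith
  have hmmono : StrictMono m := fun x y hxy => by
    simp only [hm]; nlinarith
  -- The lines `l` and `m` join `(c, d)` to `(a, a)` and to `(b, b)`. As `c ≤ d`, the broken line
  -- `min l m` is above the diagonal only between `a` and `b`, so the maximum with the identity is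
  -- the desired bijection.
  set θ : ℝ → ℝ := fun x => max x (min (l x) (m x)) with hθ
  have hmono : StrictMono θ := fun x y hxy => max_lt_max hxy (min_lt_min (hlmono hxy) (hmmono hxy))
  have hlow : ∀ x, x ≤ a → θ x = x := by
    intro x hx
    apply max_eq_left
    apply (min_le_left _ _).trans
    simp only [hl]; nlinarith
  have hhigh : ∀ x, b ≤ x → θ x = x := by
    intro x hx
    apply max_eq_left
    apply (min_le_right _ _).trans
    simp only [hm]; nlinarith
  have hcont : Continuous θ := by
    simp only [hθ, hl, hm]; fun_prop
  have hsurj : Function.Surjective θ := by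
    apply hcont.surjective
    · exact Filter.tendsto_atTop_mono (fun x => le_max_left _ _) Filter.tendsto_id
    · refine Filter.Tendsto.congr' ?_ Filter.tendsto_id
      filter_upwards [Filter.eventually_le_atBot a] with x hx using (hlow x hx).symm
  refine ⟨hmono.orderIsoOfSurjective θ hsurj, ?_, hlow, hhigh⟩
  have e1 : l c = d := by simp only [hl]; rw [div_mul_cancel₀ _ (by linarith)]; ring
  have e2 : m c = d := by simp only [hm]; rw [div_mul_cancel₀ _ (by linarith)]; ring
  change max c (min (l c) (m c)) = d
  rw [e1, e2, min_self, max_eq_right hcd]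

theorem exists_orderIso_apply_eq {a b c d : ℝ} (hac : a < c) (hcb : c < b) (had : a < d)
    (hdb : d < b) :
    ∃ θ : ℝ ≃o ℝ, θ c = d ∧ (∀ x, x ≤ a → θ x = x) ∧ ∀ x, b ≤ x → θ x = x := by
  rcases le_total c d with h | h
  · exact exists_orderIso_apply_eq_aux hac h hdb
  · obtain ⟨θ, h1, h2, h3⟩ := exists_orderIso_apply_eq_aux had h hcb
    refine ⟨θ.symm, ?_, fun x hx => ?_, fun x hx => ?_⟩
    · rw [← h1]; exact θ.symm_apply_apply d
    · conv_lhs => rw [← h2 x hx]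
      exact θ.symm_apply_apply x
    · conv_lhs => rw [← h3 x hx]
      exact θ.symm_apply_apply x

/-- An open interval around a compact interval that still avoids a finite set. -/
theorem exists_Ioo_avoiding {Z : Set ℝ} (hZ : Z.Finite) {c d : ℝ}
    (h : ∀ x ∈ Set.uIcc c d, x ∉ Z) :
    ∃ a b, a < c ∧ c < b ∧ a < d ∧ d < b ∧ ∀ x ∈ Set.Ioo a b, x ∉ Z := by
  have hopen : IsOpen Zᶜ := hZ.isClosed.isOpen_compl
  have h1 := (Metric.isOpen_iff.1 hopen) (min c d) (h _ ⟨le_rfl, min_le_max⟩)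
  have h2 := (Metric.isOpen_iff.1 hopen) (max c d) (h _ ⟨min_le_max, le_rfl⟩)
  obtain ⟨ε, hε, hb⟩ := h1
  obtain ⟨δ, hδ, hb'⟩ := h2
  refine ⟨min c d - ε, max c d + δ, by linarith [min_le_left c d], by linarith [le_max_left c d],
    by linarith [min_le_right c d], by linarith [le_max_right c d], ?_⟩
  intro x hx
  rcases lt_or_ge x (min c d) with h3 | h3
  · exact hb (by rw [Metric.mem_ball, Real.dist_eq, abs_lt]; constructor <;> linarith [hx.1])
  · rcases lt_or_ge (max c d) x with h4 | h4
    · exact hb' (by rw [Metric.mem_ball, Real.dist_eq, abs_lt]; constructor <;> linarith [hx.2])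
    · exact h x ⟨h3, h4⟩

/-- The roots of the nonzero members of a family of polynomials. -/
def familyRoots {ι : Type*} (f : ι → ℝ[X]) : Set ℝ := {z | ∃ i, f i ≠ 0 ∧ (f i).eval z = 0}

theorem finite_familyRoots {ι : Type*} [Finite ι] (f : ι → ℝ[X]) : (familyRoots f).Finite := by
  have : familyRoots f ⊆ ⋃ i, {z | z ∈ (f i).roots} := by
    rintro z ⟨i, h0, hz⟩
    exact Set.mem_iUnion.2 ⟨i, (mem_roots h0).2 hz⟩
  refine (Set.finite_iUnion fun i => ?_).subset this
  exact (f i).roots.toFinset.finite_toSet.subset fun z hz => by simpa using hz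

/-- `φ` carries the sign diagram of the family `f` to that of the family `g`. -/
def SignMatch {ι : Type*} (f g : ι → ℝ[X]) (φ : ℝ ≃o ℝ) : Prop :=
  ∀ i t, sign ((f i).eval t) = sign ((g i).eval (φ t))

theorem SignMatch.eq_zero_iff {ι : Type*} {f g : ι → ℝ[X]} {φ : ℝ ≃o ℝ} (h : SignMatch f g φ)
    (i : ι) : f i = 0 ↔ g i = 0 := by
  constructor <;> intro h0 <;> apply Polynomial.funext <;> intro t
  · have := h i (φ.symm t)
    rw [h0] at this
    simpa [eq_comm (a := (0 : SignType))] using this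
  · have := h i t
    rw [h0] at this
    simpa using this

theorem SignMatch.mem_familyRoots_iff {ι : Type*} {f g : ι → ℝ[X]} {φ : ℝ ≃o ℝ}
    (h : SignMatch f g φ) (t : ℝ) : φ t ∈ familyRoots g ↔ t ∈ familyRoots f := by
  have (i : ι) : (f i).eval t = 0 ↔ (g i).eval (φ t) = 0 := by
    rw [← sign_eq_zero_iff, h i t, sign_eq_zero_iff]
  simp only [familyRoots, Set.mem_ofPred_eq, this, Ne, h.eq_zero_iff]

/-- No nonzero member of `g` vanishes on `(a, b)`, so moving points inside this interval changes no
sign. This is the freedom used to adjust a matching to one more polynomial. -/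
theorem SignMatch.comp {ι : Type*} {f g : ι → ℝ[X]} {φ : ℝ ≃o ℝ}
    (h : SignMatch f g φ) {a b : ℝ} (hav : ∀ x ∈ Set.Ioo a b, x ∉ familyRoots g)
    {θ : ℝ ≃o ℝ} (ha : ∀ x ≤ a, θ x = x) (hb : ∀ x, b ≤ x → θ x = x) :
    SignMatch f g (φ.trans θ) := by
  intro i t
  rw [h i t, OrderIso.trans_apply]
  by_cases ht : φ t ∈ Set.Ioo a b
  · by_cases h0 : g i = 0
    · simp [h0]
    · apply sign_eval_eq_of_forall_ne_zero
      intro x hx hx0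
      refine hav x ?_ ⟨i, h0, hx0⟩
      have h1 : a < θ (φ t) := by rw [← ha a le_rfl]; exact θ.strictMono ht.1
      have h2 : θ (φ t) < b := by rw [← hb b le_rfl]; exact θ.strictMono ht.2
      rcases Set.mem_uIcc.1 hx with hx | hx
      · exact ⟨by linarith [ht.1, hx.1], by linarith [hx.2]⟩
      · exact ⟨by linarith [hx.1], by linarith [ht.2, hx.2]⟩
  · rw [Set.mem_Ioo, not_and_or, not_lt, not_lt] at ht
    rcases ht with ht | ht
    · rw [ha _ ht]
    · rw [hb _ ht]

section Extension

variable {ι : Type*} [Finite ι] {f g : ι → ℝ[X]} {p q : ℝ[X]}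

theorem SignMatch.neg_pair {φ : ℝ ≃o ℝ} {t : ℝ} (h : sign (p.eval t) = sign (q.eval (φ t))) :
    sign ((-p).eval t) = sign ((-q).eval (φ t)) := by
  simpa [Left.sign_neg] using h

/-- A root of `p` corresponds to a root of `q` in the corresponding interval. -/
theorem SignMatch.exists_root {φ : ℝ ≃o ℝ} (h : SignMatch f g φ)
    (hq : 0 < q.natDegree) (hp : 0 < p.natDegree)
    (hp' : ∀ x, p.derivative.eval x = 0 → x ∈ familyRoots f)
    (hd : ∀ x, sign (p.derivative.eval x) = sign (q.derivative.eval (φ x)))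
    (hz : ∀ z ∈ familyRoots f, sign (p.eval z) = sign (q.eval (φ z)))
    {u : ℝ} (hu : u ∉ familyRoots f) (hpu : p.eval u = 0) :
    ∃ w, q.eval w = 0 ∧ ∀ x ∈ Set.uIcc (φ u) w, x ∉ familyRoots g := by
  wlog hpos : 0 < p.derivative.eval u generalizing p q
  · have := this (p := -p) (q := -q) (by simpa using hq) (by simpa using hp)
      (by simpa using hp') (fun x => by simpa [Left.sign_neg] using hd x)
      (fun z hz' => neg_pair (hz z hz')) (by simpa using hpu)
      (by
        have h1 : p.derivative.eval u ≠ 0 := fun h1 => hu (hp' u h1)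
        simpa using lt_of_le_of_ne (not_lt.1 hpos) h1)
    simpa using this
  have hu' : φ u ∉ familyRoots g := by rwa [h.mem_familyRoots_iff]
  have hqpos : 0 < q.derivative.eval (φ u) := by
    rw [← sign_eq_one_iff, ← hd, sign_pos hpos]
  have hq' : ∀ x, q.derivative.eval x = 0 → x ∈ familyRoots g := by
    intro x hx
    rw [← φ.apply_symm_apply x, h.mem_familyRoots_iff]
    apply hp'
    rw [← sign_eq_zero_iff, hd, φ.apply_symm_apply, hx, sign_zero]
  rcases lt_trichotomy (q.eval (φ u)) 0 with h0 | h0 | h0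
  · rcases exists_root_or_nonpos_right (finite_familyRoots g) hq hq' hu' hqpos h0 with
      ⟨w, hw, hw0, hav⟩ | ⟨z, hzZ, hzt, hav, hz0⟩
    · exact ⟨w, hw0, by rwa [Set.uIcc_of_le hw.le]⟩
    -- Before reaching a root of `q` one would meet a root `φ z` of the family with `q(φ z) ≤ 0`,
    -- hence `p(z) ≤ 0`; but `p` increases strictly from its zero `u` to `z`.
    · exfalso
      obtain ⟨z, rfl⟩ := φ.surjective z
      rw [h.mem_familyRoots_iff] at hzZ
      have huz : u < z := φ.lt_iff_lt.1 hzt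
      have hpz : p.eval z ≤ 0 := by
        by_contra hcon
        have := hz z hzZ
        rw [sign_pos (not_le.1 hcon), eq_comm, sign_eq_one_iff] at this
        linarith
      have hav' : ∀ x ∈ Set.Ico u z, p.derivative.eval x ≠ 0 := fun x hx h1 =>
        hav (φ x) ⟨φ.monotone hx.1, φ.strictMono hx.2⟩ ((h.mem_familyRoots_iff x).2 (hp' x h1))
      have hmono : StrictMonoOn (fun x => p.eval x) (Set.Icc u z) := by
        apply strictMonoOn_of_deriv_pos (convex_Icc u z) p.continuous.continuousOn
        intro x hx
        rw [interior_Icc] at hx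
        rw [Polynomial.deriv, ← sign_eq_one_iff, ← sign_pos hpos]
        refine (sign_eval_eq_of_forall_ne_zero fun y hy => hav' y ?_).symm
        rw [Set.uIcc_of_le hx.1.le] at hy
        exact ⟨hy.1, hy.2.trans_lt hx.2⟩
      have := hmono ⟨le_rfl, huz.le⟩ ⟨huz.le, le_rfl⟩ huz
      simp only [hpu] at this
      linarith
  · exact ⟨φ u, h0, by simpa using hu'⟩
  · rcases exists_root_or_nonneg_left (finite_familyRoots g) hq hq' hu' hqpos h0 with
      ⟨w, hw, hw0, hav⟩ | ⟨z, hzZ, hzt, hav, hz0⟩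
    · exact ⟨w, hw0, by rwa [Set.uIcc_of_ge hw.le]⟩
    · exfalso
      obtain ⟨z, rfl⟩ := φ.surjective z
      rw [h.mem_familyRoots_iff] at hzZ
      have huz : z < u := φ.lt_iff_lt.1 hzt
      have hpz : 0 ≤ p.eval z := by
        by_contra hcon
        have := hz z hzZ
        rw [sign_neg (not_le.1 hcon), eq_comm, sign_eq_neg_one_iff] at this
        linarith
      have hav' : ∀ x ∈ Set.Ioc z u, p.derivative.eval x ≠ 0 := fun x hx h1 =>
        hav (φ x) ⟨φ.strictMono hx.1, φ.monotone hx.2⟩ ((h.mem_familyRoots_iff x).2 (hp' x h1))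
      have hmono : StrictMonoOn (fun x => p.eval x) (Set.Icc z u) :=
        strictMonoOn_of_derivative_ne_zero (u := u) ⟨huz, le_rfl⟩ hav' hpos
      have := hmono ⟨le_rfl, huz.le⟩ ⟨huz.le, le_rfl⟩ huz
      simp only [hpu] at this
      linarith

/-- If roots correspond to roots, then all signs correspond. -/
theorem SignMatch.sign_eq {φ : ℝ ≃o ℝ} (h : SignMatch f g φ)
    (hp : 0 < p.natDegree)
    (hp' : ∀ x, p.derivative.eval x = 0 → x ∈ familyRoots f)
    (hd : ∀ x, sign (p.derivative.eval x) = sign (q.derivative.eval (φ x)))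
    (hz : ∀ z ∈ familyRoots f, sign (p.eval z) = sign (q.eval (φ z)))
    (hu : ∀ u, u ∉ familyRoots f → p.eval u = 0 → q.eval (φ u) = 0) (t : ℝ) :
    sign (p.eval t) = sign (q.eval (φ t)) := by
  by_cases ht : t ∈ familyRoots f
  · exact hz t ht
  wlog hpos : 0 < p.derivative.eval t generalizing p q
  · have := this (p := -p) (q := -q) (by simpa using hp)
      (by simpa using hp') (fun x => by simpa [Left.sign_neg] using hd x)
      (fun z hz' => neg_pair (hz z hz')) (by simpa using hu)
      (by
        have h1 : p.derivative.eval t ≠ 0 := fun h1 => ht (hp' t h1)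
        simpa using lt_of_le_of_ne (not_lt.1 hpos) h1)
    simpa [Left.sign_neg] using this
  have hqpos : 0 < q.derivative.eval (φ t) := by
    rw [← sign_eq_one_iff, ← hd, sign_pos hpos]
  have hq' : ∀ x, q.derivative.eval x = 0 → x ∈ familyRoots g := by
    intro x hx
    rw [← φ.apply_symm_apply x, h.mem_familyRoots_iff]
    apply hp'
    rw [← sign_eq_zero_iff, hd, φ.apply_symm_apply, hx, sign_zero]
  rcases lt_trichotomy (p.eval t) 0 with h0 | h0 | h0
  · rw [sign_neg h0, eq_comm, sign_eq_neg_one_iff]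
    have main : ∀ v, t < v → (∀ x ∈ Set.Ico t v, x ∉ familyRoots f) → q.eval (φ v) ≤ 0 →
        q.eval (φ t) < 0 := by
      intro v htv hav hv
      have hlt := φ.strictMono htv
      have hmono : StrictMonoOn (fun x => q.eval x) (Set.Icc (φ t) (φ v)) := by
        apply strictMonoOn_of_deriv_pos (convex_Icc _ _) q.continuous.continuousOn
        intro x hx
        rw [interior_Icc] at hx
        rw [Polynomial.deriv, ← sign_eq_one_iff, ← sign_pos hqpos]
        refine (sign_eval_eq_of_forall_ne_zero fun y hy hy0 => ?_).symm
        rw [Set.uIcc_of_le hx.1.le] at hy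
        have := hq' y hy0
        rw [← φ.apply_symm_apply y, h.mem_familyRoots_iff] at this
        refine hav _ ⟨?_, ?_⟩ this
        · rw [φ.le_symm_apply]; exact hy.1
        · rw [φ.symm_apply_lt]; exact hy.2.trans_lt hx.2
      have := hmono ⟨le_rfl, hlt.le⟩ ⟨hlt.le, le_rfl⟩ hlt
      simp only at this
      linarith
    rcases exists_root_or_nonpos_right (finite_familyRoots f) hp hp' ht hpos h0 with
      ⟨u, hut, hu0, hav⟩ | ⟨z, hzZ, hzt, hav, hz0⟩
    · exact main u hut (fun x hx => hav x ⟨hx.1, hx.2.le⟩)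
        (hu u (hav u ⟨hut.le, le_rfl⟩) hu0).le
    · refine main z hzt hav ?_
      by_contra hcon
      have := hz z hzZ
      rw [sign_pos (not_le.1 hcon), sign_eq_one_iff] at this
      linarith
  · rw [h0, hu t ht h0]
  · rw [sign_pos h0, eq_comm, sign_eq_one_iff]
    have main : ∀ v, v < t → (∀ x ∈ Set.Ioc v t, x ∉ familyRoots f) → 0 ≤ q.eval (φ v) →
        0 < q.eval (φ t) := by
      intro v htv hav hv
      have hlt := φ.strictMono htv
      have hav' : ∀ x ∈ Set.Ioc (φ v) (φ t), q.derivative.eval x ≠ 0 := by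
        intro y hy hy0
        have := hq' y hy0
        rw [← φ.apply_symm_apply y, h.mem_familyRoots_iff] at this
        refine hav _ ⟨?_, ?_⟩ this
        · rw [φ.lt_symm_apply]; exact hy.1
        · rw [φ.symm_apply_le]; exact hy.2
      have hmono : StrictMonoOn (fun x => q.eval x) (Set.Icc (φ v) (φ t)) :=
        strictMonoOn_of_derivative_ne_zero (u := φ t) ⟨hlt, le_rfl⟩ hav' hqpos
      have := hmono ⟨le_rfl, hlt.le⟩ ⟨hlt.le, le_rfl⟩ hlt
      simp only at this
      linarith
    rcases exists_root_or_nonneg_left (finite_familyRoots f) hp hp' ht hpos h0 with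
      ⟨u, hut, hu0, hav⟩ | ⟨z, hzZ, hzt, hav, hz0⟩
    · exact main u hut (fun x hx => hav x ⟨hx.1.le, hx.2⟩)
        (hu u (hav u ⟨le_rfl, hut.le⟩) hu0).ge
    · refine main z hzt hav ?_
      by_contra hcon
      have := hz z hzZ
      rw [sign_neg (not_le.1 hcon), sign_eq_neg_one_iff] at this
      linarith

/-- A sign matching extends to one more polynomial, if the derivative belongs to the family and
the signs at the roots of the family are known. -/
theorem SignMatch.extend (hq : 0 < q.natDegree) (hp : 0 < p.natDegree)
    {i₀ : ι} (hfi : f i₀ = p.derivative) (hgi : g i₀ = q.derivative)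
    {φ : ℝ ≃o ℝ} (h : SignMatch f g φ)
    (hz : ∀ z ∈ familyRoots f, sign (p.eval z) = sign (q.eval (φ z))) :
    ∃ ψ : ℝ ≃o ℝ, SignMatch f g ψ ∧ ∀ t, sign (p.eval t) = sign (q.eval (ψ t)) := by
  have hp0 : p.derivative ≠ 0 := by
    intro h0
    rw [derivative_eq_zero.1 h0] at hp
    exact lt_irrefl _ hp
  have hp' : ∀ x, p.derivative.eval x = 0 → x ∈ familyRoots f := fun x hx =>
    ⟨i₀, hfi ▸ hp0, hfi ▸ hx⟩
  have hd : ∀ {φ : ℝ ≃o ℝ}, SignMatch f g φ →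
      ∀ x, sign (p.derivative.eval x) = sign (q.derivative.eval (φ x)) := fun h x => by
    rw [← hfi, ← hgi]; exact h i₀ x
  -- The roots of `p` that `φ` does not yet send to roots of `q`. Each adjustment of `φ` repairs at
  -- least one of them and spoils none, so induction on their number terminates.
  let U (φ : ℝ ≃o ℝ) : Set ℝ := {u | u ∉ familyRoots f ∧ p.eval u = 0 ∧ q.eval (φ u) ≠ 0}
  have hU : ∀ φ, (U φ).Finite := fun φ =>
    (p.roots.toFinset.finite_toSet).subset fun u hu => by
      have : p ≠ 0 := by rintro rfl; simp at hp
      simpa [this] using hu.2.1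
  induction hn : (U φ).ncard using Nat.strong_induction_on generalizing φ with
  | _ n ih =>
    by_cases hempty : U φ = ∅
    · refine ⟨φ, h, h.sign_eq hp hp' (hd h) hz fun u hu hu0 => ?_⟩
      by_contra hcon
      exact (Set.eq_empty_iff_forall_notMem.1 hempty u) ⟨hu, hu0, hcon⟩
    obtain ⟨u, hu⟩ := Set.nonempty_iff_ne_empty.2 hempty
    obtain ⟨w, hw0, hav⟩ := h.exists_root hq hp hp' (hd h) hz hu.1 hu.2.1
    obtain ⟨a, b, hau, hub, haw, hwb, hab⟩ := exists_Ioo_avoiding (finite_familyRoots g) hav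
    obtain ⟨θ, hθu, hθa, hθb⟩ := exists_orderIso_apply_eq hau hub haw hwb
    have hid : ∀ x, φ x ∉ Set.Ioo a b → θ (φ x) = φ x := by
      intro x hx
      rw [Set.mem_Ioo, not_and_or, not_lt, not_lt] at hx
      rcases hx with hx | hx
      exacts [hθa _ hx, hθb _ hx]
    have h' : SignMatch f g (φ.trans θ) := h.comp hab hθa hθb
    refine ih (U (φ.trans θ)).ncard ?_ h' ?_ rfl
    · rw [← hn]
      refine Set.ncard_lt_ncard ?_ (hU φ)
      refine Set.ssubset_iff_of_subset ?_ |>.2 ⟨u, hu, fun hu' => hu'.2.2 ?_⟩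
      · rintro v ⟨hv, hv0, hv1⟩
        refine ⟨hv, hv0, ?_⟩
        by_cases hvI : φ v ∈ Set.Ioo a b
        · exfalso
          have huv : u ≠ v := by
            rintro rfl
            exact hv1 (by rw [OrderIso.trans_apply, hθu]; exact hw0)
          -- A second root `v` of `p` moved by `θ` is impossible by Rolle: `p'` belongs to the
          -- family and has no zero between `u` and `v`.
          have hno : ∀ x ∈ Set.uIcc u v, p.derivative.eval x ≠ 0 := by
            intro x hx hx0
            refine hab (φ x) ?_ ((h.mem_familyRoots_iff x).2 (hp' x hx0))
            rcases Set.mem_uIcc.1 hx with hx | hx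
            · exact ⟨hau.trans_le (φ.monotone hx.1), (φ.monotone hx.2).trans_lt hvI.2⟩
            · exact ⟨hvI.1.trans_le (φ.monotone hx.1), (φ.monotone hx.2).trans_lt hub⟩
          rcases lt_or_gt_of_ne huv with hlt | hlt
          · obtain ⟨x, hx, hx0⟩ := exists_deriv_eq_zero hlt p.continuous.continuousOn
              (hu.2.1.trans hv0.symm)
            rw [Polynomial.deriv] at hx0
            exact hno x (Set.uIcc_of_le hlt.le ▸ ⟨hx.1.le, hx.2.le⟩) hx0
          · obtain ⟨x, hx, hx0⟩ := exists_deriv_eq_zero hlt p.continuous.continuousOn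
              (hv0.trans hu.2.1.symm)
            rw [Polynomial.deriv] at hx0
            exact hno x (Set.uIcc_of_ge hlt.le ▸ ⟨hx.1.le, hx.2.le⟩) hx0
        · rwa [OrderIso.trans_apply, hid v hvI] at hv1
      · rw [OrderIso.trans_apply, hθu]; exact hw0
    · intro z hzf
      rw [hz z hzf, OrderIso.trans_apply, hid]
      intro hzI
      exact hab _ hzI ((h.mem_familyRoots_iff z).2 hzf)

end Extension

end SignMatching

end CartanGr

namespace CartanGr

/-! ### Elimination of one variable with parameters (Cohen-Hörmander) -/

section Parametric

open Polynomial SignType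

variable {A : Type*} [CommRing A]

theorem exists_pseudo_remainder_aux (G : A[X]) (hG : 0 < G.natDegree) (P : A[X]) :
    ∃ (k : ℕ) (Q R : A[X]), C (G.leadingCoeff ^ k) * P = Q * G + R ∧ R.natDegree < G.natDegree := by
  induction hn : P.natDegree using Nat.strong_induction_on generalizing P with
  | _ n ih =>
    rcases lt_or_ge P.natDegree G.natDegree with h | h
    · exact ⟨0, 0, P, by simp, h⟩
    · set T : A[X] := C P.leadingCoeff * X ^ (P.natDegree - G.natDegree) with hT
      -- Multiplying `P` by the leading coefficient of `G` permits cancelling the top term without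
      -- division in `A`; each round costs one power of that coefficient.
      set P' : A[X] := C G.leadingCoeff * P - T * G with hP'
      have hdeg : P'.natDegree < P.natDegree := by
        have hle : P'.natDegree ≤ P.natDegree := by
          refine (natDegree_sub_le _ _).trans (max_le (natDegree_C_mul_le _ _) ?_)
          refine natDegree_mul_le.trans ?_
          have : T.natDegree ≤ _ := natDegree_C_mul_X_pow_le P.leadingCoeff _
          omega
        refine lt_of_le_of_ne hle fun heq => ?_
        have hc : P'.coeff P.natDegree = 0 := by
          have e : P.natDegree = P.natDegree - G.natDegree + G.natDegree := by omega
          rw [hP', coeff_sub, coeff_C_mul, hT, mul_assoc, coeff_C_mul]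
          conv_lhs => enter [2, 2, 2]; rw [e]
          rw [add_comm (P.natDegree - G.natDegree), coeff_X_pow_mul]
          rw [coeff_natDegree, coeff_natDegree]; ring
        rw [← heq, coeff_natDegree, leadingCoeff_eq_zero] at hc
        rw [hc, natDegree_zero] at heq
        omega
      obtain ⟨k, Q, R, h1, h2⟩ := ih _ (hn ▸ hdeg) P' rfl
      refine ⟨k + 1, Q + C (G.leadingCoeff ^ k) * T, R, ?_, h2⟩
      have : C (G.leadingCoeff ^ (k + 1)) * P
          = C (G.leadingCoeff ^ k) * P' + C (G.leadingCoeff ^ k) * T * G := by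
        rw [hP', pow_succ, C_mul]; ring
      rw [this, h1]; ring

/-- Pseudo-division with an even power of the leading coefficient, so that signs are kept. -/
theorem exists_pseudo_remainder (P G : A[X]) :
    ∃ R : A[X], 0 < G.natDegree → R.natDegree < G.natDegree ∧
      ∃ (k : ℕ) (Q : A[X]), C (G.leadingCoeff ^ k * G.leadingCoeff ^ k) * P = Q * G + R := by
  by_cases hG : 0 < G.natDegree
  · obtain ⟨k, Q, R, h1, h2⟩ := exists_pseudo_remainder_aux G hG P
    refine ⟨C (G.leadingCoeff ^ k) * R, fun _ => ⟨(natDegree_C_mul_le _ _).trans_lt h2, k,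
      C (G.leadingCoeff ^ k) * Q, ?_⟩⟩
    rw [C_mul, mul_assoc, h1]; ring
  · exact ⟨0, fun h => absurd h hG⟩

/-- A pseudo-remainder of `P` by `G`. -/
noncomputable def pseudoRem (P G : A[X]) : A[X] := (exists_pseudo_remainder P G).choose

theorem natDegree_pseudoRem_lt (P : A[X]) {G : A[X]} (hG : 0 < G.natDegree) :
    (pseudoRem P G).natDegree < G.natDegree :=
  ((exists_pseudo_remainder P G).choose_spec hG).1

/-- At a root of the specialized `G` the pseudo-division identity says that the remainder is a
nonzero square times `P`. Signs of `P` at such roots are thus known from a polynomial of lower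
degree. -/
theorem sign_eval₂_pseudoRem (P : A[X]) {G : A[X]} (hG : 0 < G.natDegree) (σ : A →+* ℝ)
    (hlc : σ G.leadingCoeff ≠ 0) {z : ℝ} (hz : G.eval₂ σ z = 0) :
    sign ((pseudoRem P G).eval₂ σ z) = sign (P.eval₂ σ z) := by
  obtain ⟨k, Q, h⟩ := ((exists_pseudo_remainder P G).choose_spec hG).2
  change _ = Q * G + pseudoRem P G at h
  have := congrArg (eval₂ σ z) h
  rw [eval₂_mul, eval₂_add, eval₂_mul, hz, mul_zero, zero_add, eval₂_C, map_mul, map_pow] at this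
  rw [← this, sign_mul, sign_pos (mul_self_pos.2 (pow_ne_zero k hlc)), one_mul]

/-- A set of polynomials is closed under the operations of the Cohen-Hörmander algorithm. -/
structure EliminationClosed (S : Set A[X]) : Prop where
  eraseLead : ∀ P ∈ S, 0 < P.natDegree → P.eraseLead ∈ S
  derivative : ∀ P ∈ S, 0 < P.natDegree → P.derivative ∈ S
  leadingCoeff : ∀ P ∈ S, 0 < P.natDegree → C P.leadingCoeff ∈ S
  pseudoRem : ∀ P ∈ S, ∀ G ∈ S, 0 < G.natDegree → G.natDegree ≤ P.natDegree → pseudoRem P G ∈ S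

open Classical in
/-- One round of the operations of the Cohen-Hörmander algorithm. -/
noncomputable def eliminationStep (S : Finset A[X]) : Finset A[X] :=
  S ∪ (S.filter (0 < ·.natDegree)).image eraseLead
    ∪ (S.filter (0 < ·.natDegree)).image derivative
    ∪ (S.filter (0 < ·.natDegree)).image (fun P => C P.leadingCoeff)
    ∪ ((S ×ˢ S).filter fun PG => 0 < PG.2.natDegree ∧ PG.2.natDegree ≤ PG.1.natDegree).image
      fun PG => pseudoRem PG.1 PG.2

theorem mem_eliminationStep {S : Finset A[X]} {P : A[X]} :
    P ∈ eliminationStep S ↔ P ∈ S ∨ (∃ Q ∈ S, 0 < Q.natDegree ∧ Q.eraseLead = P) ∨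
      (∃ Q ∈ S, 0 < Q.natDegree ∧ derivative Q = P) ∨
      (∃ Q ∈ S, 0 < Q.natDegree ∧ C Q.leadingCoeff = P) ∨
      (∃ Q ∈ S, ∃ G ∈ S, 0 < G.natDegree ∧ G.natDegree ≤ Q.natDegree ∧ pseudoRem Q G = P) := by
  simp only [eliminationStep, Finset.mem_union, Finset.mem_image, Finset.mem_filter,
    Finset.mem_product, Prod.exists, or_assoc, and_assoc]
  constructor
  · rintro (h | h | h | h | ⟨Q, G, h1, h2, h3, h4, h5⟩)
    · exact Or.inl h
    · exact Or.inr (Or.inl h)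
    · exact Or.inr (Or.inr (Or.inl h))
    · exact Or.inr (Or.inr (Or.inr (Or.inl h)))
    · exact Or.inr (Or.inr (Or.inr (Or.inr ⟨Q, h1, G, h2, h3, h4, h5⟩)))
  · rintro (h | h | h | h | ⟨Q, h1, G, h2, h3, h4, h5⟩)
    · exact Or.inl h
    · exact Or.inr (Or.inl h)
    · exact Or.inr (Or.inr (Or.inl h))
    · exact Or.inr (Or.inr (Or.inr (Or.inl h)))
    · exact Or.inr (Or.inr (Or.inr (Or.inr ⟨Q, G, h1, h2, h3, h4, h5⟩)))

/-- New polynomials arise from polynomials of higher degree only. -/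
theorem mem_eliminationStep_of_natDegree {S T : Finset A[X]} {m : ℕ}
    (hST : ∀ P ∈ S, m < P.natDegree → P ∈ T) {P : A[X]}
    (hP : P ∈ eliminationStep S) (hm : m ≤ P.natDegree) : P ∈ S ∨ P ∈ eliminationStep T := by
  rcases mem_eliminationStep.1 hP with h | ⟨Q, hQ, h0, rfl⟩ | ⟨Q, hQ, h0, rfl⟩ | ⟨Q, hQ, h0, rfl⟩ |
    ⟨Q, hQ, G, hG, h0, h1, rfl⟩
  · exact Or.inl h
  · right
    have : Q.eraseLead.natDegree ≤ Q.natDegree - 1 := eraseLead_natDegree_le Q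
    exact mem_eliminationStep.2 (Or.inr (Or.inl ⟨Q, hST Q hQ (by omega), h0, rfl⟩))
  · right
    have := natDegree_derivative_le Q
    exact mem_eliminationStep.2 (Or.inr (Or.inr (Or.inl ⟨Q, hST Q hQ (by omega), h0, rfl⟩)))
  · right
    rw [natDegree_C] at hm
    exact mem_eliminationStep.2
      (Or.inr (Or.inr (Or.inr (Or.inl ⟨Q, hST Q hQ (by omega), h0, rfl⟩))))
  · right
    have := natDegree_pseudoRem_lt Q h0
    exact mem_eliminationStep.2 (Or.inr (Or.inr (Or.inr (Or.inr
      ⟨Q, hST Q hQ (by omega), G, hST G hG (by omega), h0, h1, rfl⟩))))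

theorem subset_eliminationStep (S : Finset A[X]) : S ⊆ eliminationStep S := fun _ h =>
  mem_eliminationStep.2 (Or.inl h)

/-- Each operation lowers the degree, so degrees stabilize from the top: with `d` the largest degree
in `S`, whatever is new in round `n + 1` has degree at most `d - n`. Hence nothing is new after `d +
1` rounds. -/
theorem exists_eliminationClosed (S : Finset A[X]) :
    ∃ T : Finset A[X], S ⊆ T ∧ EliminationClosed (T : Set A[X]) := by
  set d := S.sup natDegree with hd
  let T : ℕ → Finset A[X] := fun n => eliminationStep^[n] S
  have hT : ∀ n, T (n + 1) = eliminationStep (T n) := fun n =>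
    Function.iterate_succ_apply' eliminationStep n S
  have key : ∀ n, ∀ P ∈ T (n + 1), d + 1 ≤ P.natDegree + n → P ∈ T n := by
    intro n
    induction n with
    | zero =>
      intro P hP hdeg
      rw [hT] at hP
      rcases mem_eliminationStep_of_natDegree (T := ∅) (m := d) (fun Q hQ hQd =>
        absurd (Finset.le_sup (f := natDegree) hQ) (not_le.2 hQd)) hP (by omega) with h | h
      · exact h
      · rcases mem_eliminationStep.1 h with h | ⟨Q, hQ, _⟩ | ⟨Q, hQ, _⟩ | ⟨Q, hQ, _⟩ | ⟨Q, hQ, _⟩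
        all_goals simp at *
    | succ n ih =>
      intro P hP hdeg
      rw [hT] at hP
      rcases mem_eliminationStep_of_natDegree (T := T n) (m := d - n) (fun Q hQ hQd =>
        ih Q hQ (by omega)) hP (by omega) with h | h
      · exact h
      · rwa [hT]
  have hstab : ∀ P ∈ eliminationStep (T (d + 1)), P ∈ T (d + 1) := by
    intro P hP
    rw [← hT] at hP
    exact key _ P hP (by omega)
  have hsub : ∀ n, S ⊆ T n := by
    intro n
    induction n with
    | zero => exact subset_rfl
    | succ n ih => rw [hT]; exact ih.trans (subset_eliminationStep _)
  refine ⟨T (d + 1), hsub _, ?_, ?_, ?_, ?_⟩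
  · exact fun P hP h => hstab _ (mem_eliminationStep.2 (Or.inr (Or.inl ⟨P, hP, h, rfl⟩)))
  · exact fun P hP h => hstab _ (mem_eliminationStep.2 (Or.inr (Or.inr (Or.inl ⟨P, hP, h, rfl⟩))))
  · exact fun P hP h => hstab _
      (mem_eliminationStep.2 (Or.inr (Or.inr (Or.inr (Or.inl ⟨P, hP, h, rfl⟩)))))
  · exact fun P hP G hG h h' => hstab _
      (mem_eliminationStep.2 (Or.inr (Or.inr (Or.inr (Or.inr ⟨P, hP, G, hG, h, h', rfl⟩)))))

theorem map_eraseLead_of_leadingCoeff {P : A[X]} {σ : A →+* ℝ} (h : σ P.leadingCoeff = 0) :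
    P.eraseLead.map σ = P.map σ := by
  have := congrArg (Polynomial.map σ) (eraseLead_add_C_mul_X_pow P)
  rwa [Polynomial.map_add, Polynomial.map_mul, Polynomial.map_C, h, C_0, zero_mul, add_zero] at this

theorem eval₂_eraseLead_of_leadingCoeff {P : A[X]} {σ : A →+* ℝ} (h : σ P.leadingCoeff = 0)
    (t : ℝ) : P.eraseLead.eval₂ σ t = P.eval₂ σ t := by
  rw [← eval_map, ← eval_map, map_eraseLead_of_leadingCoeff h]

theorem natDegree_map_of_apply_leadingCoeff_ne_zero {P : A[X]} {σ : A →+* ℝ}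
    (h : σ P.leadingCoeff ≠ 0) : (P.map σ).natDegree = P.natDegree :=
  natDegree_map_of_leadingCoeff_ne_zero σ h

/-- A root of a nonzero specialization of a polynomial in a closed set is a root of a
specialization whose formal leading coefficient does not vanish. -/
theorem EliminationClosed.exists_leadingCoeff_ne_zero {S : Set A[X]} (hS : EliminationClosed S)
    {σ : A →+* ℝ} {z : ℝ} {G : A[X]} (hG : G ∈ S) (h0 : G.map σ ≠ 0) (hz : G.eval₂ σ z = 0) :
    ∃ G' ∈ S, G'.natDegree ≤ G.natDegree ∧ 0 < G'.natDegree ∧ σ G'.leadingCoeff ≠ 0 ∧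
      G'.eval₂ σ z = 0 := by
  induction hn : G.natDegree using Nat.strong_induction_on generalizing G with
  | _ n ih =>
    have hpos : 0 < G.natDegree := by
      by_contra hcon
      have hG0 := eq_C_of_natDegree_eq_zero (Nat.eq_zero_of_not_pos hcon)
      rw [hG0, eval₂_C] at hz
      apply h0
      rw [hG0, Polynomial.map_C, hz, C_0]
    by_cases hlc : σ G.leadingCoeff = 0
    · have hmap := map_eraseLead_of_leadingCoeff hlc
      have hlt : G.eraseLead.natDegree < n := by
        have := eraseLead_natDegree_le G
        omega
      obtain ⟨G', h1, h2, h3⟩ := ih _ hlt (hS.eraseLead G hG hpos) (hmap ▸ h0)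
        (by rw [eval₂_eraseLead_of_leadingCoeff hlc, hz]) rfl
      exact ⟨G', h1, by omega, h3⟩
    · exact ⟨G, hG, hn.le, hpos, hlc, hz⟩

/-- **Elimination of one real variable**: the sign diagrams of finitely many polynomials whose
coefficients depend on a parameter are determined by the signs of finitely many functions of the
parameter. -/
theorem EliminationClosed.exists_orderIso {S : Finset A[X]}
    (hS : EliminationClosed (S : Set A[X])) {σ τ : A →+* ℝ}
    (hsign : ∀ P ∈ S, P.natDegree = 0 → sign (σ (P.coeff 0)) = sign (τ (P.coeff 0))) :
    ∃ φ : ℝ ≃o ℝ, ∀ P ∈ S, ∀ t, sign (P.eval₂ σ t) = sign (P.eval₂ τ (φ t)) := by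
  classical
  suffices ∀ d : ℕ, ∃ φ : ℝ ≃o ℝ, ∀ P ∈ S, P.natDegree < d →
      ∀ t, sign (P.eval₂ σ t) = sign (P.eval₂ τ (φ t)) by
    obtain ⟨φ, hφ⟩ := this (S.sup natDegree + 1)
    exact ⟨φ, fun P hP => hφ P hP (Nat.lt_succ_of_le (Finset.le_sup hP))⟩
  intro d
  induction d with
  | zero => exact ⟨OrderIso.refl ℝ, fun P _ h => absurd h (by omega)⟩
  | succ d ihd =>
    rcases Nat.eq_zero_or_pos d with rfl | hdpos
    · refine ⟨OrderIso.refl ℝ, fun P hP h t => ?_⟩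
      have h0 : P.natDegree = 0 := by omega
      have := hsign P hP h0
      rw [eq_C_of_natDegree_eq_zero h0] at this ⊢
      simpa using this
    -- The polynomials of degree `d` are adjoined one by one to a matching for all lower degrees.
    suffices ∀ T : Finset A[X], T ⊆ S.filter (·.natDegree = d) →
        ∃ φ : ℝ ≃o ℝ, ∀ P ∈ S.filter (·.natDegree < d) ∪ T,
          ∀ t, sign (P.eval₂ σ t) = sign (P.eval₂ τ (φ t)) by
      obtain ⟨φ, hφ⟩ := this _ subset_rfl
      refine ⟨φ, fun P hP h => hφ P ?_⟩
      simp only [Finset.mem_union, Finset.mem_filter, hP, true_and]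
      omega
    intro T
    induction T using Finset.induction_on with
    | empty =>
      intro _
      obtain ⟨φ, hφ⟩ := ihd
      refine ⟨φ, fun P hP => ?_⟩
      simp only [Finset.union_empty, Finset.mem_filter] at hP
      exact hφ P hP.1 hP.2
    | insert P T hPT ih =>
      intro hsub
      obtain ⟨φ, hφ⟩ := ih ((Finset.subset_insert _ _).trans hsub)
      have hP := hsub (Finset.mem_insert_self P T)
      simp only [Finset.mem_filter] at hP
      obtain ⟨hPS, hPd⟩ := hP
      have hlow : ∀ Q ∈ S, Q.natDegree < d → Q ∈ S.filter (·.natDegree < d) ∪ T := fun Q hQ h => by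
        simp [hQ, h]
      have hP0 : 0 < P.natDegree := by omega
      suffices ∃ ψ : ℝ ≃o ℝ, (∀ Q ∈ S.filter (·.natDegree < d) ∪ T,
          ∀ t, sign (Q.eval₂ σ t) = sign (Q.eval₂ τ (ψ t))) ∧
          ∀ t, sign (P.eval₂ σ t) = sign (P.eval₂ τ (ψ t)) by
        obtain ⟨ψ, h1, h2⟩ := this
        refine ⟨ψ, fun Q hQ => ?_⟩
        rw [Finset.union_insert, Finset.mem_insert] at hQ
        rcases hQ with rfl | hQ
        exacts [h2, h1 Q hQ]
      have hlc := hsign _ (hS.leadingCoeff P hPS hP0) (natDegree_C _)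
      rw [coeff_C_zero] at hlc
      -- If the leading coefficient specializes to zero, it does so under `τ` too, and `P` agrees
      -- with its truncation, which is already matched.
      by_cases hσ : σ P.leadingCoeff = 0
      · have hτ : τ P.leadingCoeff = 0 := by
          rw [hσ, sign_zero, eq_comm, sign_eq_zero_iff] at hlc
          exact hlc
        refine ⟨φ, hφ, fun t => ?_⟩
        have := hφ P.eraseLead (hlow _ (hS.eraseLead P hPS hP0) (by
          have := eraseLead_natDegree_le P
          omega)) t
        rwa [eval₂_eraseLead_of_leadingCoeff hσ, eval₂_eraseLead_of_leadingCoeff hτ] at this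
      · have hτ : τ P.leadingCoeff ≠ 0 := by
          intro h
          rw [h, sign_zero, sign_eq_zero_iff] at hlc
          exact hσ hlc
        let I := S.filter (·.natDegree < d) ∪ T
        let f : I → ℝ[X] := fun Q => Q.1.map σ
        let g : I → ℝ[X] := fun Q => Q.1.map τ
        have hm : SignMatch f g φ := fun Q t => by
          simpa only [f, g, eval_map] using hφ Q.1 Q.2 t
        have hder : P.derivative ∈ I := hlow _ (hS.derivative P hPS hP0) (by
          have := natDegree_derivative_le P
          omega)
        obtain ⟨ψ, h1, h2⟩ := hm.extend (p := P.map σ) (q := P.map τ) (i₀ := ⟨_, hder⟩)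
          (by rwa [natDegree_map_of_apply_leadingCoeff_ne_zero hτ])
          (by rwa [natDegree_map_of_apply_leadingCoeff_ne_zero hσ])
          (derivative_map P σ).symm (derivative_map P τ).symm (by
            rintro z ⟨⟨G, hG⟩, hG0, hGz⟩
            have hGS : G ∈ S ∧ G.natDegree ≤ d := by
              simp only [I, Finset.mem_union, Finset.mem_filter] at hG
              rcases hG with hG | hG
              · exact ⟨hG.1, hG.2.le⟩
              · have := hsub (Finset.mem_insert_of_mem hG)
                simp only [Finset.mem_filter] at this
                exact ⟨this.1, this.2.le⟩
            -- To know the sign of `P` at a root `z` of the family, divide `P` by a polynomial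
            -- vanishing at `z` whose leading coefficient survives specialization. `G` itself serves
            -- here if it has full degree; otherwise a truncation of lower degree is used. In both
            -- cases the remainder has degree below `d` and is already matched.
            by_cases hGd : G.natDegree = d ∧ σ G.leadingCoeff ≠ 0
            · have hG1 : 0 < G.natDegree := by omega
              have hGz' : G.eval₂ σ z = 0 := by rwa [← eval_map]
              have hGτ : G.eval₂ τ (φ z) = 0 := by
                rw [← sign_eq_zero_iff, ← hφ G hG, hGz', sign_zero]
              have hlcG := hsign _ (hS.leadingCoeff G hGS.1 hG1) (natDegree_C _)
              rw [coeff_C_zero] at hlcG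
              have hGlcτ : τ G.leadingCoeff ≠ 0 := by
                intro h
                rw [h, sign_zero, sign_eq_zero_iff] at hlcG
                exact hGd.2 hlcG
              rw [eval_map, eval_map, ← sign_eval₂_pseudoRem P hG1 σ hGd.2 hGz',
                ← sign_eval₂_pseudoRem P hG1 τ hGlcτ hGτ]
              refine hφ _ (hlow _ (hS.pseudoRem P hPS G hGS.1 hG1 (by omega)) ?_) z
              have := natDegree_pseudoRem_lt P hG1
              omega
            · obtain ⟨G', hG'S, hG'd, hG1, hGlc, hGz'⟩ : ∃ G' ∈ (S : Set A[X]), G'.natDegree < d ∧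
                  0 < G'.natDegree ∧ σ G'.leadingCoeff ≠ 0 ∧ G'.eval₂ σ z = 0 := by
                rw [not_and_or, not_not] at hGd
                have hz0 : G.eval₂ σ z = 0 := by rwa [← eval_map]
                by_cases hGd' : G.natDegree = d
                · have hlcG := hGd.resolve_left (not_not.2 hGd')
                  have hG1 : 0 < G.natDegree := by omega
                  have hmap := map_eraseLead_of_leadingCoeff hlcG
                  obtain ⟨G', h1, h2, h3⟩ := hS.exists_leadingCoeff_ne_zero
                    (hS.eraseLead G hGS.1 hG1) (by rwa [hmap])
                    (by rw [eval₂_eraseLead_of_leadingCoeff hlcG, hz0])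
                  have := eraseLead_natDegree_le G
                  exact ⟨G', h1, by omega, h3⟩
                · obtain ⟨G', h1, h2, h3⟩ := hS.exists_leadingCoeff_ne_zero hGS.1 hG0 hz0
                  exact ⟨G', h1, by omega, h3⟩
              have hGτ : G'.eval₂ τ (φ z) = 0 := by
                rw [← sign_eq_zero_iff, ← hφ G' (hlow _ hG'S hG'd), hGz', sign_zero]
              have hlcG := hsign _ (hS.leadingCoeff G' hG'S hG1) (natDegree_C _)
              rw [coeff_C_zero] at hlcG
              have hGlcτ : τ G'.leadingCoeff ≠ 0 := by
                intro h
                rw [h, sign_zero, sign_eq_zero_iff] at hlcG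
                exact hGlc hlcG
              rw [eval_map, eval_map, ← sign_eval₂_pseudoRem P hG1 σ hGlc hGz',
                ← sign_eval₂_pseudoRem P hG1 τ hGlcτ hGτ]
              refine hφ _ (hlow _ (hS.pseudoRem P hPS G' hG'S hG1 (by omega)) ?_) z
              have := natDegree_pseudoRem_lt P hG1
              omega)
        refine ⟨ψ, fun Q hQ t => ?_, fun t => ?_⟩
        · simpa only [f, g, eval_map] using h1 ⟨Q, hQ⟩ t
        · simpa only [eval_map] using h2 t

/-- `K` consists of the constant coefficients of a closed family containing `S`. Only those of its
constant members are needed; the others do no harm. -/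
theorem exists_finset_sign_elimination (S : Finset A[X]) :
    ∃ K : Finset A, ∀ σ τ : A →+* ℝ, (∀ a ∈ K, sign (σ a) = sign (τ a)) →
      ∃ φ : ℝ ≃o ℝ, ∀ P ∈ S, ∀ t, sign (P.eval₂ σ t) = sign (P.eval₂ τ (φ t)) := by
  classical
  obtain ⟨T, hST, hT⟩ := exists_eliminationClosed S
  refine ⟨T.image (·.coeff 0), fun σ τ h => ?_⟩
  obtain ⟨φ, hφ⟩ := hT.exists_orderIso (σ := σ) (τ := τ) fun P hP _ =>
    h _ (Finset.mem_image_of_mem _ hP)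
  exact ⟨φ, fun P hP => hφ P (hST hP)⟩

end Parametric

end CartanGr

namespace CartanGr

/-! ### Calculus of semialgebraic sets and Tarski-Seidenberg -/

section Semialgebraic

open SignType

universe u v

variable {W : Type*} [AddCommGroup W] [Module ℝ W]

/-- The polynomial functions on a real vector space. -/
def IsPolyFun (f : W → ℝ) : Prop := ∃ F : MvPolynomial (Dual ℝ W) ℝ, ∀ w, f w = polyEval F w

namespace IsPolyFun

variable {f g : W → ℝ}

theorem const (c : ℝ) : IsPolyFun fun _ : W => c :=
  ⟨MvPolynomial.C c, fun w => by simp [polyEval]⟩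

theorem dual (φ : Dual ℝ W) : IsPolyFun fun w => φ w :=
  ⟨MvPolynomial.X φ, fun w => by simp [polyEval]⟩

theorem add (hf : IsPolyFun f) (hg : IsPolyFun g) : IsPolyFun fun w => f w + g w := by
  obtain ⟨F, hF⟩ := hf
  obtain ⟨G, hG⟩ := hg
  exact ⟨F + G, fun w => by simp [polyEval, hF, hG]⟩

theorem mul (hf : IsPolyFun f) (hg : IsPolyFun g) : IsPolyFun fun w => f w * g w := by
  obtain ⟨F, hF⟩ := hf
  obtain ⟨G, hG⟩ := hg
  exact ⟨F * G, fun w => by simp [polyEval, hF, hG]⟩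

theorem sub (hf : IsPolyFun f) (hg : IsPolyFun g) : IsPolyFun fun w => f w - g w := by
  obtain ⟨F, hF⟩ := hf
  obtain ⟨G, hG⟩ := hg
  exact ⟨F - G, fun w => by simp [polyEval, hF, hG]⟩

theorem sum {ι : Type*} {s : Finset ι} {f : ι → W → ℝ} (hf : ∀ i ∈ s, IsPolyFun (f i)) :
    IsPolyFun fun w => ∑ i ∈ s, f i w := by
  classical
  induction s using Finset.induction_on with
  | empty => simpa using const 0
  | insert a s ha ih =>
    simp only [Finset.sum_insert ha]
    exact (hf a (Finset.mem_insert_self a s)).add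
      (ih fun i hi => hf i (Finset.mem_insert_of_mem hi))

end IsPolyFun

namespace IsSemialgebraic

variable {S T : Set W}

theorem union (hS : IsSemialgebraic S) (hT : IsSemialgebraic T) : IsSemialgebraic (S ∪ T) := by
  have := (hS.compl.inter hT.compl).compl
  rwa [← Set.compl_union, compl_compl] at this

theorem empty : IsSemialgebraic (∅ : Set W) := by
  have := pos (W := W) 0
  simpa [polyEval] using this

theorem biUnion {ι : Type*} {s : Set ι} (hs : s.Finite) {S : ι → Set W}
    (h : ∀ i ∈ s, IsSemialgebraic (S i)) : IsSemialgebraic (⋃ i ∈ s, S i) := by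
  induction s, hs using Set.Finite.induction_on with
  | empty => simpa using empty
  | insert _ _ ih =>
    rw [Set.biUnion_insert]
    exact (h _ (Set.mem_insert _ _)).union (ih fun i hi => h i (Set.mem_insert_of_mem _ hi))

theorem forall_finite {ι : Type*} [Finite ι] {P : ι → W → Prop}
    (h : ∀ i, IsSemialgebraic {w | P i w}) : IsSemialgebraic {w | ∀ i, P i w} := by
  have := (biUnion (Set.finite_univ (α := ι)) fun i _ => (h i).compl).compl
  convert this using 1
  ext w
  simp

theorem and {P Q : W → Prop} (hP : IsSemialgebraic {w | P w}) (hQ : IsSemialgebraic {w | Q w}) :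
    IsSemialgebraic {w | P w ∧ Q w} := hP.inter hQ

theorem not {P : W → Prop} (hP : IsSemialgebraic {w | P w}) : IsSemialgebraic {w | ¬ P w} :=
  hP.compl

theorem imp {P Q : W → Prop} (hP : IsSemialgebraic {w | P w}) (hQ : IsSemialgebraic {w | Q w}) :
    IsSemialgebraic {w | P w → Q w} := by
  convert hP.compl.union hQ using 1
  ext w
  simp [imp_iff_not_or]

theorem lt {f g : W → ℝ} (hf : IsPolyFun f) (hg : IsPolyFun g) :
    IsSemialgebraic {w | f w < g w} := by
  obtain ⟨F, hF⟩ := hg.sub hf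
  convert pos F using 1
  ext w
  simp [← hF]

theorem eq {f g : W → ℝ} (hf : IsPolyFun f) (hg : IsPolyFun g) :
    IsSemialgebraic {w | f w = g w} := by
  convert (lt hf hg).not.and (lt hg hf).not using 1
  ext w
  simp [le_antisymm_iff, and_comm]

/-- A set is semialgebraic iff membership depends only on the signs of finitely many
polynomials. -/
theorem iff_sign_determined : IsSemialgebraic S ↔ ∃ F : Finset (MvPolynomial (Dual ℝ W) ℝ),
    ∀ v w, (∀ f ∈ F, sign (polyEval f v) = sign (polyEval f w)) → v ∈ S → w ∈ S := by
  classical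
  constructor
  · intro h
    induction h with
    | pos F =>
      refine ⟨{F}, fun v w h hv => ?_⟩
      have h1 := h F (Finset.mem_singleton_self F)
      have hv : 0 < polyEval F v := hv
      rw [sign_pos hv, eq_comm, sign_eq_one_iff] at h1
      exact h1
    | compl _ ih =>
      obtain ⟨F, hF⟩ := ih
      exact ⟨F, fun v w h hv hw => hv (hF w v (fun f hf => (h f hf).symm) hw)⟩
    | inter _ _ ih1 ih2 =>
      obtain ⟨F, hF⟩ := ih1
      obtain ⟨G, hG⟩ := ih2
      exact ⟨F ∪ G, fun v w h hv =>
        ⟨hF v w (fun f hf => h f (Finset.mem_union_left _ hf)) hv.1,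
          hG v w (fun f hf => h f (Finset.mem_union_right _ hf)) hv.2⟩⟩
  · rintro ⟨F, hF⟩
    let cell (ε : F → SignType) : Set W := {w | ∀ f : F, sign (polyEval f.1 w) = ε f}
    have hcell (ε : F → SignType) : IsSemialgebraic (cell ε) := by
      refine forall_finite fun f => ?_
      have hf : IsPolyFun (fun w => polyEval f.1 w) := ⟨f.1, fun _ => rfl⟩
      cases ε f with
      | zero => simpa using eq hf (IsPolyFun.const 0)
      | neg => simpa [sign_eq_neg_one_iff] using lt hf (IsPolyFun.const 0)
      | pos => simpa [sign_eq_one_iff] using lt (IsPolyFun.const 0) hf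
    convert biUnion (Set.toFinite {ε | ∃ v ∈ S, v ∈ cell ε}) (fun ε _ => hcell ε) using 1
    ext w
    simp only [Set.mem_iUnion, exists_prop]
    constructor
    · exact fun hw => ⟨fun f => sign (polyEval f.1 w), ⟨w, hw, fun f => rfl⟩, fun f => rfl⟩
    · rintro ⟨ε, ⟨v, hv, hvε⟩, hwε⟩
      exact hF v w (fun f hf => (hvε ⟨f, hf⟩).trans (hwε ⟨f, hf⟩).symm) hv

theorem polyEval_rename {W' : Type*} [AddCommGroup W'] [Module ℝ W'] (L : W →ₗ[ℝ] W')
    (F : MvPolynomial (Dual ℝ W') ℝ) (w : W) :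
    polyEval (MvPolynomial.rename (fun φ : Dual ℝ W' => φ.comp L) F) w = polyEval F (L w) := by
  simp [polyEval, MvPolynomial.eval_rename, Function.comp_def]

theorem preimage {W' : Type*} [AddCommGroup W'] [Module ℝ W'] {S : Set W'}
    (hS : IsSemialgebraic S) (L : W →ₗ[ℝ] W') : IsSemialgebraic (L ⁻¹' S) := by
  induction hS with
  | pos F =>
    convert pos (MvPolynomial.rename (fun φ : Dual ℝ W' => φ.comp L) F) using 1
    ext w
    simp [polyEval_rename]
  | compl _ ih => exact ih.compl
  | inter _ _ ih1 ih2 => exact ih1.inter ih2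

open Polynomial in
/-- A polynomial function on `W × ℝ`, as a polynomial in the last variable. -/
noncomputable def polynomialOfProd :
    MvPolynomial (Dual ℝ (W × ℝ)) ℝ →ₐ[ℝ] Polynomial (MvPolynomial (Dual ℝ W) ℝ) :=
  MvPolynomial.aeval fun φ => C (MvPolynomial.X (φ.comp (LinearMap.inl ℝ W ℝ)))
    + C (MvPolynomial.C (φ (0, 1))) * X

theorem eval₂_polynomialOfProd (F : MvPolynomial (Dual ℝ (W × ℝ)) ℝ) (w : W) (t : ℝ) :
    (polynomialOfProd F).eval₂ (MvPolynomial.eval fun φ : Dual ℝ W => φ w) t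
      = polyEval F (w, t) := by
  induction F using MvPolynomial.induction_on with
  | C a =>
    rw [← MvPolynomial.algebraMap_eq, AlgHom.commutes]
    simp [polyEval, Polynomial.algebraMap_apply, MvPolynomial.algebraMap_eq]
  | add p q hp hq => simpa [polyEval, Polynomial.eval₂_add] using congrArg₂ (· + ·) hp hq
  | mul_X p φ hp =>
    have : φ (w, t) = φ (w, 0) + φ (0, 1) * t := by
      have : ((w, t) : W × ℝ) = (w, 0) + t • (0, 1) := by simp
      rw [this, map_add, map_smul, smul_eq_mul, mul_comm]
    simp only [polyEval] at hp
    rw [map_mul, Polynomial.eval₂_mul, hp]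
    simp [polyEval, polynomialOfProd, this, Polynomial.eval₂_add, Polynomial.eval₂_mul]

/-- **Tarski-Seidenberg**, for one quantifier over the reals. -/
theorem exists_real {P : W → ℝ → Prop} (h : IsSemialgebraic {p : W × ℝ | P p.1 p.2}) :
    IsSemialgebraic {w | ∃ t, P w t} := by
  classical
  rw [iff_sign_determined] at h ⊢
  obtain ⟨F, hF⟩ := h
  obtain ⟨K, hK⟩ := exists_finset_sign_elimination (F.image polynomialOfProd)
  refine ⟨K, fun v w hvw hv => ?_⟩
  obtain ⟨t, ht⟩ := hv
  obtain ⟨φ, hφ⟩ := hK (MvPolynomial.eval fun φ : Dual ℝ W => φ v)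
    (MvPolynomial.eval fun φ : Dual ℝ W => φ w) hvw
  -- The bijection that matches the sign diagrams over `v` and `w` carries a witness over `v` to a
  -- witness over `w`.
  refine ⟨φ t, hF (v, t) (w, φ t) (fun f hf => ?_) ht⟩
  have := hφ _ (Finset.mem_image_of_mem _ hf) t
  rwa [eval₂_polynomialOfProd, eval₂_polynomialOfProd] at this

theorem exists_fin {W : Type u} [AddCommGroup W] [Module ℝ W] {n : ℕ} {P : W → (Fin n → ℝ) → Prop}
    (h : IsSemialgebraic {p : W × (Fin n → ℝ) | P p.1 p.2}) :
    IsSemialgebraic {w | ∃ c, P w c} := by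
  induction n generalizing W with
  | zero =>
    convert h.preimage (LinearMap.inl ℝ W (Fin 0 → ℝ)) using 1
    ext w
    constructor
    · rintro ⟨c, hc⟩
      rwa [Subsingleton.elim c 0] at hc
    · exact fun hw => ⟨0, hw⟩
  | succ n ih =>
    let L : (W × (Fin n → ℝ)) × ℝ →ₗ[ℝ] W × (Fin (n + 1) → ℝ) :=
      ((LinearMap.fst ℝ W _).comp (LinearMap.fst ℝ _ ℝ)).prod
        ((Fin.consLinearEquiv ℝ (fun _ => ℝ)).toLinearMap.comp
          ((LinearMap.snd ℝ _ ℝ).prod ((LinearMap.snd ℝ W _).comp (LinearMap.fst ℝ _ ℝ))))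
    have h1 := h.preimage L
    have h2 : IsSemialgebraic {p : W × (Fin n → ℝ) | ∃ t : ℝ, P p.1 (Fin.cons t p.2)} :=
      exists_real (W := W × (Fin n → ℝ)) (P := fun p t => P p.1 (Fin.cons t p.2)) h1
    have h3 := ih (P := fun w c => ∃ t : ℝ, P w (Fin.cons t c)) h2
    convert h3 using 1
    ext w
    constructor
    · rintro ⟨c, hc⟩
      exact ⟨Fin.tail c, c 0, by rwa [Fin.cons_self_tail]⟩
    · rintro ⟨c, t, hc⟩
      exact ⟨_, hc⟩

/-- **Tarski-Seidenberg**: projections of semialgebraic sets are semialgebraic. -/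
theorem exists_vec {W : Type u} [AddCommGroup W] [Module ℝ W] {W' : Type v} [AddCommGroup W']
    [Module ℝ W'] [FiniteDimensional ℝ W'] {P : W → W' → Prop}
    (h : IsSemialgebraic {p : W × W' | P p.1 p.2}) :
    IsSemialgebraic {w | ∃ w', P w w'} := by
  let e := (finBasis ℝ W').equivFun
  have h1 := h.preimage (LinearMap.prodMap (LinearMap.id : W →ₗ[ℝ] W) e.symm.toLinearMap)
  have h2 := exists_fin (P := fun w c => P w (e.symm c)) h1
  convert h2 using 1
  ext w
  exact e.symm.surjective.exists

theorem forall_vec {W : Type u} [AddCommGroup W] [Module ℝ W] {W' : Type v} [AddCommGroup W']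
    [Module ℝ W'] [FiniteDimensional ℝ W'] {P : W → W' → Prop}
    (h : IsSemialgebraic {p : W × W' | P p.1 p.2}) :
    IsSemialgebraic {w | ∀ w', P w w'} := by
  have := (exists_vec (P := fun w w' => ¬ P w w') h.not).not
  simpa using this

end IsSemialgebraic

/-- The polynomial maps between real vector spaces. -/
def IsPolyMap {W' : Type*} [AddCommGroup W'] [Module ℝ W'] (f : W → W') : Prop :=
  ∀ φ : Dual ℝ W', IsPolyFun fun w => φ (f w)

namespace IsPolyMap

variable {W' : Type*} [AddCommGroup W'] [Module ℝ W'] {f g : W → W'}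

theorem linear (L : W →ₗ[ℝ] W') : IsPolyMap fun w => L w := fun φ => IsPolyFun.dual (φ.comp L)

theorem id : IsPolyMap fun w : W => w := linear LinearMap.id

theorem comp_linear {W₁ : Type*} [AddCommGroup W₁] [Module ℝ W₁] (L : W' →ₗ[ℝ] W₁)
    (hf : IsPolyMap f) : IsPolyMap fun w => L (f w) := fun φ => hf (φ.comp L)

theorem fst {W₁ W₂ : Type*} [AddCommGroup W₁] [Module ℝ W₁] [AddCommGroup W₂] [Module ℝ W₂]
    {f : W → W₁ × W₂} (hf : IsPolyMap f) : IsPolyMap fun w => (f w).1 :=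
  hf.comp_linear (LinearMap.fst ℝ W₁ W₂)

theorem snd {W₁ W₂ : Type*} [AddCommGroup W₁] [Module ℝ W₁] [AddCommGroup W₂] [Module ℝ W₂]
    {f : W → W₁ × W₂} (hf : IsPolyMap f) : IsPolyMap fun w => (f w).2 :=
  hf.comp_linear (LinearMap.snd ℝ W₁ W₂)

theorem proj {ι : Type*} {f : W → ι → W'} (hf : IsPolyMap f) (i : ι) : IsPolyMap fun w => f w i :=
  hf.comp_linear (LinearMap.proj i : (ι → W') →ₗ[ℝ] W')

theorem isPolyFun {f : W → ℝ} (hf : IsPolyMap f) : IsPolyFun f := hf LinearMap.id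

theorem preimage_isSemialgebraic (hf : IsPolyMap f) {S : Set W'} (hS : IsSemialgebraic S) :
    IsSemialgebraic (f ⁻¹' S) := by
  choose G hG using hf
  induction hS with
  | pos F =>
    convert IsSemialgebraic.pos (MvPolynomial.bind₁ G F) using 1
    ext w
    have : polyEval (MvPolynomial.bind₁ G F) w = polyEval F (f w) := by
      simp only [polyEval, MvPolynomial.eval, MvPolynomial.eval₂Hom_bind₁]
      simp only [hG, polyEval, MvPolynomial.eval]
    simp [this]
  | compl _ ih => exact ih.compl
  | inter _ _ ih1 ih2 => exact ih1.inter ih2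

theorem const (c : W') : IsPolyMap fun _ : W => c := fun φ => IsPolyFun.const (φ c)

theorem add (hf : IsPolyMap f) (hg : IsPolyMap g) : IsPolyMap fun w => f w + g w := fun φ => by
  simpa using (hf φ).add (hg φ)

theorem smul {c : W → ℝ} (hc : IsPolyFun c) (hf : IsPolyMap f) : IsPolyMap fun w => c w • f w :=
  fun φ => by simpa using hc.mul (hf φ)

theorem sum {ι : Type*} {s : Finset ι} {f : ι → W → W'} (hf : ∀ i ∈ s, IsPolyMap (f i)) :
    IsPolyMap fun w => ∑ i ∈ s, f i w := fun φ => by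
  simpa using IsPolyFun.sum fun i hi => hf i hi φ

theorem bilinear {W₁ W₂ : Type*} [AddCommGroup W₁] [Module ℝ W₁] [AddCommGroup W₂] [Module ℝ W₂]
    [FiniteDimensional ℝ W₁] [FiniteDimensional ℝ W₂] (B : W₁ →ₗ[ℝ] W₂ →ₗ[ℝ] W')
    {f : W → W₁} {g : W → W₂} (hf : IsPolyMap f) (hg : IsPolyMap g) :
    IsPolyMap fun w => B (f w) (g w) := by
  let b := finBasis ℝ W₁
  let c := finBasis ℝ W₂
  have : (fun w => B (f w) (g w))
      = fun w => ∑ i, ∑ j, (b.coord i (f w) * c.coord j (g w)) • B (b i) (c j) := by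
    ext w
    conv_lhs => rw [← b.sum_repr (f w), ← c.sum_repr (g w)]
    rw [map_sum B, LinearMap.sum_apply]
    refine Finset.sum_congr rfl fun i _ => ?_
    rw [map_smul, LinearMap.smul_apply, map_sum, Finset.smul_sum]
    refine Finset.sum_congr rfl fun j _ => ?_
    rw [map_smul, smul_smul]
    rfl
  rw [this]
  exact sum fun i _ => sum fun j _ => smul ((hf _).mul (hg _)) (const _)

theorem semialgebraic_eq [FiniteDimensional ℝ W'] (hf : IsPolyMap f) (hg : IsPolyMap g) :
    IsSemialgebraic {w | f w = g w} := by
  let b := finBasis ℝ W'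
  convert IsSemialgebraic.forall_finite fun i =>
    IsSemialgebraic.eq (hf (b.coord i)) (hg (b.coord i)) using 1
  ext w
  exact b.ext_elem_iff

end IsPolyMap

theorem continuous_polyEval [FiniteDimensional ℝ W] (F : MvPolynomial (Dual ℝ W) ℝ) :
    @Continuous W ℝ (moduleTopology ℝ W) _ (polyEval F) := by
  let _ : TopologicalSpace W := moduleTopology ℝ W
  have : IsModuleTopology ℝ W := ⟨rfl⟩
  induction F using MvPolynomial.induction_on with
  | C a => exact (continuous_const (y := a)).congr fun w => by simp [polyEval]
  | add p q hp hq => exact (hp.add hq).congr fun w => by simp [polyEval]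
  | mul_X p φ hp =>
    exact (hp.mul (IsModuleTopology.continuous_of_linearMap φ)).congr fun w => by simp [polyEval]

theorem IsPolyFun.continuous [FiniteDimensional ℝ W] {f : W → ℝ} (hf : IsPolyFun f) :
    @Continuous W ℝ (moduleTopology ℝ W) _ f := by
  obtain ⟨F, hF⟩ := hf
  rw [show f = polyEval F from funext hF]
  exact continuous_polyEval F

/-- In coordinates the module topology is that of the sup norm. In this form the closure quantifies
only over reals and vectors, so Tarski-Seidenberg applies to it. -/
theorem mem_closure_moduleTopology_iff [FiniteDimensional ℝ W] {S : Set W} {v : W} :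
    v ∈ @closure W (moduleTopology ℝ W) S ↔
      ∀ ε : ℝ, 0 < ε → ∃ w, w ∈ S ∧ ∀ i, (finBasis ℝ W).coord i (v - w) < ε ∧
        -ε < (finBasis ℝ W).coord i (v - w) := by
  let _ : TopologicalSpace W := moduleTopology ℝ W
  have : IsModuleTopology ℝ W := ⟨rfl⟩
  have := IsModuleTopology.toContinuousAdd ℝ W
  let e := (finBasis ℝ W).equivFun
  let h : W ≃ₜ (Fin (finrank ℝ W) → ℝ) :=
    { e.toEquiv with
      continuous_toFun := IsModuleTopology.continuous_of_linearMap e.toLinearMap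
      continuous_invFun := IsModuleTopology.continuous_of_linearMap e.symm.toLinearMap }
  rw [← h.injective.mem_set_image, h.image_closure, Metric.mem_closure_iff]
  refine forall₂_congr fun ε hε => ?_
  simp only [Set.exists_mem_image]
  refine exists_congr fun w => and_congr_right fun _ => ?_
  rw [dist_pi_lt_iff hε]
  refine forall_congr' fun i => ?_
  rw [Real.dist_eq, abs_lt, and_comm]
  have : (finBasis ℝ W).coord i (v - w) = h v i - h w i := by
    rw [map_sub]; rfl
  rw [this]

theorem IsSemialgebraic.closure [FiniteDimensional ℝ W] {S : Set W} (hS : IsSemialgebraic S) :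
    IsSemialgebraic (@closure W (moduleTopology ℝ W) S) := by
  have : @_root_.closure W (moduleTopology ℝ W) S = {v | ∀ ε : ℝ, 0 < ε → ∃ w, w ∈ S ∧
      ∀ i, (finBasis ℝ W).coord i (v - w) < ε ∧ -ε < (finBasis ℝ W).coord i (v - w)} :=
    Set.ext fun v => mem_closure_moduleTopology_iff
  rw [this]
  refine IsSemialgebraic.forall_vec ?_
  refine IsSemialgebraic.imp (.lt (.const 0) (.dual (LinearMap.snd ℝ W ℝ))) ?_
  refine IsSemialgebraic.exists_vec (P := fun (p : W × ℝ) w => w ∈ S ∧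
      ∀ i, (finBasis ℝ W).coord i (p.1 - w) < p.2 ∧ -p.2 < (finBasis ℝ W).coord i (p.1 - w)) ?_
  refine IsSemialgebraic.and (hS.preimage (LinearMap.snd ℝ (W × ℝ) W)) ?_
  refine IsSemialgebraic.forall_finite fun i => ?_
  let L : (W × ℝ) × W →ₗ[ℝ] W :=
    (LinearMap.fst ℝ W ℝ).comp (LinearMap.fst ℝ _ W) - LinearMap.snd ℝ (W × ℝ) W
  let M : (W × ℝ) × W →ₗ[ℝ] ℝ := (LinearMap.snd ℝ W ℝ).comp (LinearMap.fst ℝ _ W)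
  exact .and (.lt (.dual (((finBasis ℝ W).coord i).comp L)) (.dual M))
    (.lt (.dual (-M)) (.dual (((finBasis ℝ W).coord i).comp L)))

end Semialgebraic

end CartanGr

namespace CartanGr

/-! ### Topology and semialgebraic sets of the Grassmannian, through frames -/

section GrassmannianTopology

variable {W : Type*} [AddCommGroup W] [Module ℝ W] {r : ℕ}

/-- The change of frame given by a matrix. -/
def frameChange (W : Type*) [AddCommGroup W] [Module ℝ W] {r : ℕ} (g : Matrix (Fin r) (Fin r) ℝ) :
    (Fin r → W) →ₗ[ℝ] (Fin r → W) :=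
  LinearMap.pi fun i => ∑ j, g i j • LinearMap.proj j

theorem frameChange_apply (g : Matrix (Fin r) (Fin r) ℝ) (v : Fin r → W) (i : Fin r) :
    frameChange W g v i = ∑ j, g i j • v j := by
  simp [frameChange]

theorem frameChange_mul (g h : Matrix (Fin r) (Fin r) ℝ) (v : Fin r → W) :
    frameChange W (g * h) v = frameChange W g (frameChange W h v) := by
  ext i
  simp only [frameChange_apply, Matrix.mul_apply, Finset.sum_smul, Finset.smul_sum, mul_smul]
  exact Finset.sum_comm

theorem frameChange_one (v : Fin r → W) : frameChange W 1 v = v := by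
  ext i
  simp [frameChange_apply, Matrix.one_apply, ite_smul]

theorem span_frameChange_le (g : Matrix (Fin r) (Fin r) ℝ) (v : Fin r → W) :
    Submodule.span ℝ (Set.range (frameChange W g v)) ≤ Submodule.span ℝ (Set.range v) := by
  rw [Submodule.span_le]
  rintro _ ⟨i, rfl⟩
  rw [frameChange_apply]
  exact Submodule.sum_mem _ fun j _ =>
    Submodule.smul_mem _ _ (Submodule.subset_span (Set.mem_range_self j))

theorem exists_frameChange_eq {u w : Fin r → W}
    (h : Submodule.span ℝ (Set.range u) ≤ Submodule.span ℝ (Set.range w)) :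
    ∃ g, frameChange W g w = u := by
  have (i : Fin r) : ∃ c : Fin r → ℝ, ∑ j, c j • w j = u i :=
    (Submodule.mem_span_range_iff_exists_fun ℝ).1
      (h (Submodule.subset_span (Set.mem_range_self i)))
  choose g hg using this
  exact ⟨Matrix.of g, funext fun i => by rw [frameChange_apply]; exact hg i⟩

theorem eq_one_of_frameChange_eq_self {w : Fin r → W} (hw : LinearIndependent ℝ w)
    {g : Matrix (Fin r) (Fin r) ℝ} (h : frameChange W g w = w) : g = 1 := by
  ext i j
  have h1 := congrFun h i
  have h2 := congrFun (frameChange_one w) i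
  rw [frameChange_apply] at h1 h2
  have h3 : ∑ j, (g i j - (1 : Matrix (Fin r) (Fin r) ℝ) i j) • w j = 0 := by
    simp only [sub_smul, Finset.sum_sub_distrib, h1, h2, sub_self]
  exact sub_eq_zero.1 (Fintype.linearIndependent_iff.1 hw _ h3 j)

/-- If `w` spans the same plane as `u ∈ U`, then `u = g w` for an invertible matrix `g`. For `w'`
near `w`, the frame `g w'` is still in `U` and spans the plane of `w'`. -/
theorem Frame.isOpenMap_span [FiniteDimensional ℝ W] :
    IsOpenMap (Frame.span : Frame W r → Gr W r) := by
  let _ : TopologicalSpace (Fin r → W) := moduleTopology ℝ (Fin r → W)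
  have : IsModuleTopology ℝ (Fin r → W) := ⟨rfl⟩
  have := IsModuleTopology.toContinuousAdd ℝ (Fin r → W)
  rintro U ⟨O, hO, rfl⟩
  change IsOpen (Frame.span ⁻¹' _)
  rw [isOpen_iff_forall_mem_open]
  rintro w ⟨u, hu, huw⟩
  have huw' : Submodule.span ℝ (Set.range u.1) = Submodule.span ℝ (Set.range w.1) :=
    congrArg Subtype.val huw
  obtain ⟨g, hg⟩ := exists_frameChange_eq huw'.le
  obtain ⟨h, hh⟩ := exists_frameChange_eq huw'.ge
  have hhg : h * g = 1 := eq_one_of_frameChange_eq_self w.2 (by rw [frameChange_mul, hg, hh])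
  refine ⟨Subtype.val ⁻¹' (frameChange W g ⁻¹' O), ?_, ?_, ?_⟩
  · intro w' hw'
    have hspan : Submodule.span ℝ (Set.range (frameChange W g w'.1))
        = Submodule.span ℝ (Set.range w'.1) := by
      apply le_antisymm (span_frameChange_le g w'.1)
      conv_lhs => rw [← frameChange_one w'.1, ← hhg, frameChange_mul]
      exact span_frameChange_le h _
    refine ⟨⟨frameChange W g w'.1, ?_⟩, hw', Subtype.ext hspan⟩
    rw [linearIndependent_iff_card_eq_finrank_span, Set.finrank, hspan, finrank_span_eq_card w'.2]
  · exact ⟨_, hO.preimage (IsModuleTopology.continuous_of_linearMap (frameChange W g)), rfl⟩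
  · change frameChange W g w.1 ∈ O
    rw [hg]
    exact hu

/-- Closure commutes with preimage under a continuous open map, and frames carry the induced
topology. Closures in the Grassmannian thereby become closures in a vector space. -/
theorem Frame.span_mem_closure_iff [FiniteDimensional ℝ W] {S : Set (Gr W r)} (v : Frame W r) :
    v.span ∈ closure S ↔ v.1 ∈ @closure _ (moduleTopology ℝ (Fin r → W))
      {v : Fin r → W | ∃ h : LinearIndependent ℝ v, Frame.span ⟨v, h⟩ ∈ S} := by
  let _ : TopologicalSpace (Fin r → W) := moduleTopology ℝ (Fin r → W)
  have hcont : Continuous (Frame.span : Frame W r → Gr W r) := continuous_coinduced_rng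
  have hind : Topology.IsInducing (Subtype.val : Frame W r → Fin r → W) := ⟨rfl⟩
  have h1 : closure (Frame.span ⁻¹' S : Set (Frame W r))
      = Subtype.val ⁻¹' closure (Subtype.val '' (Frame.span ⁻¹' S)) :=
    hind.closure_eq_preimage_closure_image _
  have h2 : v.span ∈ closure S ↔ v.1 ∈ closure (Subtype.val '' (Frame.span ⁻¹' S)) := by
    rw [← Set.mem_preimage, Frame.isOpenMap_span.preimage_closure_eq_closure_preimage hcont, h1]
    rfl
  have : (Subtype.val '' (Frame.span ⁻¹' S) : Set (Fin r → W))
      = {v : Fin r → W | ∃ h : LinearIndependent ℝ v, Frame.span ⟨v, h⟩ ∈ S} := by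
    ext w
    exact ⟨fun ⟨x, hx, hxw⟩ => ⟨hxw ▸ x.2, by subst hxw; exact hx⟩, fun ⟨h, hw⟩ => ⟨⟨w, h⟩, hw, rfl⟩⟩
  rw [h2, this]

/-- The planes on which a quadratic form is nonnegative form a closed set. -/
theorem isClosed_nonneg [FiniteDimensional ℝ W] (B : W →ₗ[ℝ] W →ₗ[ℝ] ℝ) :
    IsClosed {V : Gr W r | ∀ x ∈ V.1, 0 ≤ B x x} := by
  let _ : TopologicalSpace (Fin r → W) := moduleTopology ℝ (Fin r → W)
  have hind : Topology.IsInducing (Subtype.val : Frame W r → Fin r → W) := ⟨rfl⟩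
  have hq : Topology.IsQuotientMap (Frame.span : Frame W r → Gr W r) :=
    ⟨⟨rfl⟩, Frame.span_surjective⟩
  rw [← hq.isClosed_preimage]
  -- On frames the condition is an intersection, over the coefficients of a linear combination, of
  -- inequalities between polynomial functions.
  have : (Frame.span ⁻¹' {V : Gr W r | ∀ x ∈ V.1, 0 ≤ B x x} : Set (Frame W r))
      = Subtype.val ⁻¹' (⋂ c : Fin r → ℝ,
        {v : Fin r → W | 0 ≤ B (∑ i, c i • v i) (∑ i, c i • v i)}) := by
    ext v
    constructor
    · exact fun h => Set.mem_iInter.2 fun c =>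
        h _ ((Submodule.mem_span_range_iff_exists_fun ℝ).2 ⟨c, rfl⟩)
    · intro h x hx
      obtain ⟨c, rfl⟩ := (Submodule.mem_span_range_iff_exists_fun ℝ).1 hx
      exact Set.mem_iInter.1 h c
  rw [this]
  refine IsClosed.preimage hind.continuous (isClosed_iInter fun c => ?_)
  refine isClosed_le continuous_const (IsPolyFun.continuous ?_)
  have h : IsPolyMap fun v : Fin r → W => ∑ i, c i • v i :=
    IsPolyMap.sum fun i _ => IsPolyMap.smul (.const (c i)) (IsPolyMap.id.proj i)
  exact (h.bilinear B h).isPolyFun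

theorem isSemialgebraic_linearIndependent [FiniteDimensional ℝ W] :
    IsSemialgebraic {v : Fin r → W | LinearIndependent ℝ v} := by
  simp only [Fintype.linearIndependent_iff]
  refine IsSemialgebraic.forall_vec (P := fun (v : Fin r → W) (c : Fin r → ℝ) =>
    ∑ i, c i • v i = 0 → ∀ i, c i = 0) ?_
  refine IsSemialgebraic.imp (IsPolyMap.semialgebraic_eq (IsPolyMap.sum fun i _ => ?_)
    (IsPolyMap.const 0)) (IsSemialgebraic.forall_finite fun i => IsSemialgebraic.eq ?_ (.const 0))
  · exact IsPolyMap.smul (IsPolyMap.id.snd.proj i).isPolyFun (IsPolyMap.id.fst.proj i)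
  · exact (IsPolyMap.id.snd.proj i).isPolyFun

theorem IsSemialgebraicGr.closure [FiniteDimensional ℝ W] {S : Set (Gr W r)}
    (hS : IsSemialgebraicGr S) : IsSemialgebraicGr (closure S) := by
  have : {v : Fin r → W | ∃ h : LinearIndependent ℝ v, Frame.span ⟨v, h⟩ ∈ _root_.closure S}
      = {v : Fin r → W | LinearIndependent ℝ v} ∩ @_root_.closure _ (moduleTopology ℝ (Fin r → W))
        {v : Fin r → W | ∃ h : LinearIndependent ℝ v, Frame.span ⟨v, h⟩ ∈ S} := by
    ext v
    constructor
    · rintro ⟨h, hv⟩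
      exact ⟨h, (Frame.span_mem_closure_iff ⟨v, h⟩).1 hv⟩
    · rintro ⟨h, hv⟩
      exact ⟨h, (Frame.span_mem_closure_iff ⟨v, h⟩).2 hv⟩
  unfold IsSemialgebraicGr
  rw [this]
  exact isSemialgebraic_linearIndependent.inter (IsSemialgebraic.closure hS)

end GrassmannianTopology

/-! ### Cartan subspaces as a first-order condition -/

section CartanDefinable

universe u

variable {𝔤 : Type u} [LieRing 𝔤] [LieAlgebra ℝ 𝔤]

/-- The right-hand side quantifies over finitely many vectors and scalars, hence is accessible to
quantifier elimination, unlike the supremum over all eigenvalues. -/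
theorem exists_eigenbasis_iff {V : Type*} [AddCommGroup V] [Module ℝ V] [FiniteDimensional ℝ V]
    (D : End ℝ V) : ⨆ μ : ℝ, D.eigenspace μ = ⊤ ↔
      ∃ (b : Fin (finrank ℝ V) → V) (c : Fin (finrank ℝ V) → ℝ),
        LinearIndependent ℝ b ∧ ∀ k, D (b k) = c k • b k := by
  constructor
  · intro h
    let s : Set V := ⋃ μ : ℝ, (D.eigenspace μ : Set V)
    have hs : Submodule.span ℝ s = ⊤ := by
      rw [← h, Submodule.span_iUnion]
      simp
    obtain ⟨t, hts, htspan, hli⟩ := exists_linearIndependent ℝ s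
    rw [hs] at htspan
    let B : Basis t ℝ V := Basis.mk hli (by rw [Subtype.range_coe, htspan])
    have : Fintype t := FiniteDimensional.fintypeBasisIndex B
    let e : Fin (finrank ℝ V) ≃ t :=
      (finCongr (finrank_eq_card_basis B)).trans (Fintype.equivFin t).symm
    have (k : Fin (finrank ℝ V)) : ∃ μ : ℝ, D (e k : V) = μ • (e k : V) := by
      obtain ⟨μ, hμ⟩ := Set.mem_iUnion.1 (hts (e k).2)
      exact ⟨μ, End.mem_eigenspace_iff.1 hμ⟩
    choose c hc using this
    exact ⟨fun k => e k, c, hli.comp e e.injective, hc⟩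
  · rintro ⟨b, c, hb, hbc⟩
    rw [eq_top_iff, ← hb.span_eq_top_of_card_eq_finrank' (by simp), Submodule.span_le]
    rintro _ ⟨k, rfl⟩
    exact Submodule.mem_iSup_of_mem (c k) (End.mem_eigenspace_iff.2 (hbc k))

theorem IsPolyMap.lie [FiniteDimensional ℝ 𝔤] {E : Type*} [AddCommGroup E] [Module ℝ E]
    {f g : E → 𝔤} (hf : IsPolyMap f) (hg : IsPolyMap g) : IsPolyMap fun w => ⁅f w, g w⁆ :=
  hf.bilinear (LinearMap.mk₂ ℝ (fun x y : 𝔤 => ⁅x, y⁆) add_lie smul_lie lie_add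
    fun c x y => lie_smul c x y) hg

/-- An element that acts on `𝔤` as an endomorphism diagonalizable over `ℝ`. -/
def IsSplitElement (x : 𝔤) : Prop := ⨆ μ : ℝ, (LieAlgebra.ad ℝ 𝔤 x).eigenspace μ = ⊤

theorem isSemialgebraic_isSplitElement [FiniteDimensional ℝ 𝔤] :
    IsSemialgebraic {x : 𝔤 | IsSplitElement x} := by
  simp only [IsSplitElement, exists_eigenbasis_iff, LieAlgebra.ad_apply]
  refine IsSemialgebraic.exists_vec (P := fun (x : 𝔤) (b : Fin (finrank ℝ 𝔤) → 𝔤) =>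
    ∃ c : Fin (finrank ℝ 𝔤) → ℝ, LinearIndependent ℝ b ∧
      ∀ k, ⁅x, b k⁆ = c k • b k) ?_
  refine IsSemialgebraic.exists_vec (P := fun (p : 𝔤 × (Fin (finrank ℝ 𝔤) → 𝔤))
    (c : Fin (finrank ℝ 𝔤) → ℝ) => LinearIndependent ℝ p.2 ∧
      ∀ k, ⁅p.1, p.2 k⁆ = c k • p.2 k) ?_
  refine .and (IsPolyMap.id.fst.snd.preimage_isSemialgebraic isSemialgebraic_linearIndependent)
    (.forall_finite fun k => IsPolyMap.semialgebraic_eq ?_ ?_)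
  · exact IsPolyMap.lie IsPolyMap.id.fst.fst (IsPolyMap.id.fst.snd.proj k)
  · exact IsPolyMap.smul (IsPolyMap.id.snd.proj k).isPolyFun (IsPolyMap.id.fst.snd.proj k)

/-- A linear subspace with zero bracket, as a Lie subalgebra. -/
def abelianSubalgebra (V : Submodule ℝ 𝔤) (hV : ∀ x ∈ V, ∀ y ∈ V, ⁅x, y⁆ = 0) :
    LieSubalgebra ℝ 𝔤 :=
  { V with lie_mem' := fun {x y} hx hy => hV x hx y hy ▸ V.zero_mem }

theorem isLieAbelian_iff (𝔞 : LieSubalgebra ℝ 𝔤) :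
    IsLieAbelian 𝔞 ↔ ∀ x ∈ 𝔞, ∀ y ∈ 𝔞, ⁅x, y⁆ = 0 := by
  constructor
  · intro h x hx y hy
    have := h.trivial ⟨x, hx⟩ ⟨y, hy⟩
    exact congrArg Subtype.val this
  · intro h
    exact ⟨fun x y => Subtype.ext (h x x.2 y y.2)⟩

theorem isSplitAbelian_iff (𝔞 : LieSubalgebra ℝ 𝔤) : IsSplitAbelian 𝔞 ↔
    (∀ x ∈ 𝔞, ∀ y ∈ 𝔞, ⁅x, y⁆ = 0) ∧ ∀ x ∈ 𝔞, IsSplitElement x :=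
  ⟨fun h => ⟨(isLieAbelian_iff 𝔞).1 h.abelian, h.diagonalizable⟩,
    fun h => ⟨(isLieAbelian_iff 𝔞).2 h.1, h.2⟩⟩

/-- Maximality can be tested by adding one element. -/
theorem isCartanSubspace_iff (𝔞 : LieSubalgebra ℝ 𝔤) : IsCartanSubspace 𝔞 ↔
    (∀ x ∈ 𝔞, ∀ y ∈ 𝔞, ⁅x, y⁆ = 0) ∧ (∀ x ∈ 𝔞, IsSplitElement x) ∧
    ∀ x, (∀ y ∈ 𝔞, ⁅x, y⁆ = 0) → (∀ s : ℝ, ∀ y ∈ 𝔞, IsSplitElement (s • x + y)) → x ∈ 𝔞 := by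
  rw [← and_assoc, ← isSplitAbelian_iff]
  refine and_congr_right fun h => ⟨fun hmax x hx hsplit => ?_, fun hmax 𝔟 h𝔟 hle x hx => ?_⟩
  · have hab := ((isSplitAbelian_iff 𝔞).1 h).1
    let V : Submodule ℝ 𝔤 := ℝ ∙ x ⊔ 𝔞.toSubmodule
    have hmem : ∀ z ∈ V, ∃ s : ℝ, ∃ y ∈ 𝔞, z = s • x + y := by
      intro z hz
      obtain ⟨_, hsx, y, hy, rfl⟩ := Submodule.mem_sup.1 hz
      obtain ⟨s, rfl⟩ := Submodule.mem_span_singleton.1 hsx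
      exact ⟨s, y, hy, rfl⟩
    have hV : ∀ z ∈ V, ∀ w ∈ V, ⁅z, w⁆ = 0 := by
      intro z hz w hw
      obtain ⟨s, y, hy, rfl⟩ := hmem z hz
      obtain ⟨t, u, hu, rfl⟩ := hmem w hw
      have h1 : ⁅y, x⁆ = 0 := by rw [← lie_skew, hx y hy, neg_zero]
      simp [hx u hu, h1, hab y hy u hu]
    have hle : 𝔞 ≤ abelianSubalgebra V hV := (le_sup_right : 𝔞.toSubmodule ≤ V)
    refine hmax ?_ hle ((le_sup_left : ℝ ∙ x ≤ V) (Submodule.mem_span_singleton_self x))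
    rw [isSplitAbelian_iff]
    refine ⟨hV, fun z hz => ?_⟩
    obtain ⟨s, y, hy, rfl⟩ := hmem z hz
    exact hsplit s y hy
  · obtain ⟨h1, h2⟩ := (isSplitAbelian_iff 𝔟).1 h𝔟
    exact hmax x (fun y hy => h1 x hx y (hle hy)) fun s y hy =>
      h2 _ (𝔟.toSubmodule.add_mem (𝔟.toSubmodule.smul_mem s hx) (hle hy))

/-- Quantifiers over subalgebras are replaced by quantifiers over vectors and coefficients; the
one-element test of maximality makes this possible. -/
theorem span_mem_cartan_iff {r : ℕ} (v : Frame 𝔤 r) : v.span ∈ cartan 𝔤 r ↔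
    (∀ i j, ⁅v.1 i, v.1 j⁆ = 0) ∧ (∀ c : Fin r → ℝ, IsSplitElement (∑ i, c i • v.1 i)) ∧
    ∀ x, (∀ i, ⁅x, v.1 i⁆ = 0) →
      (∀ (s : ℝ) (c : Fin r → ℝ), IsSplitElement (s • x + ∑ i, c i • v.1 i)) →
        ∃ c : Fin r → ℝ, ∑ i, c i • v.1 i = x := by
  have hmem : ∀ x, x ∈ Submodule.span ℝ (Set.range v.1) ↔ ∃ c : Fin r → ℝ, ∑ i, c i • v.1 i = x :=
    fun x => Submodule.mem_span_range_iff_exists_fun ℝ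
  have hsub : ∀ i, v.1 i ∈ Submodule.span ℝ (Set.range v.1) := fun i =>
    Submodule.subset_span (Set.mem_range_self i)
  have hlie : ∀ x : 𝔤, (∀ i, ⁅x, v.1 i⁆ = (0 : 𝔤)) → ∀ y ∈ Submodule.span ℝ (Set.range v.1), ⁅x, y⁆ = 0 := by
    intro x hx y hy
    obtain ⟨c, rfl⟩ := (hmem y).1 hy
    simp [lie_sum, hx]
  constructor
  · rintro ⟨𝔞, h𝔞, hspan⟩
    have hspan : 𝔞.toSubmodule = Submodule.span ℝ (Set.range v.1) := hspan
    have hm : ∀ x, x ∈ 𝔞 ↔ x ∈ Submodule.span ℝ (Set.range v.1) := fun x => by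
      rw [← hspan, LieSubalgebra.mem_toSubmodule]
    obtain ⟨h1, h2, h3⟩ := (isCartanSubspace_iff 𝔞).1 h𝔞
    simp only [hm] at h1 h2 h3
    refine ⟨fun i j => h1 _ (hsub i) _ (hsub j), fun c => h2 _ ((hmem _).2 ⟨c, rfl⟩),
      fun x hx hs => (hmem x).1 (h3 x (hlie x hx) fun s y hy => ?_)⟩
    obtain ⟨c, rfl⟩ := (hmem y).1 hy
    exact hs s c
  · rintro ⟨h1, h2, h3⟩
    have hab : ∀ x ∈ Submodule.span ℝ (Set.range v.1), ∀ y ∈ Submodule.span ℝ (Set.range v.1),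
        ⁅x, y⁆ = 0 := by
      intro x hx y hy
      refine hlie x (fun i => ?_) y hy
      rw [← lie_skew, hlie (v.1 i) (h1 i) x hx, neg_zero]
    refine ⟨abelianSubalgebra _ hab, (isCartanSubspace_iff _).2 ⟨hab, fun x hx => ?_,
      fun x hx hs => (hmem x).2 (h3 x (fun i => hx _ (hsub i)) fun s c =>
        hs s _ ((hmem _).2 ⟨c, rfl⟩))⟩, rfl⟩
    obtain ⟨c, rfl⟩ := (hmem x).1 hx
    exact h2 c

theorem isSemialgebraicGr_cartan [FiniteDimensional ℝ 𝔤] (r : ℕ) :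
    IsSemialgebraicGr (cartan 𝔤 r) := by
  have hset : {v : Fin r → 𝔤 | ∃ h : LinearIndependent ℝ v, Frame.span ⟨v, h⟩ ∈ cartan 𝔤 r} =
      {v | LinearIndependent ℝ v ∧ (∀ i j, ⁅v i, v j⁆ = 0) ∧
        (∀ c : Fin r → ℝ, IsSplitElement (∑ i, c i • v i)) ∧
        ∀ x : 𝔤, (∀ i, ⁅x, v i⁆ = 0) →
          (∀ (s : ℝ) (c : Fin r → ℝ), IsSplitElement (s • x + ∑ i, c i • v i)) →
            ∃ c : Fin r → ℝ, ∑ i, c i • v i = x} := by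
    ext v
    constructor
    · rintro ⟨h, hv⟩
      exact ⟨h, (span_mem_cartan_iff ⟨v, h⟩).1 hv⟩
    · rintro ⟨h, hv⟩
      exact ⟨h, (span_mem_cartan_iff ⟨v, h⟩).2 hv⟩
  unfold IsSemialgebraicGr
  rw [hset]
  have hlin {E : Type u} [AddCommGroup E] [Module ℝ E] {v : E → Fin r → 𝔤} {c : E → Fin r → ℝ}
      (hv : IsPolyMap v) (hc : IsPolyMap c) : IsPolyMap fun p => ∑ i, c p i • v p i :=
    IsPolyMap.sum fun i _ => .smul (hc.proj i).isPolyFun (hv.proj i)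
  refine isSemialgebraic_linearIndependent.and (.and ?_ (.and ?_ ?_))
  · exact .forall_finite fun i => .forall_finite fun j => IsPolyMap.semialgebraic_eq
      (.lie (IsPolyMap.id.proj i) (IsPolyMap.id.proj j))
      (.const 0)
  · refine IsSemialgebraic.forall_vec (P := fun (v : Fin r → 𝔤) (c : Fin r → ℝ) =>
      IsSplitElement (∑ i, c i • v i)) ?_
    exact (hlin IsPolyMap.id.fst IsPolyMap.id.snd).preimage_isSemialgebraic
      isSemialgebraic_isSplitElement
  · refine IsSemialgebraic.forall_vec (P := fun (v : Fin r → 𝔤) (x : 𝔤) =>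
      (∀ i, ⁅x, v i⁆ = 0) →
          (∀ (s : ℝ) (c : Fin r → ℝ), IsSplitElement (s • x + ∑ i, c i • v i)) →
            ∃ c : Fin r → ℝ, ∑ i, c i • v i = x) ?_
    refine .imp (.forall_finite fun i => IsPolyMap.semialgebraic_eq
      (.lie IsPolyMap.id.snd (IsPolyMap.id.fst.proj i))
      (.const 0)) (.imp ?_ ?_)
    · refine IsSemialgebraic.forall_vec (P := fun (p : (Fin r → 𝔤) × 𝔤) (s : ℝ) =>
        ∀ c : Fin r → ℝ, IsSplitElement (s • p.2 + ∑ i, c i • p.1 i)) ?_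
      refine IsSemialgebraic.forall_vec (P := fun (p : ((Fin r → 𝔤) × 𝔤) × ℝ) (c : Fin r → ℝ) =>
        IsSplitElement (p.2 • p.1.2 + ∑ i, c i • p.1.1 i)) ?_
      exact (IsPolyMap.add (.smul IsPolyMap.id.fst.snd.isPolyFun IsPolyMap.id.fst.fst.snd)
        (hlin IsPolyMap.id.fst.fst.fst IsPolyMap.id.snd)).preimage_isSemialgebraic
        isSemialgebraic_isSplitElement
    · refine IsSemialgebraic.exists_vec (P := fun (p : (Fin r → 𝔤) × 𝔤) (c : Fin r → ℝ) =>
        ∑ i, c i • p.1 i = p.2) ?_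
      exact IsPolyMap.semialgebraic_eq (hlin IsPolyMap.id.fst.fst IsPolyMap.id.snd)
        IsPolyMap.id.fst.snd

end CartanDefinable

end CartanGr

namespace CartanGr

attribute [local instance 100] LieRing.ofAssociativeRing

/-! ### Diagonalizable endomorphisms and commuting families -/

section Diagonalizable

open Polynomial

variable {V : Type*} [AddCommGroup V] [Module ℝ V]

theorem ker_aeval_prod_le_iSup_eigenspace (D : End ℝ V) (s : Finset ℝ) :
    LinearMap.ker (aeval D (∏ a ∈ s, (X - C a))) ≤ ⨆ μ : ℝ, D.eigenspace μ := by
  classical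
  induction s using Finset.induction_on with
  | empty => simp [Module.End.one_eq_id]
  | insert a s ha ih =>
    rw [Finset.prod_insert ha, ← sup_ker_aeval_eq_ker_aeval_mul_of_coprime]
    · refine sup_le (fun v hv => Submodule.mem_iSup_of_mem a ?_) ih
      rw [End.mem_eigenspace_iff, ← sub_eq_zero]
      simpa [Module.algebraMap_end_apply] using hv
    · exact IsCoprime.prod_right fun b hb => isCoprime_X_sub_C_of_isUnit_sub
        (sub_ne_zero.2 (by rintro rfl; exact ha hb)).isUnit

theorem iSup_eigenspace_eq_top_of_aeval_prod {D : End ℝ V} {s : Finset ℝ}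
    (h : aeval D (∏ a ∈ s, (X - C a)) = 0) : ⨆ μ : ℝ, D.eigenspace μ = ⊤ := by
  rw [eq_top_iff]
  refine le_trans ?_ (ker_aeval_prod_le_iSup_eigenspace D s)
  rw [h, LinearMap.ker_zero]

variable [FiniteDimensional ℝ V]

theorem aeval_prod_eq_zero_of_iSup_eigenspace_eq_top {D : End ℝ V}
    (h : ⨆ μ : ℝ, D.eigenspace μ = ⊤) :
    ∃ s : Finset ℝ, aeval D (∏ a ∈ s, (X - C a)) = 0 := by
  have hfin : {μ | D.HasEigenvalue μ}.Finite := End.finite_hasEigenvalue D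
  refine ⟨hfin.toFinset, ?_⟩
  rw [← LinearMap.ker_eq_top, eq_top_iff, ← h]
  refine iSup_le fun μ v hv => ?_
  rw [LinearMap.mem_ker]
  by_cases hv0 : v = 0
  · simp [hv0]
  · have hμ : D.HasEigenvector μ v := ⟨hv, hv0⟩
    rw [End.aeval_apply_of_hasEigenvector hμ, eval_prod, Finset.prod_eq_zero (i := μ), zero_smul]
    · simpa using End.hasEigenvalue_of_hasEigenvector hμ
    · simp

theorem isSemisimple_of_iSup_eigenspace_eq_top {D : End ℝ V}
    (h : ⨆ μ : ℝ, D.eigenspace μ = ⊤) : D.IsSemisimple := by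
  obtain ⟨s, hs⟩ := aeval_prod_eq_zero_of_iSup_eigenspace_eq_top h
  refine End.isSemisimple_of_squarefree_aeval_eq_zero (Separable.squarefree ?_) hs
  exact separable_prod_X_sub_C_iff'.2 fun x _ y _ hxy => hxy

/-- Commuting diagonalizable endomorphisms are simultaneously diagonalizable. -/
theorem iSup_iInf_eigenspace_eq_top {ι : Type*} (f : ι → End ℝ V)
    (hc : ∀ i j, Commute (f i) (f j)) (h : ∀ i, ⨆ μ : ℝ, (f i).eigenspace μ = ⊤) :
    ⨆ χ : ι → ℝ, ⨅ i, (f i).eigenspace (χ i) = ⊤ := by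
  -- Diagonalizable endomorphisms are semisimple, so the decomposition into simultaneous generalized
  -- eigenspaces is one into eigenspaces.
  have hm : ∀ i μ, (f i).maxGenEigenspace μ = (f i).eigenspace μ := fun i μ =>
    (isSemisimple_of_iSup_eigenspace_eq_top (h i)).isFinitelySemisimple.maxGenEigenspace_eq_eigenspace
      μ
  have := End.iSup_iInf_maxGenEigenspace_eq_top_of_iSup_maxGenEigenspace_eq_top_of_commute f
    (fun i j _ => hc i j) (fun i => by simpa only [hm] using h i)
  simpa only [hm] using this

theorem iSup_eigenspace_smul_add_eq_top {D E : End ℝ V} (hc : Commute D E)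
    (hD : ⨆ μ : ℝ, D.eigenspace μ = ⊤) (hE : ⨆ μ : ℝ, E.eigenspace μ = ⊤) (s : ℝ) :
    ⨆ μ : ℝ, (s • D + E).eigenspace μ = ⊤ := by
  have := iSup_iInf_eigenspace_eq_top (fun b : Bool => if b then D else E)
    (by rintro (_ | _) (_ | _) <;> simp [hc, hc.symm]) (by rintro (_ | _) <;> simpa)
  rw [eq_top_iff, ← this]
  refine iSup_le fun χ v hv => Submodule.mem_iSup_of_mem (s * χ true + χ false) ?_
  rw [Submodule.mem_iInf] at hv
  have h1 := End.mem_eigenspace_iff.1 (hv true)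
  have h2 := End.mem_eigenspace_iff.1 (hv false)
  simp only [if_true, Bool.false_eq_true, if_false] at h1 h2
  rw [End.mem_eigenspace_iff]
  simp [h1, h2, add_smul, mul_smul]

end Diagonalizable

/-! ### The real part of an endomorphism and its trace -/

section RealPart

open Polynomial TensorProduct

theorem aeval_apply_sub_smul_of_dvd {K U : Type*} [Field K] [AddCommGroup U] [Module K U]
    {T : End K U} {p : K[X]} {a c : K} {n : ℕ} (h : (X - C a) ^ n ∣ p - C c) {w : U}
    (hw : ((T - algebraMap K _ a) ^ n) w = 0) : aeval T p w = c • w := by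
  obtain ⟨g, hg⟩ := h
  have h1 : aeval T (p - C c) w = 0 := by
    rw [hg, mul_comm, map_mul, End.mul_apply]
    simp [hw]
  rw [← sub_eq_zero]
  simpa [Module.algebraMap_end_apply] using h1

/-- A real polynomial that takes the value `Re a` to order `n` at all points of a finite set. -/
theorem exists_real_polynomial_re (s : Finset ℂ) (n : ℕ) :
    ∃ q : ℝ[X], ∀ a ∈ s, (X - C a) ^ n ∣ q.map (algebraMap ℝ ℂ) - C (a.re : ℂ) := by
  classical
  -- The set is made stable under conjugation: then a solution `p` of the congruences and its
  -- conjugate both solve them, and their average has real coefficients.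
  let Λ := s ∪ s.image (starRingEnd ℂ)
  have hΛ : ∀ a ∈ Λ, starRingEnd ℂ a ∈ Λ := by
    intro a ha
    simp only [Λ, Finset.mem_union, Finset.mem_image] at ha ⊢
    rcases ha with ha | ⟨b, hb, rfl⟩
    · exact Or.inr ⟨a, ha, rfl⟩
    · exact Or.inl (by simpa using hb)
  obtain ⟨p, hp⟩ := Ideal.exists_forall_sub_mem_ideal
    (I := fun a : Λ => Ideal.span {(X - C a.1) ^ n}) (fun a b hab => by
      rw [Function.onFun, Ideal.isCoprime_span_singleton_iff]
      exact (isCoprime_X_sub_C_of_isUnit_sub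
        (sub_ne_zero.2 fun h => hab (Subtype.ext h)).isUnit).pow)
    (fun a => C (a.1.re : ℂ))
  simp only [Ideal.mem_span_singleton] at hp
  have hp' : ∀ a ∈ Λ, (X - C a) ^ n ∣ p.map (starRingEnd ℂ) - C (a.re : ℂ) := by
    intro a ha
    have := Polynomial.map_dvd (starRingEnd ℂ) (hp ⟨_, hΛ a ha⟩)
    simpa using this
  have hlift : C (1 / 2 : ℂ) * (p + p.map (starRingEnd ℂ)) ∈ Polynomial.lifts (algebraMap ℝ ℂ) := by
    rw [Polynomial.lifts_iff_coeff_lifts]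
    intro i
    refine ⟨(p.coeff i).re, ?_⟩
    rw [coeff_C_mul, coeff_add, coeff_map, Complex.add_conj]
    simp
  obtain ⟨q, hq⟩ := (Polynomial.mem_lifts _).1 hlift
  refine ⟨q, fun a ha => ?_⟩
  have ha' : a ∈ Λ := Finset.mem_union_left _ ha
  have h1 := ((hp ⟨a, ha'⟩).add (hp' a ha')).mul_left (C (1 / 2 : ℂ))
  rw [hq]
  have h3 : (C (1 / 2 : ℂ) : ℂ[X]) * 2 = 1 := by
    rw [← C_ofNat, ← C_mul]; norm_num
  have h2 : C (1 / 2 : ℂ) * (p + p.map (starRingEnd ℂ)) - C (a.re : ℂ) = C (1 / 2 : ℂ) *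
      (p - C (a.re : ℂ) + (p.map (starRingEnd ℂ) - C (a.re : ℂ))) := by
    linear_combination C (a.re : ℂ) * h3
  rw [h2]
  exact h1

variable {V : Type*} [AddCommGroup V] [Module ℝ V] [FiniteDimensional ℝ V]

/-- The complexification of a real endomorphism. -/
noncomputable abbrev complexify {V : Type*} [AddCommGroup V] [Module ℝ V] (D : End ℝ V) : End ℂ (ℂ ⊗[ℝ] V) :=
  D.baseChange ℂ

/-- The eigenvalues of the complexification. -/
noncomputable def complexEigenvalues (D : End ℝ V) : Finset ℂ :=
  (End.finite_hasEigenvalue (complexify D)).toFinset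

theorem exists_realPart_polynomial (D : End ℝ V) : ∃ q : ℝ[X], ∀ a ∈ complexEigenvalues D,
    (X - C a) ^ (finrank ℂ (ℂ ⊗[ℝ] V)) ∣ q.map (algebraMap ℝ ℂ) - C (a.re : ℂ) :=
  exists_real_polynomial_re _ _

/-- A real polynomial which, applied to `D`, yields the endomorphism that acts on the generalized
eigenspaces of the complexification of `D` by the real parts of the eigenvalues. -/
noncomputable def realPartPolynomial (D : End ℝ V) : ℝ[X] := (exists_realPart_polynomial D).choose

/-- The real part of `D` in its complete Jordan decomposition. -/
noncomputable def realPart (D : End ℝ V) : End ℝ V := aeval D (realPartPolynomial D)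

theorem mem_complexEigenvalues {D : End ℝ V} {a : ℂ} {w : ℂ ⊗[ℝ] V}
    (hw : w ∈ (complexify D).maxGenEigenspace a) (h0 : w ≠ 0) : a ∈ complexEigenvalues D := by
  rw [complexEigenvalues, Set.Finite.mem_toFinset]
  have : (complexify D).HasUnifEigenvalue a ⊤ := by
    intro hbot
    have hw' : w ∈ (complexify D).genEigenspace a ⊤ := hw
    rw [hbot, Submodule.mem_bot] at hw'
    exact h0 hw'
  exact (End.hasUnifEigenvalue_iff_hasUnifEigenvalue_one (by simp)).1 this

omit [FiniteDimensional ℝ V] in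
theorem complexify_aeval (D : End ℝ V) (q : ℝ[X]) :
    complexify (aeval D q) = aeval (complexify D) (q.map (algebraMap ℝ ℂ)) := by
  rw [aeval_map_algebraMap]
  exact (aeval_algHom_apply (End.baseChangeHom ℝ ℂ V) D q).symm

theorem complexify_realPart_apply {D : End ℝ V} {a : ℂ} {w : ℂ ⊗[ℝ] V}
    (hw : w ∈ (complexify D).maxGenEigenspace a) :
    complexify (realPart D) w = (a.re : ℂ) • w := by
  by_cases h0 : w = 0
  · simp [h0]
  rw [realPart, complexify_aeval]
  refine aeval_apply_sub_smul_of_dvd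
    ((exists_realPart_polynomial D).choose_spec a (mem_complexEigenvalues hw h0)) ?_
  rw [End.maxGenEigenspace_eq_genEigenspace_finrank, End.mem_genEigenspace_nat,
    LinearMap.mem_ker] at hw
  simpa [Algebra.algebraMap_eq_smul_one] using hw

theorem eq_of_forall_complexify_eq {D : End ℝ V} {A B : End ℝ V}
    (h : ∀ a, ∀ w ∈ (complexify D).maxGenEigenspace a, complexify A w = complexify B w) :
    A = B := by
  apply LinearMap.baseChangeHom_injective ℝ V ℂ
  change complexify A = complexify B
  have : ⊤ ≤ LinearMap.eqLocus (complexify A) (complexify B) := by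
    rw [← End.iSup_maxGenEigenspace_eq_top (complexify D)]
    exact iSup_le fun a w hw => h a w hw
  exact LinearMap.ext fun w => this (Submodule.mem_top)

theorem iSup_eigenspace_realPart (D : End ℝ V) : ⨆ μ : ℝ, (realPart D).eigenspace μ = ⊤ := by
  classical
  refine iSup_eigenspace_eq_top_of_aeval_prod
    (s := (complexEigenvalues D).image Complex.re) ?_
  refine eq_of_forall_complexify_eq (D := D) fun a w hw => ?_
  by_cases h0 : w = 0
  · simp [h0]
  rw [complexify_aeval, End.aeval_apply_of_mem_apply_eq_smul (complexify_realPart_apply hw)]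
  have : eval (a.re : ℂ) ((∏ a ∈ (complexEigenvalues D).image Complex.re, (X - C a)).map
      (algebraMap ℝ ℂ)) = 0 := by
    rw [Polynomial.map_prod, eval_prod]
    exact Finset.prod_eq_zero
      (Finset.mem_image_of_mem _ (mem_complexEigenvalues hw h0)) (by simp)
  rw [this]
  simp

theorem realPart_apply_of_apply_eq_smul {D : End ℝ V} {v : V} {c : ℝ} (h : D v = c • v) :
    realPart D v = c • v := by
  have hw : (1 : ℂ) ⊗ₜ[ℝ] v ∈ (complexify D).maxGenEigenspace (c : ℂ) := by
    apply End.eigenspace_le_maxGenEigenspace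
    rw [End.mem_eigenspace_iff, LinearMap.baseChange_tmul, h, TensorProduct.tmul_smul]
    rfl
  have := complexify_realPart_apply hw
  rw [LinearMap.baseChange_tmul, Complex.ofReal_re] at this
  have h2 : ((c : ℂ) • (1 : ℂ) ⊗ₜ[ℝ] v) = (1 : ℂ) ⊗ₜ[ℝ] (c • v) := by
    rw [TensorProduct.tmul_smul]; rfl
  rw [h2] at this
  exact Module.FaithfullyFlat.tensorProduct_mk_injective (A := ℝ) (B := ℂ) _ this

/-- On the generalized eigenspace of `a`, `p(T)` differs from the scalar `p(a)` by a nilpotent,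
because `X - a` divides `p - p(a)`; nilpotents have trace zero. -/
theorem trace_aeval_eq_sum {U : Type*} [AddCommGroup U] [Module ℂ U] [FiniteDimensional ℂ U]
    (T : End ℂ U) (p : ℂ[X]) : LinearMap.trace ℂ U (aeval T p) =
      ∑ a ∈ (End.finite_hasEigenvalue T).toFinset,
        (finrank ℂ (T.maxGenEigenspace a) : ℂ) * p.eval a := by
  classical
  have hint : DirectSum.IsInternal fun a => T.maxGenEigenspace a :=
    DirectSum.isInternal_submodule_of_iSupIndep_of_iSup_eq_top
      (End.independent_maxGenEigenspace T) (End.iSup_maxGenEigenspace_eq_top T)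
  have hbot : ∀ a, T.maxGenEigenspace a ≠ ⊥ ↔ T.HasEigenvalue a := fun a =>
    End.hasUnifEigenvalue_iff_hasUnifEigenvalue_one (by simp)
  have hfin : {a | T.maxGenEigenspace a ≠ ⊥}.Finite := by
    simp only [hbot]
    exact End.finite_hasEigenvalue T
  have hcomm : Commute T (aeval T p) := by
    simpa using (Commute.all X p).map (aeval T)
  have hmaps : ∀ a, Set.MapsTo (aeval T p) (T.maxGenEigenspace a) (T.maxGenEigenspace a) :=
    fun a => End.mapsTo_maxGenEigenspace_of_comm hcomm a
  rw [LinearMap.trace_eq_sum_trace_restrict' hint hfin hmaps]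
  refine Finset.sum_congr (by ext a; simp [hbot]) fun a _ => ?_
  have hnil : IsNilpotent ((aeval T p).restrict (hmaps a) - algebraMap ℂ _ (p.eval a)) := by
    refine ⟨finrank ℂ U, LinearMap.ext fun w => Subtype.ext ?_⟩
    obtain ⟨g, hg⟩ := dvd_iff_isRoot.2 (show (p - C (p.eval a)).IsRoot a by simp)
    have hpow : ∀ (k : ℕ) (w : T.maxGenEigenspace a),
        ((((aeval T p).restrict (hmaps a) - algebraMap ℂ _ (p.eval a)) ^ k) w : U)
          = aeval T ((p - C (p.eval a)) ^ k) w := by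
      intro k
      induction k with
      | zero => simp
      | succ k ih =>
        intro w
        rw [pow_succ, End.mul_apply, ih, pow_succ, map_mul, End.mul_apply]
        congr 1
        simp [Module.algebraMap_end_apply]
        rfl
    rw [hpow, hg, mul_pow, mul_comm, map_mul, End.mul_apply]
    have hw : ((T - a • 1) ^ finrank ℂ U) (w : U) = 0 := by
      rw [← LinearMap.mem_ker, ← End.mem_genEigenspace_nat,
        ← End.maxGenEigenspace_eq_genEigenspace_finrank]
      exact w.2
    have : aeval T ((X - C a) ^ finrank ℂ U) (w : U) = 0 := by
      simpa [Algebra.algebraMap_eq_smul_one] using hw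
    rw [this, map_zero]
    rfl
  have htr := (LinearMap.isNilpotent_trace_of_isNilpotent hnil).eq_zero
  rw [map_sub, sub_eq_zero] at htr
  rw [htr, Algebra.algebraMap_eq_smul_one, map_smul, LinearMap.trace_one, smul_eq_mul, mul_comm]

theorem trace_aeval_eq_sum_complexEigenvalues (D : End ℝ V) (p : ℝ[X]) :
    ((LinearMap.trace ℝ V (aeval D p) : ℝ) : ℂ) = ∑ a ∈ complexEigenvalues D,
      (finrank ℂ ((complexify D).maxGenEigenspace a) : ℂ) * (p.map (algebraMap ℝ ℂ)).eval a := by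
  have := LinearMap.trace_baseChange (aeval D p) ℂ
  change LinearMap.trace ℂ _ (complexify (aeval D p)) = _ at this
  rw [complexify_aeval, trace_aeval_eq_sum] at this
  exact this.symm

theorem exists_mem_maxGenEigenspace {D : End ℝ V} {a : ℂ} (ha : a ∈ complexEigenvalues D) :
    ∃ w ∈ (complexify D).maxGenEigenspace a, w ≠ 0 := by
  rw [complexEigenvalues, Set.Finite.mem_toFinset] at ha
  obtain ⟨w, hw⟩ := End.HasEigenvalue.exists_hasEigenvector ha
  exact ⟨w, End.eigenspace_le_maxGenEigenspace hw.1, hw.2⟩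

theorem eval_realPartPolynomial {D : End ℝ V} {a : ℂ} (ha : a ∈ complexEigenvalues D) :
    ((realPartPolynomial D).map (algebraMap ℝ ℂ)).eval a = (a.re : ℂ) := by
  rw [complexEigenvalues, Set.Finite.mem_toFinset] at ha
  obtain ⟨w, hw⟩ := End.HasEigenvalue.exists_hasEigenvector ha
  have h1 := complexify_realPart_apply (End.eigenspace_le_maxGenEigenspace hw.1)
  rw [realPart, complexify_aeval, End.aeval_apply_of_hasEigenvector hw] at h1
  exact smul_left_injective ℂ hw.2 h1

/-- An eigenvalue `a` contributes `a * Re a`, whose real part is a square. This positivity is the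
source of all definiteness statements about the Killing form below. -/
theorem trace_mul_realPart (D : End ℝ V) : LinearMap.trace ℝ V (D * realPart D) =
    ∑ a ∈ complexEigenvalues D,
      (finrank ℂ ((complexify D).maxGenEigenspace a) : ℝ) * a.re ^ 2 := by
  have h1 : D * realPart D = aeval D (X * realPartPolynomial D) := by simp [realPart]
  have := congrArg Complex.re (trace_aeval_eq_sum_complexEigenvalues D (X * realPartPolynomial D))
  rw [h1, ← Complex.ofReal_re (LinearMap.trace ℝ V _), this, Complex.re_sum]
  refine Finset.sum_congr rfl fun a ha => ?_
  rw [Polynomial.map_mul, eval_mul, eval_realPartPolynomial ha]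
  simp [sq]

theorem realPart_eq_zero_of_re_eq_zero {D : End ℝ V} (h : ∀ a ∈ complexEigenvalues D, a.re = 0) :
    realPart D = 0 := by
  refine eq_of_forall_complexify_eq (D := D) fun a w hw => ?_
  by_cases h0 : w = 0
  · simp [h0]
  rw [complexify_realPart_apply hw, h a (mem_complexEigenvalues hw h0)]
  simp

theorem trace_mul_realPart_nonneg (D : End ℝ V) : 0 ≤ LinearMap.trace ℝ V (D * realPart D) := by
  rw [trace_mul_realPart]
  positivity

theorem realPart_eq_zero_of_trace {D : End ℝ V} (h : LinearMap.trace ℝ V (D * realPart D) = 0) :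
    realPart D = 0 := by
  refine realPart_eq_zero_of_re_eq_zero fun a ha => ?_
  rw [trace_mul_realPart, Finset.sum_eq_zero_iff_of_nonneg (fun a _ => by positivity)] at h
  obtain ⟨w, hw, h0⟩ := exists_mem_maxGenEigenspace ha
  have hpos : 0 < finrank ℂ ((complexify D).maxGenEigenspace a) :=
    finrank_pos_iff_exists_ne_zero.2 ⟨⟨w, hw⟩, fun h => h0 (congrArg Subtype.val h)⟩
  have := h a ha
  have h2 : ((finrank ℂ ((complexify D).maxGenEigenspace a) : ℕ) : ℝ) ≠ 0 := by
    exact_mod_cast hpos.ne'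
  simpa [h2] using this

theorem trace_mul_self_nonpos {D : End ℝ V} (h : realPart D = 0) :
    LinearMap.trace ℝ V (D * D) ≤ 0 := by
  have h1 : D * D = aeval D (X ^ 2 : ℝ[X]) := by simp [sq]
  have := congrArg Complex.re (trace_aeval_eq_sum_complexEigenvalues D (X ^ 2))
  rw [h1, ← Complex.ofReal_re (LinearMap.trace ℝ V _), this, Complex.re_sum]
  refine Finset.sum_nonpos fun a ha => ?_
  obtain ⟨w, hw, h0⟩ := exists_mem_maxGenEigenspace ha
  have hre := complexify_realPart_apply hw
  have h2 : complexify (0 : End ℝ V) w = 0 := by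
    rw [complexify, LinearMap.baseChange_zero, LinearMap.zero_apply]
  rw [h, h2, eq_comm, smul_eq_zero] at hre
  have hre : a.re = 0 := by simpa using hre.resolve_right h0
  have : ((X ^ 2 : ℝ[X]).map (algebraMap ℝ ℂ)).eval a = a ^ 2 := by simp
  rw [this]
  have h3 : (((finrank ℂ ((complexify D).maxGenEigenspace a) : ℂ) * a ^ 2)).re
      = -((finrank ℂ ((complexify D).maxGenEigenspace a) : ℝ) * a.im ^ 2) := by
    simp [sq, hre]
  rw [h3, Left.neg_nonpos_iff]
  positivity

end RealPart

/-! ### The real part of an inner derivation is a derivation -/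

section RealPartDerivation

open TensorProduct

variable {𝔤 : Type*} [LieRing 𝔤] [LieAlgebra ℝ 𝔤] [FiniteDimensional ℝ 𝔤]

/-- Over ℂ, the bracket of the generalized eigenspaces of `ad z` for `a` and `b` lies in that for `a
+ b`, and taking real parts is additive. The identity descends to `𝔤` because `𝔤` embeds in its
complexification. -/
theorem realPart_ad_lie (z x y : 𝔤) : realPart (LieAlgebra.ad ℝ 𝔤 z) ⁅x, y⁆ =
    ⁅realPart (LieAlgebra.ad ℝ 𝔤 z) x, y⁆ + ⁅x, realPart (LieAlgebra.ad ℝ 𝔤 z) y⁆ := by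
  set D := LieAlgebra.ad ℝ 𝔤 z with hD
  have hT : complexify D = LieModule.toEnd ℂ (ℂ ⊗[ℝ] 𝔤) (ℂ ⊗[ℝ] 𝔤) (1 ⊗ₜ z) :=
    (LieModule.toEnd_baseChange ℝ ℂ 𝔤 𝔤 z).symm
  have htop := End.iSup_maxGenEigenspace_eq_top (complexify D)
  have hladd : ∀ u v v' : ℂ ⊗[ℝ] 𝔤, ⁅u, v + v'⁆ = ⁅u, v⁆ + ⁅u, v'⁆ := fun u v v' => lie_add u v v'
  have hlzero : ∀ u : ℂ ⊗[ℝ] 𝔤, ⁅u, (0 : ℂ ⊗[ℝ] 𝔤)⁆ = 0 := fun u => lie_zero u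
  have hlsmul : ∀ (c : ℂ) (u v : ℂ ⊗[ℝ] 𝔤), ⁅u, c • v⁆ = c • ⁅u, v⁆ := fun c u v => lie_smul c u v
  have hsmull : ∀ (c : ℂ) (u v : ℂ ⊗[ℝ] 𝔤), ⁅c • u, v⁆ = c • ⁅u, v⁆ := fun c u v => smul_lie c u v
  have key : ∀ u v : ℂ ⊗[ℝ] 𝔤, complexify (realPart D) ⁅u, v⁆ =
      ⁅complexify (realPart D) u, v⁆ + ⁅u, complexify (realPart D) v⁆ := by
    intro u v
    have hu : u ∈ ⨆ a, (complexify D).maxGenEigenspace a := htop ▸ Submodule.mem_top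
    have hv : v ∈ ⨆ a, (complexify D).maxGenEigenspace a := htop ▸ Submodule.mem_top
    induction hu using Submodule.iSup_induction' with
    | zero => simp
    | add u u' _ _ h h' => simp only [add_lie, map_add, h, h']; abel
    | mem a u hu =>
      induction hv using Submodule.iSup_induction' with
      | zero => simp [hlzero]
      | add v v' _ _ h h' => simp only [hladd, map_add, h, h']; abel
      | mem b v hv =>
        have huv : ⁅u, v⁆ ∈ (complexify D).maxGenEigenspace (a + b) := by
          rw [hT] at hu hv ⊢
          exact LieModule.lie_mem_maxGenEigenspace_toEnd hu hv
        rw [complexify_realPart_apply huv, complexify_realPart_apply hu,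
          complexify_realPart_apply hv, hlsmul, hsmull, Complex.add_re, Complex.ofReal_add, add_smul]
  have := key (1 ⊗ₜ x) (1 ⊗ₜ y)
  simp only [LieAlgebra.ExtendScalars.bracket_tmul, mul_one, LinearMap.baseChange_tmul,
    ← TensorProduct.tmul_add] at this
  exact Module.FaithfullyFlat.tensorProduct_mk_injective (A := ℝ) (B := ℂ) _ this

end RealPartDerivation

end CartanGr

namespace CartanGr

attribute [local instance 100] LieRing.ofAssociativeRing

/-! ### Split elements and the Killing form -/

section SplitElements

variable {𝔤 : Type*} [LieRing 𝔤] [LieAlgebra ℝ 𝔤] [FiniteDimensional ℝ 𝔤]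

theorem realPart_ad_of_isSplitElement {y : 𝔤} (hy : IsSplitElement y) :
    realPart (LieAlgebra.ad ℝ 𝔤 y) = LieAlgebra.ad ℝ 𝔤 y := by
  have : ⊤ ≤ LinearMap.eqLocus (realPart (LieAlgebra.ad ℝ 𝔤 y)) (LieAlgebra.ad ℝ 𝔤 y) := by
    rw [← hy]
    refine iSup_le fun μ v hv => ?_
    rw [End.mem_eigenspace_iff] at hv
    rw [LinearMap.mem_eqLocus, hv, realPart_apply_of_apply_eq_smul hv]
  exact LinearMap.ext fun w => this Submodule.mem_top

theorem killingForm_self_nonneg {y : 𝔤} (hy : IsSplitElement y) :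
    0 ≤ killingForm ℝ 𝔤 y y := by
  have := trace_mul_realPart_nonneg (LieAlgebra.ad ℝ 𝔤 y)
  rwa [realPart_ad_of_isSplitElement hy] at this

variable [LieAlgebra.IsKilling ℝ 𝔤]

omit [FiniteDimensional ℝ 𝔤] in
theorem eq_zero_of_ad_eq_zero {y : 𝔤} (h : LieAlgebra.ad ℝ 𝔤 y = 0) : y = 0 := by
  have : y ∈ LinearMap.ker (LieAlgebra.ad ℝ 𝔤 : 𝔤 →ₗ[ℝ] End ℝ 𝔤) := h
  have h2 : LinearMap.ker (killingForm ℝ 𝔤) = ⊥ := LieAlgebra.IsKilling.ker_killingForm_eq_bot ℝ 𝔤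
  have h3 : y ∈ LinearMap.ker (killingForm ℝ 𝔤) := by
    rw [LinearMap.mem_ker]
    ext z
    rw [killingForm_apply_apply, h]
    simp
  rwa [h2, Submodule.mem_bot] at h3

theorem eq_zero_of_killingForm_self_eq_zero {y : 𝔤} (hy : IsSplitElement y)
    (h : killingForm ℝ 𝔤 y y = 0) : y = 0 := by
  apply eq_zero_of_ad_eq_zero
  rw [← realPart_ad_of_isSplitElement hy]
  apply realPart_eq_zero_of_trace
  rw [realPart_ad_of_isSplitElement hy]
  exact h

/-- Derivations are inner when the Killing form is nondegenerate. The element obtained is the split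
part of `x`. -/
theorem exists_ad_eq_realPart (x : 𝔤) :
    ∃ y : 𝔤, LieAlgebra.ad ℝ 𝔤 y = realPart (LieAlgebra.ad ℝ 𝔤 x) := by
  let D : LieDerivation ℝ 𝔤 𝔤 :=
    { toLinearMap := realPart (LieAlgebra.ad ℝ 𝔤 x)
      leibniz' := fun a b => by
        change realPart (LieAlgebra.ad ℝ 𝔤 x) ⁅a, b⁆ = _
        rw [realPart_ad_lie, ← lie_skew b, sub_neg_eq_add, add_comm] }
  obtain ⟨y, hy⟩ := LieDerivation.IsKilling.exists_eq_ad D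
  refine ⟨y, LinearMap.ext fun z => ?_⟩
  exact (LinearMap.congr_fun (LieDerivation.coe_ad_apply_eq_ad_apply (R := ℝ) y) z).symm.trans
    (LieDerivation.congr_fun hy z)

omit [LieAlgebra.IsKilling ℝ 𝔤] in
theorem isSplitElement_of_ad_eq_realPart {x y : 𝔤}
    (h : LieAlgebra.ad ℝ 𝔤 y = realPart (LieAlgebra.ad ℝ 𝔤 x)) : IsSplitElement y := by
  rw [IsSplitElement, h]
  exact iSup_eigenspace_realPart _

/-- Otherwise every `ad x` has zero real part, so all its eigenvalues are imaginary and the Killing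
form is negative semidefinite. Being nondegenerate it is negative definite, and `𝔤` itself is a
compact factor. -/
theorem exists_isSplitElement_ne_zero [Nontrivial 𝔤] (hnc : NoCompactFactor 𝔤) :
    ∃ y : 𝔤, IsSplitElement y ∧ y ≠ 0 := by
  by_contra! hcon
  have hre : ∀ x : 𝔤, realPart (LieAlgebra.ad ℝ 𝔤 x) = 0 := fun x => by
    obtain ⟨y, hy⟩ := exists_ad_eq_realPart x
    rw [← hy, hcon y (isSplitElement_of_ad_eq_realPart hy), map_zero]
  have hneg : ∀ x : 𝔤, 0 ≤ (-killingForm ℝ 𝔤) x x := fun x => by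
    have : killingForm ℝ 𝔤 x x ≤ 0 := trace_mul_self_nonpos (hre x)
    simpa using this
  have hsymm : LinearMap.IsSymm (-killingForm ℝ 𝔤) :=
    ⟨fun x y => by simp [LieModule.traceForm_comm ℝ 𝔤 𝔤 x y]⟩
  have htop : (⊤ : LieIdeal ℝ 𝔤) = ⊥ := by
    refine hnc ⊤ fun x hx => ?_
    have h1 : killingForm ℝ (⊤ : LieIdeal ℝ 𝔤) x x = killingForm ℝ 𝔤 x x := by
      rw [LieIdeal.killingForm_eq]; rfl
    rw [h1]
    refine lt_of_le_of_ne (by simpa using hneg x) fun h0 => hx (Subtype.ext ?_)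
    have h2 : LinearMap.ker (killingForm ℝ 𝔤) = ⊥ := LieAlgebra.IsKilling.ker_killingForm_eq_bot ℝ 𝔤
    have h3 : (x : 𝔤) ∈ LinearMap.ker (killingForm ℝ 𝔤) := by
      rw [LinearMap.mem_ker]
      ext z
      -- Cauchy-Schwarz for the semidefinite form: an isotropic vector lies in the radical.
      have := LinearMap.BilinForm.apply_sq_le_of_symm _ hneg hsymm (x : 𝔤) z
      simp only [LinearMap.neg_apply, h0, neg_zero, zero_mul, neg_sq] at this
      simpa using this.antisymm (sq_nonneg _)
    rwa [h2, Submodule.mem_bot] at h3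
  exact (bot_ne_top (α := LieIdeal ℝ 𝔤)) htop.symm

end SplitElements

/-! ### First properties of Cartan subspaces -/

section CartanSubspace

variable {𝔤 : Type*} [LieRing 𝔤] [LieAlgebra ℝ 𝔤] [FiniteDimensional ℝ 𝔤]
  {𝔞 : LieSubalgebra ℝ 𝔤}

omit [FiniteDimensional ℝ 𝔤] in
theorem commute_ad_of_lie_eq_zero {x y : 𝔤} (h : ⁅x, y⁆ = 0) :
    Commute (LieAlgebra.ad ℝ 𝔤 x) (LieAlgebra.ad ℝ 𝔤 y) := by
  rw [commute_iff_lie_eq, ← LieHom.map_lie, h, map_zero]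

omit [FiniteDimensional ℝ 𝔤] in
theorem IsCartanSubspace.lie_eq_zero (h : IsCartanSubspace 𝔞) {x y : 𝔤} (hx : x ∈ 𝔞)
    (hy : y ∈ 𝔞) : ⁅x, y⁆ = 0 :=
  ((isCartanSubspace_iff 𝔞).1 h).1 x hx y hy

omit [FiniteDimensional ℝ 𝔤] in
theorem IsCartanSubspace.isSplitElement (h : IsCartanSubspace 𝔞) {x : 𝔤} (hx : x ∈ 𝔞) :
    IsSplitElement x :=
  ((isCartanSubspace_iff 𝔞).1 h).2.1 x hx

/-- Sums of commuting split elements are split, so the second condition in the one-element test of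
maximality is automatic. -/
theorem IsCartanSubspace.mem_of_isSplitElement (h : IsCartanSubspace 𝔞) {y : 𝔤}
    (hy : IsSplitElement y) (hc : ∀ x ∈ 𝔞, ⁅y, x⁆ = 0) : y ∈ 𝔞 := by
  refine ((isCartanSubspace_iff 𝔞).1 h).2.2 y hc fun s x hx => ?_
  rw [IsSplitElement, map_add, map_smul]
  exact iSup_eigenspace_smul_add_eq_top (commute_ad_of_lie_eq_zero (hc x hx)) hy
    (h.isSplitElement hx) s

theorem IsCartanSubspace.exists_ne_zero [LieAlgebra.IsKilling ℝ 𝔤] [Nontrivial 𝔤]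
    (hnc : NoCompactFactor 𝔤) (h : IsCartanSubspace 𝔞) : ∃ x ∈ 𝔞, x ≠ 0 := by
  by_contra! hcon
  obtain ⟨y, hy, hy0⟩ := exists_isSplitElement_ne_zero hnc
  exact hy0 (hcon y (h.mem_of_isSplitElement hy fun x hx => by simp [hcon x hx]))

end CartanSubspace

end CartanGr

namespace CartanGr

attribute [local instance 100] LieRing.ofAssociativeRing

/-! ### Restricted roots and the triple attached to one of them -/

section RestrictedRoots

variable {𝔤 : Type*} [LieRing 𝔤] [LieAlgebra ℝ 𝔤] {𝔞 : LieSubalgebra ℝ 𝔤}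

/-- The simultaneous eigenspace of the elements of `𝔞` for the eigenvalues `χ`. -/
def restrictedRootSpace (𝔞 : LieSubalgebra ℝ 𝔤) (χ : 𝔞 → ℝ) : Submodule ℝ 𝔤 :=
  ⨅ x : 𝔞, (LieAlgebra.ad ℝ 𝔤 x).eigenspace (χ x)

theorem mem_restrictedRootSpace {χ : 𝔞 → ℝ} {v : 𝔤} :
    v ∈ restrictedRootSpace 𝔞 χ ↔ ∀ x : 𝔞, ⁅(x : 𝔤), v⁆ = χ x • v := by
  simp [restrictedRootSpace, Submodule.mem_iInf]

theorem mem_restrictedRootSpace_zero {v : 𝔤} :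
    v ∈ restrictedRootSpace 𝔞 0 ↔ ∀ x ∈ 𝔞, ⁅x, v⁆ = 0 := by
  simp [mem_restrictedRootSpace]

theorem lie_mem_restrictedRootSpace {χ ψ : 𝔞 → ℝ} {v w : 𝔤} (hv : v ∈ restrictedRootSpace 𝔞 χ)
    (hw : w ∈ restrictedRootSpace 𝔞 ψ) : ⁅v, w⁆ ∈ restrictedRootSpace 𝔞 (χ + ψ) := by
  rw [mem_restrictedRootSpace] at *
  intro x
  rw [leibniz_lie, hv, hw, smul_lie, lie_smul, Pi.add_apply, add_smul]

theorem killingForm_lie_left (x v w : 𝔤) :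
    killingForm ℝ 𝔤 ⁅x, v⁆ w = -killingForm ℝ 𝔤 v ⁅x, w⁆ := by
  rw [← lie_skew, map_neg, LinearMap.neg_apply, LieModule.traceForm_apply_lie_apply]

/-- Invariance of the form under `x ∈ 𝔞` gives `(χ x + ψ x) K(v, w) = 0`. -/
theorem killingForm_eq_zero_of_ne {χ ψ : 𝔞 → ℝ} {v w : 𝔤} (hv : v ∈ restrictedRootSpace 𝔞 χ)
    (hw : w ∈ restrictedRootSpace 𝔞 ψ) (h : χ + ψ ≠ 0) : killingForm ℝ 𝔤 v w = 0 := by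
  obtain ⟨x, hx⟩ := Function.ne_iff.1 h
  have := killingForm_lie_left (x : 𝔤) v w
  rw [mem_restrictedRootSpace.1 hv, mem_restrictedRootSpace.1 hw, map_smul, map_smul,
    LinearMap.smul_apply, smul_eq_mul, smul_eq_mul, ← sub_eq_zero, sub_neg_eq_add, ← add_mul] at this
  exact (mul_eq_zero.1 this).resolve_left hx

variable [FiniteDimensional ℝ 𝔤]

theorem IsCartanSubspace.iSup_restrictedRootSpace (h : IsCartanSubspace 𝔞) :
    ⨆ χ, restrictedRootSpace 𝔞 χ = ⊤ :=
  iSup_iInf_eigenspace_eq_top (fun x : 𝔞 => LieAlgebra.ad ℝ 𝔤 x)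
    (fun x y => commute_ad_of_lie_eq_zero (h.lie_eq_zero x.2 y.2))
    fun x => h.isSplitElement x.2

/-- The component of `u` in the weight space dual to that of `χ`. -/
theorem IsCartanSubspace.exists_killingForm_eq (h : IsCartanSubspace 𝔞) (u : 𝔤) (χ : 𝔞 → ℝ) :
    ∃ f ∈ restrictedRootSpace 𝔞 (-χ), ∀ v ∈ restrictedRootSpace 𝔞 χ,
      killingForm ℝ 𝔤 f v = killingForm ℝ 𝔤 u v := by
  have hu : u ∈ ⨆ χ, restrictedRootSpace 𝔞 χ := h.iSup_restrictedRootSpace ▸ Submodule.mem_top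
  induction hu using Submodule.iSup_induction' with
  | zero => exact ⟨0, Submodule.zero_mem _, fun _ _ => rfl⟩
  | add u w _ _ hu hw =>
    obtain ⟨f, hf, hf'⟩ := hu
    obtain ⟨g, hg, hg'⟩ := hw
    exact ⟨f + g, Submodule.add_mem _ hf hg, fun v hv => by simp [hf' v hv, hg' v hv]⟩
  | mem ψ u hu =>
    by_cases hψ : ψ = -χ
    · exact ⟨u, hψ ▸ hu, fun _ _ => rfl⟩
    · refine ⟨0, Submodule.zero_mem _, fun v hv => ?_⟩
      rw [killingForm_eq_zero_of_ne hu hv fun h0 => hψ (eq_neg_of_add_eq_zero_left h0)]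
      simp

variable [LieAlgebra.IsKilling ℝ 𝔤]

omit [FiniteDimensional ℝ 𝔤] in
theorem eq_zero_of_forall_killingForm_eq_zero {x : 𝔤} (hx : ∀ y, killingForm ℝ 𝔤 x y = 0) :
    x = 0 := by
  have h2 : LinearMap.ker (killingForm ℝ 𝔤) = ⊥ := LieAlgebra.IsKilling.ker_killingForm_eq_bot ℝ 𝔤
  have h3 : x ∈ LinearMap.ker (killingForm ℝ 𝔤) := LinearMap.mem_ker.2 (LinearMap.ext hx)
  rwa [h2, Submodule.mem_bot] at h3

theorem IsCartanSubspace.exists_restrictedRoot [Nontrivial 𝔤] (hnc : NoCompactFactor 𝔤)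
    (h : IsCartanSubspace 𝔞) :
    ∃ χ : 𝔞 → ℝ, χ ≠ 0 ∧ ∃ e ∈ restrictedRootSpace 𝔞 χ, e ≠ 0 := by
  by_contra! hcon
  obtain ⟨x, hx, hx0⟩ := h.exists_ne_zero hnc
  have htop : restrictedRootSpace 𝔞 0 = ⊤ := by
    rw [eq_top_iff, ← h.iSup_restrictedRootSpace]
    refine iSup_le fun χ v hv => ?_
    by_cases hχ : χ = 0
    · exact hχ ▸ hv
    · rw [hcon χ hχ v hv]
      exact Submodule.zero_mem _
  refine hx0 (eq_zero_of_ad_eq_zero (LinearMap.ext fun v => ?_))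
  exact mem_restrictedRootSpace_zero.1 (htop ▸ Submodule.mem_top : v ∈ _) x hx

/-- This is orthogonal projection to `𝔞`; it exists because nonzero split elements are not
isotropic, so the restricted Killing form is nondegenerate. -/
theorem IsCartanSubspace.exists_mem_forall_killingForm_eq (h : IsCartanSubspace 𝔞) (z : 𝔤) :
    ∃ a ∈ 𝔞, ∀ x ∈ 𝔞, killingForm ℝ 𝔤 a x = killingForm ℝ 𝔤 z x := by
  let B : 𝔞 →ₗ[ℝ] Dual ℝ 𝔞 :=
    (killingForm ℝ 𝔤).domRestrict₁₂ 𝔞.toSubmodule 𝔞.toSubmodule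
  have hB : Function.Injective B := by
    rw [← LinearMap.ker_eq_bot, Submodule.eq_bot_iff]
    intro x hx
    exact Subtype.ext (eq_zero_of_killingForm_self_eq_zero (h.isSplitElement x.2)
      (LinearMap.congr_fun hx x))
  have hB' : Function.Surjective B :=
    (LinearMap.injective_iff_surjective_of_finrank_eq_finrank (Subspace.dual_finrank_eq).symm).1 hB
  obtain ⟨a, ha⟩ := hB' ((killingForm ℝ 𝔤 z).domRestrict 𝔞.toSubmodule)
  exact ⟨a, a.2, fun x hx => LinearMap.congr_fun ha ⟨x, hx⟩⟩

/-- The orthogonal of `𝔞` in its centralizer. -/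
def centralizerOrthogonal (𝔞 : LieSubalgebra ℝ 𝔤) : Submodule ℝ 𝔤 where
  carrier := {m | ∀ x ∈ 𝔞, ⁅x, m⁆ = 0 ∧ killingForm ℝ 𝔤 m x = 0}
  zero_mem' := by simp
  add_mem' hm hn x hx := by simp [hm x hx, hn x hx]
  smul_mem' c m hm x hx := by simp [hm x hx]

theorem IsCartanSubspace.exists_eq_add (h : IsCartanSubspace 𝔞) {z : 𝔤}
    (hz : ∀ x ∈ 𝔞, ⁅x, z⁆ = 0) : ∃ a ∈ 𝔞, ∃ m ∈ centralizerOrthogonal 𝔞, z = a + m := by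
  obtain ⟨a, ha, haz⟩ := h.exists_mem_forall_killingForm_eq z
  refine ⟨a, ha, z - a, fun x hx => ⟨?_, ?_⟩, by abel⟩
  · rw [lie_sub, hz x hx, h.lie_eq_zero hx ha, sub_zero]
  · rw [map_sub, LinearMap.sub_apply, haz x hx, sub_self]

/-- An element of the centralizer of `𝔞` that is orthogonal to `𝔪` lies in `𝔞`. -/
theorem IsCartanSubspace.mem_of_orthogonal (h : IsCartanSubspace 𝔞) {z : 𝔤}
    (hz : ∀ x ∈ 𝔞, ⁅x, z⁆ = 0)
    (hm : ∀ m ∈ centralizerOrthogonal 𝔞, killingForm ℝ 𝔤 z m = 0) : z ∈ 𝔞 := by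
  obtain ⟨a, ha, n, hn, rfl⟩ := h.exists_eq_add hz
  suffices n = 0 by simpa [this]
  have hn' : ∀ m ∈ centralizerOrthogonal 𝔞, killingForm ℝ 𝔤 n m = 0 := by
    intro m hm'
    have h1 := hm m hm'
    rw [map_add, LinearMap.add_apply, LieModule.traceForm_comm, (hm' a ha).2, zero_add] at h1
    exact h1
  refine eq_zero_of_forall_killingForm_eq_zero fun w => ?_
  -- The part `n` of `z` orthogonal to `𝔞` is tested on each weight space: weights other than zero
  -- are orthogonal to the centralizer, and the zero weight space is `𝔞` plus its orthogonal there.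
  have hw : w ∈ ⨆ χ, restrictedRootSpace 𝔞 χ := h.iSup_restrictedRootSpace ▸ Submodule.mem_top
  induction hw using Submodule.iSup_induction' with
  | zero => simp
  | add u w _ _ hu hw => simp [hu, hw]
  | mem ψ w hw =>
    by_cases hψ : ψ = 0
    · subst hψ
      obtain ⟨b, hb, m, hm', rfl⟩ := h.exists_eq_add (mem_restrictedRootSpace_zero.1 hw)
      rw [map_add, (hn b hb).2, hn' m hm', add_zero]
    · exact killingForm_eq_zero_of_ne
        (mem_restrictedRootSpace_zero.2 fun x hx => (hn x hx).1) hw (by simpa using hψ)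

/-- The split part `y` of `m` commutes with `𝔞`, so it lies in `𝔞` by maximality and is orthogonal
to `m`. Thus the trace of `ad m` times its real part is zero, the real part vanishes, and `1` cannot
be an eigenvalue of `ad m`. -/
theorem IsCartanSubspace.lie_ne_self (h : IsCartanSubspace 𝔞) {m e : 𝔤}
    (hm : m ∈ centralizerOrthogonal 𝔞) (he : e ≠ 0) : ⁅m, e⁆ ≠ e := by
  intro hme
  obtain ⟨y, hy⟩ := exists_ad_eq_realPart m
  have hya : y ∈ 𝔞 := by
    refine h.mem_of_isSplitElement (isSplitElement_of_ad_eq_realPart hy) fun x hx => ?_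
    rw [← LieAlgebra.ad_apply (R := ℝ), hy, realPart_apply_of_apply_eq_smul (c := 0), zero_smul]
    rw [LieAlgebra.ad_apply, ← lie_skew, (hm x hx).1, neg_zero, zero_smul]
  have h0 : realPart (LieAlgebra.ad ℝ 𝔤 m) = 0 := by
    apply realPart_eq_zero_of_trace
    rw [← hy]
    exact (hm y hya).2
  have := realPart_apply_of_apply_eq_smul (D := LieAlgebra.ad ℝ 𝔤 m) (v := e) (c := 1)
    (by simpa using hme)
  rw [h0] at this
  exact he (by simpa using this.symm)

theorem exists_killingForm_eq_dual (φ : Dual ℝ 𝔤) : ∃ u : 𝔤, ∀ v, killingForm ℝ 𝔤 u v = φ v := by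
  have hB : Function.Injective (killingForm ℝ 𝔤) :=
    LinearMap.ker_eq_bot.1 (LieAlgebra.IsKilling.ker_killingForm_eq_bot ℝ 𝔤)
  obtain ⟨u, hu⟩ := (LinearMap.injective_iff_surjective_of_finrank_eq_finrank
    (Subspace.dual_finrank_eq (K := ℝ) (V := 𝔤)).symm).1 hB φ
  exact ⟨u, fun v => LinearMap.congr_fun hu v⟩

/-- A restricted root gives a copy of `𝔰𝔩₂(ℝ)` whose diagonal part lies in `𝔞`. -/
theorem IsCartanSubspace.exists_triple [Nontrivial 𝔤] (hnc : NoCompactFactor 𝔤)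
    (h : IsCartanSubspace 𝔞) : ∃ (χ : 𝔞 →ₗ[ℝ] ℝ) (e f : 𝔤) (a : 𝔞),
      (∀ x : 𝔞, ⁅(x : 𝔤), e⁆ = χ x • e) ∧ (∀ x : 𝔞, ⁅(x : 𝔤), f⁆ = -χ x • f) ∧
      ⁅e, f⁆ = a ∧ χ a = 2 ∧ killingForm ℝ 𝔤 (e - f) (e - f) < 0 := by
  obtain ⟨χ, hχ, e, he, he0⟩ := h.exists_restrictedRoot hnc
  have he' := mem_restrictedRootSpace.1 he
  let ρ : 𝔞 →ₗ[ℝ] ℝ :=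
    { toFun := χ
      map_add' := fun x y => by
        have := he' (x + y)
        rw [show ((x + y : 𝔞) : 𝔤) = x + y from rfl, add_lie, he', he', ← add_smul] at this
        exact (smul_left_injective ℝ he0 this).symm
      map_smul' := fun c x => by
        have := he' (c • x)
        rw [show ((c • x : 𝔞) : 𝔤) = c • x from rfl, smul_lie, he', smul_smul] at this
        exact (smul_left_injective ℝ he0 this).symm }
  have hmem : ∀ m ∈ centralizerOrthogonal 𝔞, ⁅m, e⁆ ∈ restrictedRootSpace 𝔞 χ := by
    intro m hm
    simpa using lie_mem_restrictedRootSpace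
      (mem_restrictedRootSpace_zero.2 fun x hx => (hm x hx).1) he
  let M : Submodule ℝ 𝔤 := (centralizerOrthogonal 𝔞).map (LieAlgebra.ad ℝ 𝔤 e)
  have heM : e ∉ M := by
    rintro ⟨m, hm, hme⟩
    refine h.lie_ne_self (neg_mem hm) he0 ?_
    rw [neg_lie, lie_skew]
    exact hme
  -- `f` is to pair nontrivially with `e` and to be orthogonal to `[e, 𝔪]`, where `𝔪` is the
  -- orthogonal of `𝔞` in its centralizer. The second condition forces `[e, f]` into `𝔞`, also when
  -- the root space has dimension greater than one.
  obtain ⟨φ, hφe, hφM⟩ := Submodule.exists_le_ker_of_notMem heM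
  obtain ⟨u, hu⟩ := exists_killingForm_eq_dual φ
  obtain ⟨f, hf, hfu⟩ := h.exists_killingForm_eq u χ
  have hf' := mem_restrictedRootSpace.1 hf
  have hfe : killingForm ℝ 𝔤 e f ≠ 0 := by
    rwa [LieModule.traceForm_comm, hfu e he, hu]
  have hz0 : ∀ x ∈ 𝔞, ⁅x, ⁅e, f⁆⁆ = 0 := by
    apply mem_restrictedRootSpace_zero.1
    simpa using lie_mem_restrictedRootSpace he hf
  have hza : ⁅e, f⁆ ∈ 𝔞 := by
    refine h.mem_of_orthogonal hz0 fun m hm => ?_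
    rw [← lie_skew, map_neg, LinearMap.neg_apply, LieModule.traceForm_apply_lie_apply,
      ← lie_skew, map_neg, neg_neg, hfu _ (hmem m hm), hu, ← lie_skew, map_neg, neg_eq_zero]
    exact hφM (Submodule.mem_map_of_mem hm)
  have hKz : ∀ x : 𝔞, killingForm ℝ 𝔤 ⁅e, f⁆ x = χ x * killingForm ℝ 𝔤 e f := by
    intro x
    rw [LieModule.traceForm_apply_lie_apply, ← lie_skew, hf', map_neg, map_smul]
    simp
  have hz : ⁅e, f⁆ ≠ 0 := by
    intro h0
    obtain ⟨x, hx⟩ := Function.ne_iff.1 hχ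
    have := hKz x
    rw [h0, map_zero, LinearMap.zero_apply] at this
    exact mul_ne_zero hx hfe this.symm
  have hpos : 0 < killingForm ℝ 𝔤 ⁅e, f⁆ ⁅e, f⁆ :=
    (killingForm_self_nonneg (h.isSplitElement hza)).lt_of_ne' fun h0 =>
      hz (eq_zero_of_killingForm_self_eq_zero (h.isSplitElement hza) h0)
  -- Positivity of `K([e, f], [e, f]) = c K(e, f)` gives `c ≠ 0`. Rescaling `f` by `2 / c`
  -- normalizes the root value to `2` and makes the norm of `e - f` negative, whatever the sign of
  -- `c`.
  set c := ρ ⟨_, hza⟩ with hc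
  have hKc : killingForm ℝ 𝔤 ⁅e, f⁆ ⁅e, f⁆ = c * killingForm ℝ 𝔤 e f := hKz ⟨_, hza⟩
  have hc0 : c ≠ 0 := by
    rintro h0
    rw [hKc, h0, zero_mul] at hpos
    exact hpos.false
  have hχ2 : χ + χ ≠ 0 := by
    intro h0
    apply hχ
    funext x
    have := congrFun h0 x
    simp only [Pi.add_apply, Pi.zero_apply] at this ⊢
    linarith
  have hχ2' : -χ + -χ ≠ 0 := by
    rwa [← neg_add, neg_ne_zero]
  refine ⟨ρ, e, (2 / c) • f, (2 / c) • ⟨_, hza⟩, he', fun x => ?_, ?_, ?_, ?_⟩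
  · rw [lie_smul, hf', smul_comm]; rfl
  · rw [lie_smul]; rfl
  · rw [map_smul, ← hc, smul_eq_mul, div_mul_cancel₀ _ hc0]
  · have h1 := killingForm_eq_zero_of_ne he he hχ2
    have h2 := killingForm_eq_zero_of_ne hf hf hχ2'
    have h3 := LieModule.traceForm_comm ℝ 𝔤 𝔤 f e
    have h4 : killingForm ℝ 𝔤 (e - (2 / c) • f) (e - (2 / c) • f) =
        -(4 / c ^ 2) * (c * killingForm ℝ 𝔤 e f) := by
      simp only [map_sub, map_smul, LinearMap.sub_apply, LinearMap.smul_apply, h1, h2, h3,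
        smul_eq_mul]
      field_simp
      ring
    rw [h4, ← hKc]
    exact mul_neg_of_neg_of_pos (by simpa using by positivity) hpos

end RestrictedRoots

end CartanGr

namespace CartanGr

attribute [local instance 100] LieRing.ofAssociativeRing

/-! ### Pencils in the Grassmannian and Zariski-closed sets -/

section ZariskiLines

variable {W : Type*} [AddCommGroup W] [Module ℝ W] {r : ℕ}

theorem exists_polynomial_eval_eq_polyEval (F : MvPolynomial (Dual ℝ W) ℝ) (p q : W) :
    ∃ g : Polynomial ℝ, ∀ t : ℝ, g.eval t = polyEval F (p + t • q) := by
  refine ⟨MvPolynomial.aeval (fun φ : Dual ℝ W =>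
    Polynomial.C (φ p) + Polynomial.X * Polynomial.C (φ q)) F, fun t => ?_⟩
  rw [polyEval, ← Polynomial.coe_evalRingHom, MvPolynomial.aeval_def, MvPolynomial.eval,
    MvPolynomial.hom_eval₂, MvPolynomial.coe_eval₂Hom]
  congr 1
  · ext c; simp
  · funext φ
    simp only [Polynomial.coe_evalRingHom, Polynomial.eval_mul,
      Polynomial.eval_C, Polynomial.eval_X, map_add, map_smul, smul_eq_mul]

/-- A Zariski-closed set that contains infinitely many members of a pencil contains all of them. -/
theorem IsZariskiClosed.span_update_mem {T : Set (Gr W r)} (hT : IsZariskiClosed T)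
    {v : Fin r → W} {i : Fin r} {p q : W} {s : ℝ}
    (hinf : {t : ℝ | ∃ h : LinearIndependent ℝ (Function.update v i (p + t • q)),
      Frame.span ⟨_, h⟩ ∈ T}.Infinite)
    (h : LinearIndependent ℝ (Function.update v i (p + s • q))) : Frame.span ⟨_, h⟩ ∈ T := by
  obtain ⟨P, -, hP⟩ := hT
  refine (hP ⟨_, h⟩).2 fun F hF => ?_
  -- When a single vector of the frame moves affinely in `t`, so does the Plücker vector, by
  -- multilinearity. Each equation becomes a polynomial in `t` with infinitely many roots.
  obtain ⟨g, hg⟩ := exists_polynomial_eval_eq_polyEval F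
    (exteriorPower.ιMulti ℝ r (Function.update v i p))
    (exteriorPower.ιMulti ℝ r (Function.update v i q))
  have hg' : ∀ (t : ℝ) (h : LinearIndependent ℝ (Function.update v i (p + t • q))),
      polyEval F (Frame.plucker ⟨_, h⟩) = g.eval t := by
    intro t h
    change polyEval F (exteriorPower.ιMulti ℝ r (Function.update v i (p + t • q))) = _
    rw [hg, AlternatingMap.map_update_add, AlternatingMap.map_update_smul]
  have h0 : g = 0 := by
    refine Polynomial.eq_zero_of_infinite_isRoot g (hinf.mono ?_)
    rintro t ⟨ht, htT⟩
    rw [Set.mem_ofPred_eq, Polynomial.IsRoot, ← hg' t ht]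
    exact (hP _).1 htT F hF
  rw [hg', h0, Polynomial.eval_zero]

end ZariskiLines

/-! ### Exponentials of nilpotent inner derivations -/

section Exponential

/-- The powers `E ^ k` satisfy `[D, E ^ k] = k c E ^ k`. If none vanished, bracketing with `D` would
have infinitely many eigenvalues on the endomorphisms of `V`. -/
theorem isNilpotent_of_commutator_eq_smul {V : Type*} [AddCommGroup V] [Module ℝ V]
    [FiniteDimensional ℝ V] {D E : End ℝ V} {c : ℝ} (hc : c ≠ 0) (h : D * E - E * D = c • E) :
    IsNilpotent E := by
  by_contra hE
  have hE : ∀ k : ℕ, E ^ k ≠ 0 := fun k hk => hE ⟨k, hk⟩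
  let T : End ℝ (End ℝ V) := LinearMap.mulLeft ℝ D - LinearMap.mulRight ℝ D
  have hT : ∀ k : ℕ, D * E ^ k - E ^ k * D = (k * c) • E ^ k := by
    intro k
    induction k with
    | zero => simp
    | succ k ih =>
      have : D * E ^ (k + 1) - E ^ (k + 1) * D =
          (D * E ^ k - E ^ k * D) * E + E ^ k * (D * E - E * D) := by
        rw [pow_succ]; noncomm_ring
      rw [this, ih, h, smul_mul_assoc, mul_smul_comm, ← pow_succ, ← add_smul]
      push_cast
      ring_nf
  refine Set.infinite_of_injective_forall_mem (f := fun k : ℕ => (k * c : ℝ))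
    (fun k l hkl => by simpa [hc] using hkl) (fun k => ?_) (End.finite_hasEigenvalue T)
  exact End.hasEigenvalue_of_hasEigenvector (x := E ^ k) ⟨End.mem_eigenspace_iff.2 (hT k), hE k⟩

variable {𝔤 : Type*} [LieRing 𝔤] [LieAlgebra ℝ 𝔤]

theorem isNilpotent_ad_of_lie_eq_smul [FiniteDimensional ℝ 𝔤] {h e : 𝔤} {c : ℝ} (hc : c ≠ 0)
    (he : ⁅h, e⁆ = c • e) : IsNilpotent (LieAlgebra.ad ℝ 𝔤 e) := by
  refine isNilpotent_of_commutator_eq_smul (D := LieAlgebra.ad ℝ 𝔤 h) hc ?_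
  rw [← map_smul, ← he, LieHom.map_lie]
  rfl

/-- The exponential of a nilpotent inner derivation. -/
theorem exists_lieEquiv_exp {x : 𝔤} (hx : IsNilpotent (LieAlgebra.ad ℝ 𝔤 x)) :
    ∃ φ : 𝔤 ≃ₗ⁅ℝ⁆ 𝔤, ∀ v, ⁅x, ⁅x, ⁅x, v⁆⁆⁆ = 0 →
      φ v = v + ⁅x, v⁆ + (1 / 2 : ℝ) • ⁅x, ⁅x, v⁆⁆ := by
  let _ : Module ℚ 𝔤 := Module.compHom 𝔤 (algebraMap ℚ ℝ)
  let _ : LieAlgebra ℚ 𝔤 := { lie_smul := fun t x y => lie_smul (t : ℝ) x y }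
  have hD : (LieDerivation.ad ℝ 𝔤 x).toLinearMap = LieAlgebra.ad ℝ 𝔤 x :=
    LieDerivation.coe_ad_apply_eq_ad_apply x
  have hx' : IsNilpotent (LieDerivation.ad ℝ 𝔤 x).toLinearMap := hD ▸ hx
  refine ⟨LieDerivation.exp _ hx', fun v hv => ?_⟩
  have h3 : (LieAlgebra.ad ℝ 𝔤 x ^ 3) • v = 0 := by
    simpa [pow_succ] using hv
  rw [LieDerivation.exp_map_apply, hD]
  have := IsNilpotent.exp_smul_eq_sum h3 hx
  rw [End.smul_def] at this
  rw [this]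
  have h2 : ∀ (c : ℚ) (w : 𝔤), c • w = (c : ℝ) • w := fun _ _ => rfl
  simp [Finset.sum_range_succ, pow_succ, h2]

end Exponential

/-! ### Automorphisms preserve Cartan subspaces -/

section Automorphisms

variable {𝔤 : Type*} [LieRing 𝔤] [LieAlgebra ℝ 𝔤] {𝔞 : LieSubalgebra ℝ 𝔤}

theorem IsSplitElement.map (φ : 𝔤 ≃ₗ⁅ℝ⁆ 𝔤) {x : 𝔤} (hx : IsSplitElement x) :
    IsSplitElement (φ x) := by
  have h : ⊤ ≤ (⨆ μ : ℝ, (LieAlgebra.ad ℝ 𝔤 x).eigenspace μ).map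
      (φ.toLinearEquiv : 𝔤 →ₗ[ℝ] 𝔤) := by
    rw [hx, Submodule.map_top, LinearEquiv.range]
  rw [IsSplitElement, eq_top_iff]
  refine h.trans ?_
  rw [Submodule.map_iSup]
  refine iSup_mono fun μ => Submodule.map_le_iff_le_comap.2 fun v hv => ?_
  rw [End.mem_eigenspace_iff, LieAlgebra.ad_apply] at hv
  change φ v ∈ (LieAlgebra.ad ℝ 𝔤 (φ x)).eigenspace μ
  rw [End.mem_eigenspace_iff, LieAlgebra.ad_apply, ← LieEquiv.map_lie, hv, map_smul]

theorem isSplitElement_map_iff (φ : 𝔤 ≃ₗ⁅ℝ⁆ 𝔤) {x : 𝔤} :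
    IsSplitElement (φ x) ↔ IsSplitElement x :=
  ⟨fun h => by simpa using h.map φ.symm, fun h => h.map φ⟩

theorem IsCartanSubspace.map (h : IsCartanSubspace 𝔞) (φ : 𝔤 ≃ₗ⁅ℝ⁆ 𝔤) :
    IsCartanSubspace (𝔞.map φ.toLieHom) := by
  obtain ⟨h1, h2, h3⟩ := (isCartanSubspace_iff 𝔞).1 h
  rw [isCartanSubspace_iff]
  refine ⟨?_, ?_, fun x hx hs => ?_⟩
  · rintro _ ⟨x, hx, rfl⟩ _ ⟨y, hy, rfl⟩
    change ⁅φ x, φ y⁆ = 0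
    rw [← LieEquiv.map_lie, h1 x hx y hy, map_zero]
  · rintro _ ⟨x, hx, rfl⟩
    exact (h2 x hx).map φ
  · obtain ⟨y, rfl⟩ := φ.surjective x
    refine ⟨y, h3 y (fun z hz => ?_) (fun s z hz => ?_), rfl⟩
    · have : ⁅φ y, φ z⁆ = 0 := hx (φ z) ⟨z, hz, rfl⟩
      rwa [← LieEquiv.map_lie, map_eq_zero_iff φ φ.injective] at this
    · rw [← isSplitElement_map_iff φ, map_add, map_smul]
      exact hs s (φ z) ⟨z, hz, rfl⟩

end Automorphisms

/-! ### The pencil of planes through the kernel of a restricted root -/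

section NotZariskiClosed

variable {𝔤 : Type*} [LieRing 𝔤] [LieAlgebra ℝ 𝔤] [FiniteDimensional ℝ 𝔤]
  {𝔞 : LieSubalgebra ℝ 𝔤}

/-- The rotations of a copy of `𝔰𝔩₂(ℝ)` carry `𝔞` to a Cartan subspace containing `e + t f`. -/
theorem IsCartanSubspace.exists_rotate (h : IsCartanSubspace 𝔞) {χ : 𝔞 →ₗ[ℝ] ℝ} {e f : 𝔤} {a : 𝔞}
    (he : ∀ x : 𝔞, ⁅(x : 𝔤), e⁆ = χ x • e) (hf : ∀ x : 𝔞, ⁅(x : 𝔤), f⁆ = -χ x • f)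
    (ha : ⁅e, f⁆ = a) (hχ : χ a = 2) {t : ℝ} (ht : 0 < t) :
    ∃ 𝔟 : LieSubalgebra ℝ 𝔤, IsCartanSubspace 𝔟 ∧ finrank ℝ 𝔟 = finrank ℝ 𝔞 ∧
      e + t • f ∈ 𝔟 ∧ ∀ x : 𝔞, χ x = 0 → (x : 𝔤) ∈ 𝔟 := by
  have hne : IsNilpotent (LieAlgebra.ad ℝ 𝔤 e) :=
    isNilpotent_ad_of_lie_eq_smul (two_ne_zero (α := ℝ)) (by rw [he a, hχ])
  have hnf : IsNilpotent (LieAlgebra.ad ℝ 𝔤 f) :=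
    isNilpotent_ad_of_lie_eq_smul (neg_ne_zero.2 (two_ne_zero (α := ℝ))) (by rw [hf a, hχ])
  have hs : ∀ s : ℝ, IsNilpotent (LieAlgebra.ad ℝ 𝔤 (s • e)) := fun s => by
    rw [map_smul]; exact hne.smul s
  have hs' : ∀ s : ℝ, IsNilpotent (LieAlgebra.ad ℝ 𝔤 (s • f)) := fun s => by
    rw [map_smul]; exact hnf.smul s
  set u : ℝ := √t with hu
  have hu0 : u ≠ 0 := (Real.sqrt_pos.2 ht).ne'
  have hut : u * u = t := Real.mul_self_sqrt ht.le
  -- With `u = √t`, the parameters are such that `φ` sends `-u a` to `e - u a`, and `ψ` sends this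
  -- to `e + t f`. Both fix `ker χ`, which commutes with `e` and `f`.
  obtain ⟨φ, hφ⟩ := exists_lieEquiv_exp (hs (1 / (2 * u)))
  obtain ⟨ψ, hψ⟩ := exists_lieEquiv_exp (hs' (-u))
  have hex : ∀ x : 𝔞, ⁅e, (x : 𝔤)⁆ = -(χ x • e) := fun x => by rw [← lie_skew, he]
  have hfx : ∀ x : 𝔞, ⁅f, (x : 𝔤)⁆ = χ x • f := fun x => by
    rw [← lie_skew, hf, neg_smul, neg_neg]
  have hfe : ⁅f, e⁆ = -(a : 𝔤) := by rw [← lie_skew, ha]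
  have h1 : ∀ x : 𝔞, φ x = x - (1 / (2 * u) * χ x) • e := by
    intro x
    rw [hφ] <;> simp [hex, mul_smul, sub_eq_add_neg]
  have h2 : ∀ x : 𝔞, ψ x = x - (u * χ x) • f := by
    intro x
    rw [hψ] <;> simp [hfx, mul_smul, sub_eq_add_neg]
  have h3 : ψ e = e + u • (a : 𝔤) - t • f := by
    rw [hψ] <;> simp [hfe, hfx, hχ, ← hut, smul_smul, sub_eq_add_neg]
    congr 1
    ring
  refine ⟨(𝔞.map φ.toLieHom).map ψ.toLieHom, (h.map φ).map ψ, ?_, ?_, fun x hx => ?_⟩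
  · refine Eq.trans ?_ (LinearEquiv.finrank_eq (φ.toLinearEquiv.submoduleMap 𝔞.toSubmodule)).symm
    exact (LinearEquiv.finrank_eq (ψ.toLinearEquiv.submoduleMap
      (𝔞.map φ.toLieHom).toSubmodule)).symm
  · refine ⟨_, ⟨((-u) • a : 𝔞), ((-u) • a : 𝔞).2, rfl⟩, ?_⟩
    change ψ (φ ((-u) • a : 𝔞)) = _
    have h4 : (((-u) • a : 𝔞) : 𝔤) = (-u) • (a : 𝔤) := rfl
    rw [h1, map_sub, h2, map_smul ψ, h3, map_smul, hχ, h4]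
    have h5 : 1 / (2 * u) * (-u * 2) = -1 := by field_simp
    have h6 : u * (-u * 2) = - (2 * t) := by rw [← hut]; ring
    simp only [smul_eq_mul]
    rw [h5, h6]
    module
  · refine ⟨x, ⟨x, x.2, ?_⟩, ?_⟩
    · change φ x = x
      rw [h1, hx]; simp
    · change ψ x = x
      rw [h2, hx]; simp

theorem killingForm_nonneg_of_mem_chabauty {r : ℕ} {V : Gr 𝔤 r} (hV : V ∈ chabauty 𝔤 r) :
    ∀ x ∈ V.1, 0 ≤ killingForm ℝ 𝔤 x x := by
  refine closure_minimal (t := {V : Gr 𝔤 r | ∀ x ∈ V.1, 0 ≤ killingForm ℝ 𝔤 x x}) ?_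
    (isClosed_nonneg _) hV
  rintro V ⟨𝔟, h𝔟, hV⟩ x hx
  rw [← hV] at hx
  exact killingForm_self_nonneg (h𝔟.isSplitElement hx)

theorem not_isZariskiClosed_chabauty [LieAlgebra.IsKilling ℝ 𝔤] [Nontrivial 𝔤] (hnc : NoCompactFactor 𝔤)
    (h : IsCartanSubspace 𝔞) : ¬ IsZariskiClosed (chabauty 𝔤 (finrank ℝ 𝔞)) := by
  intro hcl
  obtain ⟨χ, e, f, a, he, hf, ha, hχ, hneg⟩ := h.exists_triple hnc
  obtain ⟨k, hk⟩ : ∃ k, finrank ℝ 𝔞 = k + 1 := by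
    have : Nontrivial 𝔞 := ⟨a, 0, fun h0 => by simp [h0] at hχ⟩
    exact Nat.exists_eq_succ_of_ne_zero finrank_pos.ne'
  rw [hk] at hcl
  have hker : finrank ℝ (LinearMap.ker χ) = k := by
    have h1 := LinearMap.finrank_range_add_finrank_ker χ
    have h2 : LinearMap.range χ = ⊤ :=
      LinearMap.range_eq_top.2 (LinearMap.surjective fun h0 => by simp [h0] at hχ)
    rw [h2, finrank_top, finrank_self, hk] at h1
    omega
  let b := finBasisOfFinrankEq ℝ (LinearMap.ker χ) hker
  let v : Fin k → 𝔤 := fun i => ((b i : 𝔞) : 𝔤)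
  have hv : LinearIndependent ℝ v := by
    refine (b.linearIndependent.map' (𝔞.toSubmodule.subtype ∘ₗ (LinearMap.ker χ).subtype) ?_)
    exact LinearMap.ker_eq_bot.2
      (𝔞.toSubmodule.injective_subtype.comp (LinearMap.ker χ).injective_subtype)
  have hupd : ∀ t : ℝ, Function.update (Fin.cons 0 v : Fin (k + 1) → 𝔤) 0 (e + t • f) =
      Fin.cons (e + t • f) v := fun t => Fin.update_cons_zero _ _ _
  -- Bracketing with `a` gives `2 (e - t f)`; if this vanished, `e` and `f` would be proportional
  -- and `a = [e, f]` would be zero.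
  have hnot : ∀ t : ℝ, e + t • f ∉ 𝔞 := by
    intro t ht
    have h1 : ⁅(a : 𝔤), e + t • f⁆ = 0 := h.lie_eq_zero a.2 ht
    rw [lie_add, lie_smul, he, hf, hχ] at h1
    have h2 : e = t • f := by
      have : (2 : ℝ) • (e - t • f) = 0 := by rw [← h1]; module
      exact sub_eq_zero.1 ((smul_eq_zero.1 this).resolve_left two_ne_zero)
    rw [h2, smul_lie, lie_self, smul_zero] at ha
    have : a = 0 := Subtype.ext ha.symm
    simp [this] at hχ
  have hli : ∀ t : ℝ, LinearIndependent ℝ (Function.update (Fin.cons 0 v) 0 (e + t • f)) := by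
    intro t
    rw [hupd, linearIndependent_finCons]
    refine ⟨hv, fun hmem => hnot t ?_⟩
    refine (Submodule.span_le (p := 𝔞.toSubmodule)).2 ?_ hmem
    rintro _ ⟨i, rfl⟩
    exact (b i : 𝔞).2
  have hpos : ∀ t : ℝ, 0 < t → Frame.span ⟨_, hli t⟩ ∈ chabauty 𝔤 (k + 1) := by
    intro t ht
    obtain ⟨𝔟, h𝔟, hfin, htb, hkb⟩ := h.exists_rotate he hf ha hχ ht
    refine subset_closure ⟨𝔟, h𝔟, (Submodule.eq_of_le_of_finrank_eq ?_ ?_).symm⟩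
    · refine Submodule.span_le.2 ?_
      rintro _ ⟨i, rfl⟩
      change Function.update (Fin.cons 0 v : Fin (k + 1) → 𝔤) 0 (e + t • f) i ∈ 𝔟
      rw [hupd]
      exact Fin.cases htb (fun i => hkb (b i) (b i).2) i
    · rw [(Frame.span ⟨_, hli t⟩).2]
      exact (hfin.trans hk).symm
  -- All `t > 0` give Cartan subspaces, and `t = -1` brings in the vector `e - f` of negative norm.
  have hmem := hcl.span_update_mem (s := -1) ((Set.Ioi_infinite (0 : ℝ)).mono
    fun t ht => ⟨hli t, hpos t ht⟩) (hli (-1))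
  have h1 := killingForm_nonneg_of_mem_chabauty hmem (e - f) (Submodule.subset_span ⟨0, by
    simp [sub_eq_add_neg]⟩)
  exact absurd hneg (not_lt.2 h1)

end NotZariskiClosed

end CartanGr

namespace CartanGr

attribute [local instance 100] LieRing.ofAssociativeRing

/-! ### Limits along affine curves of frames -/

section Curves

variable {W : Type*} [AddCommGroup W] [Module ℝ W] [FiniteDimensional ℝ W] {r : ℕ}

theorem Frame.span_mem_closure_of_forall_pos {S : Set (Gr W r)} (v : Frame W r) (w : Fin r → W)
    (h : ∀ t : ℝ, 0 < t → ∃ h : LinearIndependent ℝ (v.1 + t • w), Frame.span ⟨_, h⟩ ∈ S) :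
    v.span ∈ closure S := by
  rw [Frame.span_mem_closure_iff]
  let _ : TopologicalSpace (Fin r → W) := moduleTopology ℝ (Fin r → W)
  have : IsModuleTopology ℝ (Fin r → W) := ⟨rfl⟩
  have : ContinuousAdd (Fin r → W) := IsModuleTopology.toContinuousAdd ℝ _
  have hc : Continuous fun t : ℝ => v.1 + t • w :=
    continuous_const.add (continuous_id.smul continuous_const)
  have ht : Filter.Tendsto (fun t : ℝ => v.1 + t • w) (nhdsWithin 0 (Set.Ioi 0)) (nhds v.1) := by
    have := (hc.tendsto 0).mono_left (nhdsWithin_le_nhds (s := Set.Ioi 0))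
    simpa using this
  exact mem_closure_of_tendsto ht (Filter.eventually_of_mem self_mem_nhdsWithin fun t => h t)

end Curves

/-! ### The case of `𝔰𝔩₂(ℝ)` -/

section SpecialLinear

theorem sl2_apply_one_one (x : sl2) : x.1 1 1 = -x.1 0 0 := by
  have : Matrix.trace x.1 = 0 := x.2
  rw [Matrix.trace_fin_two] at this
  linarith

theorem sl2_ext {x y : sl2} (h1 : x.1 0 0 = y.1 0 0) (h2 : x.1 0 1 = y.1 0 1)
    (h3 : x.1 1 0 = y.1 1 0) : x = y := by
  have := sl2_apply_one_one x
  have := sl2_apply_one_one y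
  apply Subtype.ext
  ext i j
  fin_cases i <;> fin_cases j <;> simp_all

theorem sl2_lie_apply (x y : sl2) (i j : Fin 2) : ⁅x, y⁆.1 i j =
    x.1 i 0 * y.1 0 j + x.1 i 1 * y.1 1 j - (y.1 i 0 * x.1 0 j + y.1 i 1 * x.1 1 j) := by
  rw [LieSubalgebra.coe_bracket, Ring.lie_def, Matrix.sub_apply, Matrix.mul_apply,
    Matrix.mul_apply, Fin.sum_univ_two, Fin.sum_univ_two]

/-- Half the trace form of `𝔰𝔩₂(ℝ)`; its quadratic form is the opposite of the determinant. -/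
noncomputable def sl2Form : sl2 →ₗ[ℝ] sl2 →ₗ[ℝ] ℝ :=
  LinearMap.mk₂ ℝ (fun x y => x.1 0 0 * y.1 0 0 + (x.1 0 1 * y.1 1 0 + x.1 1 0 * y.1 0 1) / 2)
    (fun x y z => by
      simp only [AddMemClass.coe_add, Matrix.add_apply]; ring)
    (fun c x y => by
      simp only [SetLike.val_smul, Matrix.smul_apply, smul_eq_mul]; ring)
    (fun x y z => by
      simp only [AddMemClass.coe_add, Matrix.add_apply]; ring)
    (fun c x y => by
      simp only [SetLike.val_smul, Matrix.smul_apply, smul_eq_mul]; ring)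

theorem sl2Form_self (x : sl2) : sl2Form x x = x.1 0 0 ^ 2 + x.1 0 1 * x.1 1 0 := by
  change x.1 0 0 * x.1 0 0 + (x.1 0 1 * x.1 1 0 + x.1 1 0 * x.1 0 1) / 2 = _
  ring

theorem charpoly_splits_iff (x : sl2) : x.1.charpoly.Splits ↔ 0 ≤ sl2Form x x := by
  open Polynomial in
  have h : x.1.charpoly = X ^ 2 - C (sl2Form x x) := by
    have ht : Matrix.trace x.1 = 0 := x.2
    rw [Matrix.charpoly_fin_two, ht, Matrix.det_fin_two, sl2_apply_one_one, sl2Form_self]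
    have h1 : x.1 0 0 * -x.1 0 0 - x.1 0 1 * x.1 1 0 =
      -(x.1 0 0 ^ 2 + x.1 0 1 * x.1 1 0) := by ring
    rw [h1, C_neg, C_0]
    ring
  rw [h]
  constructor
  · intro hs
    obtain ⟨c, hc⟩ := hs.exists_eval_eq_zero (by
      rw [Polynomial.degree_X_pow_sub_C (by norm_num)]; norm_num)
    simp only [Polynomial.eval_sub, Polynomial.eval_pow, Polynomial.eval_X,
      Polynomial.eval_C] at hc
    nlinarith [sq_nonneg c]
  · intro h0
    rw [← Real.sq_sqrt h0, Polynomial.C_pow, sq_sub_sq]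
    exact .mul (.X_add_C _) (.X_sub_C _)

/-- `ad x` has eigenvalues `0` and `± 2 √(-det x)`, whence the cubic relation. It decides splitness
by the sign of the form alone. -/
theorem sl2_lie_lie_lie (x v : sl2) : ⁅x, ⁅x, ⁅x, v⁆⁆⁆ = (4 * sl2Form x x) • ⁅x, v⁆ := by
  have hx := sl2_apply_one_one x
  have hv := sl2_apply_one_one v
  rw [sl2Form_self]
  apply sl2_ext <;>
    simp only [SetLike.val_smul, Matrix.smul_apply, smul_eq_mul, sl2_lie_apply, hx, hv] <;> ring

theorem isSplitElement_zero {𝔤 : Type*} [LieRing 𝔤] [LieAlgebra ℝ 𝔤] :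
    IsSplitElement (0 : 𝔤) := by
  rw [IsSplitElement, eq_top_iff]
  exact fun v _ => Submodule.mem_iSup_of_mem 0 (by simp)

theorem isSplitElement_of_sl2Form_pos {x : sl2} (hx : 0 < sl2Form x x) : IsSplitElement x := by
  open Polynomial in
  set s := √(sl2Form x x) with hs
  have hs0 : 0 < s := Real.sqrt_pos.2 hx
  have hss : s ^ 2 = sl2Form x x := Real.sq_sqrt hx.le
  refine iSup_eigenspace_eq_top_of_aeval_prod (s := {0, 2 * s, -(2 * s)}) ?_
  have h1 : ∏ a ∈ ({0, 2 * s, -(2 * s)} : Finset ℝ), (X - C a) =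
      X ^ 3 - C (4 * sl2Form x x) * X := by
    rw [Finset.prod_insert, Finset.prod_insert, Finset.prod_singleton, ← hss]
    · simp only [C_mul, C_neg, C_0, C_pow, C_ofNat]
      ring
    · simp only [Finset.mem_singleton]; linarith
    · simp only [Finset.mem_insert, Finset.mem_singleton, not_or]
      constructor <;> linarith
  rw [h1]
  ext v : 1
  have := sl2_lie_lie_lie x v
  simpa [pow_succ, Module.algebraMap_end_apply, sub_eq_zero, smul_smul, mul_comm] using this

/-- The diagonal matrix with entries `1` and `-1`. -/
def sl2Diag : sl2 := ⟨!![1, 0; 0, -1], by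
  change Matrix.trace (_ : Matrix (Fin 2) (Fin 2) ℝ) = 0
  rw [Matrix.trace_fin_two]; simp⟩

/-- The elementary nilpotent upper triangular matrix. -/
def sl2Upper : sl2 := ⟨!![0, 1; 0, 0], by
  change Matrix.trace (_ : Matrix (Fin 2) (Fin 2) ℝ) = 0
  rw [Matrix.trace_fin_two]; simp⟩

theorem exists_smul_eq_of_lie_eq_zero {x y : sl2} (hx : x ≠ 0) (h : ⁅y, x⁆ = 0) :
    ∃ c : ℝ, c • x = y := by
  have hx1 := sl2_apply_one_one x
  have hy1 := sl2_apply_one_one y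
  have h0 := fun i j => congrArg (fun z : sl2 => z.1 i j) h
  have h00 : ⁅y, x⁆.1 0 0 = 0 := h0 0 0
  have h01 : ⁅y, x⁆.1 0 1 = 0 := h0 0 1
  have h10 : ⁅y, x⁆.1 1 0 = 0 := h0 1 0
  rw [sl2_lie_apply] at h00 h01 h10
  rw [hx1, hy1] at h01 h10
  by_cases ha : x.1 0 0 = 0
  · by_cases hb : x.1 0 1 = 0
    · have hc : x.1 1 0 ≠ 0 := fun hc => hx (sl2_ext ha hb hc)
      refine ⟨y.1 1 0 / x.1 1 0, sl2_ext ?_ ?_ ?_⟩ <;>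
        simp only [SetLike.val_smul, Matrix.smul_apply, smul_eq_mul] <;> field_simp <;> linarith
    · refine ⟨y.1 0 1 / x.1 0 1, sl2_ext ?_ ?_ ?_⟩ <;>
        simp only [SetLike.val_smul, Matrix.smul_apply, smul_eq_mul] <;> field_simp <;> linarith
  · refine ⟨y.1 0 0 / x.1 0 0, sl2_ext ?_ ?_ ?_⟩ <;>
      simp only [SetLike.val_smul, Matrix.smul_apply, smul_eq_mul] <;> field_simp <;> linarith

/-- If the form is not positive, the cubic relation leaves `0` as the only real eigenvalue of `ad
x`. A split `x` is then central, and two non-proportional matrices would both be multiples of it. -/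
theorem sl2Form_pos_of_isSplitElement {x : sl2} (hx : IsSplitElement x) (hx0 : x ≠ 0) :
    0 < sl2Form x x := by
  by_contra! hneg
  have htop : (LieAlgebra.ad ℝ sl2 x).eigenspace 0 = ⊤ := by
    rw [eq_top_iff, ← hx]
    refine iSup_le fun μ v hv => ?_
    rw [End.mem_eigenspace_iff, LieAlgebra.ad_apply] at hv
    have h3 := sl2_lie_lie_lie x v
    rw [hv, lie_smul, hv, lie_smul, lie_smul, hv, smul_smul, smul_smul, smul_smul, ← sub_eq_zero,
      ← sub_smul, smul_eq_zero] at h3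
    rw [End.mem_eigenspace_iff, LieAlgebra.ad_apply, hv]
    rcases h3 with h3 | rfl
    · have : μ = 0 := by
        by_contra hμ
        have h4 : μ * (μ ^ 2 - 4 * sl2Form x x) = 0 := by linarith
        have h5 := (mul_eq_zero.1 h4).resolve_left hμ
        have := pow_pos (abs_pos.2 hμ) 2
        rw [sq_abs] at this
        linarith
      rw [this]
    · simp
  have hz : ∀ v : sl2, ⁅x, v⁆ = 0 := fun v => by
    have : v ∈ (LieAlgebra.ad ℝ sl2 x).eigenspace 0 := htop ▸ Submodule.mem_top
    simpa using this
  have hz' : ∀ v : sl2, ⁅v, x⁆ = 0 := fun v => by rw [← lie_skew, hz, neg_zero]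
  obtain ⟨c, hc⟩ := exists_smul_eq_of_lie_eq_zero hx0 (hz' sl2Diag)
  obtain ⟨d, hd⟩ := exists_smul_eq_of_lie_eq_zero hx0 (hz' sl2Upper)
  have h1 : c * x.1 0 0 = 1 := congrArg (fun z : sl2 => z.1 0 0) hc
  have h2 : c * x.1 0 1 = 0 := congrArg (fun z : sl2 => z.1 0 1) hc
  have h3 : d * x.1 0 1 = 1 := congrArg (fun z : sl2 => z.1 0 1) hd
  rcases mul_eq_zero.1 h2 with h | h <;> simp [h] at h1 h3

theorem sl2Form_nonneg_of_isSplitElement {x : sl2} (hx : IsSplitElement x) :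
    0 ≤ sl2Form x x := by
  by_cases h0 : x = 0
  · simp [h0]
  · exact (sl2Form_pos_of_isSplitElement hx h0).le

theorem sl2Form_add_smul_diag (x : sl2) (t : ℝ) :
    sl2Form (x + t • sl2Diag) (x + t • sl2Diag) = sl2Form x x + 2 * t * x.1 0 0 + t ^ 2 := by
  have h1 : ∀ i j, (x + t • sl2Diag).1 i j = x.1 i j + t * sl2Diag.1 i j := fun _ _ => rfl
  rw [sl2Form_self, sl2Form_self, h1, h1, h1]
  simp [sl2Diag]
  ring

theorem sl2Form_diag_pos : 0 < sl2Form sl2Diag sl2Diag := by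
  rw [sl2Form_self]
  simp [sl2Diag]

theorem finrank_eq_one_of_isCartanSubspace {𝔞 : LieSubalgebra ℝ sl2} (h : IsCartanSubspace 𝔞) :
    finrank ℝ 𝔞 = 1 := by
  obtain ⟨x, hx, hx0⟩ : ∃ x ∈ 𝔞, x ≠ 0 := by
    by_contra! hcon
    have hd := isSplitElement_of_sl2Form_pos sl2Form_diag_pos
    have h0 := sl2Form_diag_pos
    rw [hcon _ (h.mem_of_isSplitElement hd fun x hx => by simp [hcon x hx])] at h0
    simp at h0
  refine (finrank_eq_one_iff_of_nonzero' (⟨x, hx⟩ : 𝔞) fun h0 => hx0 (congrArg Subtype.val h0)).2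
    fun y => ?_
  obtain ⟨c, hc⟩ := exists_smul_eq_of_lie_eq_zero hx0 (h.lie_eq_zero y.2 hx)
  exact ⟨c, Subtype.ext hc⟩

theorem span_mem_cartan_sl2 (v : Frame sl2 1) (hv : 0 < sl2Form (v.1 0) (v.1 0)) :
    v.span ∈ cartan sl2 1 := by
  have hs : ∀ c : ℝ, IsSplitElement (c • v.1 0) := by
    intro c
    by_cases hc : c = 0
    · simpa [hc] using isSplitElement_zero
    · refine isSplitElement_of_sl2Form_pos ?_
      rw [map_smul, map_smul, LinearMap.smul_apply, smul_smul, smul_eq_mul]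
      exact mul_pos (mul_self_pos.2 hc) hv
  rw [span_mem_cartan_iff]
  refine ⟨fun i j => ?_, fun c => ?_, fun x hx _ => ?_⟩
  · rw [Subsingleton.elim i j, lie_self]
  · rw [Fin.sum_univ_one]
    exact hs _
  · obtain ⟨c, hc⟩ := exists_smul_eq_of_lie_eq_zero (v.2.ne_zero 0) (hx 0)
    exact ⟨fun _ => c, by rwa [Fin.sum_univ_one]⟩

theorem linearIndependent_of_sl2Form_pos {v : Fin 1 → sl2} (hv : 0 < sl2Form (v 0) (v 0)) :
    LinearIndependent ℝ v := by
  refine linearIndependent_unique_iff.2 fun h0 => hv.ne' ?_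
  have h0 : v 0 = 0 := h0
  simp [h0]

theorem chabauty_sl2 : chabauty sl2 1 = {V : Gr sl2 1 | ∀ x ∈ V.1, x.1.charpoly.Splits} := by
  simp only [charpoly_splits_iff]
  apply Set.Subset.antisymm
  · refine closure_minimal ?_ (isClosed_nonneg _)
    rintro V ⟨𝔞, h𝔞, hV⟩ x hx
    rw [← hV] at hx
    exact sl2Form_nonneg_of_isSplitElement (h𝔞.isSplitElement hx)
  · intro V hV
    obtain ⟨v, rfl⟩ := Frame.span_surjective V
    have hx := hV (v.1 0) (Submodule.subset_span ⟨0, rfl⟩)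
    -- With this sign, moving by `t ε` along the diagonal matrix adds `2 t ε x₀₀ + t² > 0` to a
    -- nonnegative value of the form, for every `t > 0`.
    obtain ⟨ε, hε, hεx⟩ : ∃ ε : ℝ, ε ^ 2 = 1 ∧ 0 ≤ ε * (v.1 0).1 0 0 := by
      rcases le_total 0 ((v.1 0).1 0 0) with h | h
      · exact ⟨1, by norm_num, by simpa⟩
      · exact ⟨-1, by norm_num, by simpa⟩
    refine v.span_mem_closure_of_forall_pos (fun _ => ε • sl2Diag) fun t ht => ?_
    have hpos : 0 < sl2Form (v.1 0 + t • ε • sl2Diag) (v.1 0 + t • ε • sl2Diag) := by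
      rw [smul_smul, sl2Form_add_smul_diag, mul_pow, hε]
      have := mul_nonneg ht.le hεx
      have := pow_pos ht 2
      linarith
    exact ⟨linearIndependent_of_sl2Form_pos hpos, span_mem_cartan_sl2 ⟨_, _⟩ hpos⟩

theorem zariskiClosure_cartan_sl2 : zariskiClosure (cartan sl2 1) = Set.univ := by
  refine Set.eq_univ_of_forall fun V => Set.mem_sInter.2 ?_
  rintro T ⟨hT, hsub⟩
  obtain ⟨v, rfl⟩ := Frame.span_surjective V
  have hupd : Function.update v.1 0 (v.1 0 + (0 : ℝ) • sl2Diag) = v.1 := by simp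
  have hli : LinearIndependent ℝ (Function.update v.1 0 (v.1 0 + (0 : ℝ) • sl2Diag)) :=
    hupd.symm ▸ v.2
  have hmem := hT.span_update_mem ?_ hli
  · have : (⟨_, hli⟩ : Frame sl2 1) = v := Subtype.ext hupd
    rwa [this] at hmem
  · set a := (v.1 0).1 0 0
    set q := sl2Form (v.1 0) (v.1 0)
    -- The line sits at `t = 0` of the pencil directed by the diagonal matrix. Beyond this bound
    -- `t²` dominates in `q + 2 t a + t²`, so the member is a Cartan subspace.
    refine (Set.Ioi_infinite (1 + 2 * |a| + |q|)).mono fun t ht => ?_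
    have ht : 1 + 2 * |a| + |q| < t := ht
    have hpos : 0 < sl2Form (Function.update v.1 0 (v.1 0 + t • sl2Diag) 0)
        (Function.update v.1 0 (v.1 0 + t • sl2Diag) 0) := by
      rw [Function.update_self, sl2Form_add_smul_diag]
      change 0 < q + 2 * t * a + t ^ 2
      have h1 := neg_abs_le a
      have h2 := neg_abs_le q
      have h3 := abs_nonneg a
      have h4 := abs_nonneg q
      nlinarith [mul_nonneg (by linarith : 0 ≤ t) (by linarith : 0 ≤ a + |a|)]
    exact ⟨linearIndependent_of_sl2Form_pos hpos, hsub (span_mem_cartan_sl2 _ hpos)⟩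

end SpecialLinear

end CartanGr

theorem proposition3p2 :
    (∀ (𝔤 : Type*) [LieRing 𝔤] [LieAlgebra ℝ 𝔤] [FiniteDimensional ℝ 𝔤] [Nontrivial 𝔤]
        [LieAlgebra.IsSemisimple ℝ 𝔤], CartanGr.NoCompactFactor 𝔤 →
      ∀ (𝔞 : LieSubalgebra ℝ 𝔤), CartanGr.IsCartanSubspace 𝔞 →
      ∀ r : ℕ, r = Module.finrank ℝ 𝔞 →
        CartanGr.IsSemialgebraicGr (CartanGr.chabauty 𝔤 r) ∧
        ¬ CartanGr.IsZariskiClosed (CartanGr.chabauty 𝔤 r)) ∧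
    (∀ 𝔞 : LieSubalgebra ℝ CartanGr.sl2,
      CartanGr.IsCartanSubspace 𝔞 → Module.finrank ℝ 𝔞 = 1) ∧
    CartanGr.chabauty CartanGr.sl2 1 =
      {V : CartanGr.Gr CartanGr.sl2 1 | ∀ x ∈ V.1, (x : Matrix (Fin 2) (Fin 2) ℝ).charpoly.Splits} ∧
    CartanGr.zariskiClosure (CartanGr.cartan CartanGr.sl2 1) = Set.univ := by
  refine ⟨?_, fun 𝔞 h => CartanGr.finrank_eq_one_of_isCartanSubspace h, CartanGr.chabauty_sl2,
    CartanGr.zariskiClosure_cartan_sl2⟩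
  rintro 𝔤 _ _ _ _ _ hnc 𝔞 h𝔞 r rfl
  exact ⟨(CartanGr.isSemialgebraicGr_cartan _).closure,
    -- Nondegeneracy of the Killing form is inferred from semisimplicity by instance search
    -- (Cartan's criterion).
    CartanGr.not_isZariskiClosed_chabauty hnc h𝔞⟩
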